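/- Let $X=(V,E,\partial,\ell)$ be a metric graph (loops and multiple edges allowed) whose edge lengths satisfy $\ell_e\ge\ell_0$ for some $\ell_0>0$; the edge $e$ is identified with $(0,\ell_e)$, running from $\partial_-e$ to $\partial_+e$. For $v\in V$ let $E_v$ be the disjoint union of the set of edges ending at $v$ and the set of edges starting at $v$, and put $$\mathcal G^{\max}=\bigoplus_{v}\mathbb C^{E_v},\quad \|F\|^2=\sum_v\sum_{e\in E_v}|F_e(v)|^2,\qquad \ell^2(E):\ \|\eta\|^2=\sum_e|\eta_e|^2/\ell_e,\qquad L^2(X)=\bigoplus_e L^2(0,\ell_e).$$ Let $H^1_{\max}(X)=\bigoplus_eH^1(0,\ell_e)$ (functions in $L^2(X)$ that are absolutely continuous on every edge with derivative in $L^2(X)$), let $\underline f=\{f_e(v)\}\in\mathcal G^{\max}$ be the vertex evaluation of $f\in H^1_{\max}(X)$ ($f_e(\partial_-e)=f_e(0)$, $f_e(\partial_+e)=f_e(\ell_e)$), and $(\int g)_e=\int_0^{\ell_e}g_e\,dx$. Let $\mathcal G\subset\mathcal G^{\max}$ be a vertex space (a closed subspace) with orthogonal projection $P$, and let $L\ge0$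 be a bounded operator on $\mathcal G$. Put $H^1_{\mathcal G}(X)=\{f\in H^1_{\max}(X):\underline f\in\mathcal G\}$, $\mathcal G_0=\ker L$, $\mathcal G_1=\mathcal G\ominus\ker L$, let $\perp$ denote complements in $\mathcal G^{\max}$, and let $P_i,P_i^\perp$ be the projections onto $\mathcal G_i,\mathcal G_i^\perp$. For a closed subspace $\mathcal H\subset\mathcal G^{\max}$ let $\mathsf d_{\mathcal H}:\mathcal H\to\ell^2(E)$, $(\mathsf d_{\mathcal H}F)_e=F_e(\partial_+e)-F_e(\partial_-e)$ (a bounded operator). Consider the following exterior derivatives $d$ (with Hilbert space adjoint $d^*$), discrete exterior derivatives $\mathsf d$, and maps $\Phi_0$ on $\operatorname{dom}d$, $\Phi_1$ on $\operatorname{dom}d^*$. 1. Simple: $d f=f'$ in $L^2(X)$ on $\operatorname{dom}d=H^1_{\mathcal G}(X)$; $\mathsf d=\mathsf d_{\mathcal G}:\mathcal G\to\ell^2(E)$; $\Phi_0f=\underline f$, $\Phi_1g=\int g$. 2. 0-enlarged: $d(f,F)=f'$ from $L^2(X)\oplus\mathcal G$ to $L^2(X)$ on $\{(f,F):f\in H^1_{\mathcal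 G}(X),\ \underline f=L^{1/2}F\}$; $\mathsf d:\mathcal G_1\oplus\mathcal G_0\to\ell^2(E)$, $F_1\oplus F_0\mapsto\mathsf d_{\mathcal G_1}F_1$; $\Phi_0(f,F)=(P_1\underline f,P_0F)$, $\Phi_1g=\int g$. 3. 0-enlarged with projection: $d(f,F)=f'$ from $L^2(X)\oplus\mathcal G$ to $L^2(X)$ on $\{(f,F):f\in H^1_{\max}(X),\ P\underline f=L^{1/2}F\}$; $\mathsf d:\mathcal G_0^\perp\oplus\mathcal G_0\to\ell^2(E)$, $F_0^\perp\oplus F_0\mapsto\mathsf d_{\mathcal G_0^\perp}F_0^\perp$; $\Phi_0(f,F)=(P_0^\perp\underline f,P_0F)$, $\Phi_1g=\int g$. 4. 1-enlarged: $df=(f',L^{1/2}P\underline f)$ from $L^2(X)$ to $L^2(X)\oplus\mathcal G$ on $H^1_{\max}(X)$; $\mathsf d:\mathcal G_1^\perp\to\mathcal G_0\oplus\ell^2(E)$, $F\mapsto0\oplus\mathsf d_{\mathcal G_1^\perp}F$; $\Phi_0f=P_1^\perp\underline f$, $\Phi_1(g,G)=(P_0G,\int g)$. 5. 1-enlarged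 with projection: $df=(f',L^{1/2}\underline f)$ from $L^2(X)$ to $L^2(X)\oplus\mathcal G$ on $H^1_{\mathcal G}(X)$; $\mathsf d:\mathcal G_0\to\mathcal G_0\oplus\ell^2(E)$, $F\mapsto0\oplus\mathsf d_{\mathcal G_0}F$; $\Phi_0f=P_0\underline f$, $\Phi_1(g,G)=(P_0G,\int g)$. Let $D(\omega_0,\omega_1)=(d^*\omega_1,d\omega_0)$ on $\operatorname{dom}d\oplus\operatorname{dom}d^*$, define $\mathsf D$ from $\mathsf d$ in the same way, and let $\Phi=\Phi_0\oplus\Phi_1$. The index of $D$ is $\operatorname{ind}D=\dim\ker d-\dim\ker d^*$, defined when both kernels are finite dimensional; likewise for $\mathsf D$. Then in each of the five cases: (a) $d$ is closed and densely defined. (b) If $\ell_0\le1$, then $\|\Phi\omega\|\le\frac{2}{\sqrt{\ell_0}}\bigl(\|\omega\|^2+\|f'\|^2\bigr)^{1/2}$ for every $\omega\in\operatorname{dom}D$ with $0$-form function component $f$; in particular $\Phi$ is bounded by $2/\sqrt{\ell_0}$ with respect to the Sobolev ($H^1$) norm on $\operatorname{dom}D$. (c) $\Phi$, $\Phi_0$,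 $\Phi_1$ map $\ker D$, $\ker d$, $\ker d^*$ injectively into $\ker\mathsf D$, $\ker\mathsf d$, $\ker\mathsf d^*$, respectively. (d) $\Phi_0$ restricts to an isomorphism (linear, bounded with bounded inverse) of $\ker d$ onto $\ker\mathsf d$ if $\sup_e\ell_e<\infty$ and, in cases 2 and 3, $L$ has closed range (equivalently, $L$ is invertible on $\mathcal G_1$). $\Phi_1$ restricts to such an isomorphism of $\ker d^*$ onto $\ker\mathsf d^*$ without further hypothesis in cases 1, 2, 3, and if $L$ has closed range in cases 4 and 5. If the hypotheses for both hold, then $\Phi$ restricts to such an isomorphism of $\ker D$ onto $\ker\mathsf D$, and $\operatorname{ind}D=\operatorname{ind}\mathsf D$ (if one of the two indices is defined, so is the other). (e) If $E$ is finite, then $\Phi_0,\Phi_1,\Phi$ restrict to isomorphisms $\ker d\cong\ker\mathsf d$, $\ker d^*\cong\ker\mathsf d^*$, $\ker D\cong\ker\mathsf D$, both indices are defined, and $\operatorname{ind}D=\operatorname{ind}\mathsf D$ equals $$\dim\mathcal G-|E|,\qquad \dim\mathcal G-|E|,\qquad |E|,\qquad |E|-\dim\mathcal G,\qquad -|E|$$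 in cases 1, 2, 3, 4, 5, respectively. -/

import Mathlib

open MeasureTheory Set
open scoped ENNReal InnerProductSpace

noncomputable section

/-! ### Supersymmetry: exterior derivatives, Dirac operators, kernels, indices -/

section Susy

variable {H₀ H₁ K₀ K₁ N : Type*}
  [NormedAddCommGroup H₀] [InnerProductSpace ℂ H₀]
  [NormedAddCommGroup H₁] [InnerProductSpace ℂ H₁]
  [NormedAddCommGroup K₀] [InnerProductSpace ℂ K₀]
  [NormedAddCommGroup K₁] [InnerProductSpace ℂ K₁]
  [NormedAddCommGroup N] [InnerProductSpace ℂ N]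

/-- The kernel of a partially defined operator, as a subspace of the ambient space. -/
def pmapKer (T : H₀ →ₗ.[ℂ] H₁) : Submodule ℂ H₀ :=
  (LinearMap.ker T.toFun).map T.domain.subtype

/-- An everywhere defined bounded operator, seen as a partially defined one. -/
def bddPMap (T : H₀ →L[ℂ] H₁) : H₀ →ₗ.[ℂ] H₁ :=
  (T : H₀ →ₗ[ℂ] H₁).toPMap ⊤

/-- `d` has supersymmetry: it is a densely defined closed operator from `0`-forms to `1`-forms. -/
def IsExteriorDerivative (d : H₀ →ₗ.[ℂ] H₁) : Prop :=
  Dense (d.domain : Set H₀) ∧ d.IsClosed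

/-- The Dirac operator `D (f₀ ⊕ f₁) = d* f₁ ⊕ d f₀` on `dom d ⊕ dom d*`, where `d*` is the
Hilbert space adjoint of `d`. -/
def diracOp [CompleteSpace H₀] (d : H₀ →ₗ.[ℂ] H₁) :
    WithLp 2 (H₀ × H₁) →ₗ.[ℂ] WithLp 2 (H₀ × H₁) where
  domain :=
    { carrier := {x | x.fst ∈ d.domain ∧ x.snd ∈ d.adjoint.domain}
      zero_mem' := ⟨d.domain.zero_mem, d.adjoint.domain.zero_mem⟩
      add_mem' := fun hx hy =>
        ⟨d.domain.add_mem hx.1 hy.1, d.adjoint.domain.add_mem hx.2 hy.2⟩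
      smul_mem' := fun c _ hx =>
        ⟨d.domain.smul_mem c hx.1, d.adjoint.domain.smul_mem c hx.2⟩ }
  toFun :=
    { toFun := fun x => WithLp.toLp 2 (d.adjoint ⟨x.1.snd, x.2.2⟩, d ⟨x.1.fst, x.2.1⟩)
      map_add' := fun x y => by
        rw [← WithLp.toLp_add, Prod.mk_add_mk, ← LinearPMap.map_add, ← LinearPMap.map_add]
        rfl
      map_smul' := fun c x => by
        rw [RingHom.id_apply, ← WithLp.toLp_smul, Prod.smul_mk, ← LinearPMap.map_smul,
          ← LinearPMap.map_smul]
        rfl }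

/-- `Φ = Φ₀ ⊕ Φ₁` on the domain `dom d ⊕ dom d*` of the Dirac operator. -/
def susySum [CompleteSpace H₀] {d : H₀ →ₗ.[ℂ] H₁}
    (Φ₀ : d.domain →ₗ[ℂ] K₀) (Φ₁ : d.adjoint.domain →ₗ[ℂ] K₁) :
    (diracOp d).domain →ₗ[ℂ] WithLp 2 (K₀ × K₁) where
  toFun := fun x => WithLp.toLp 2 (Φ₀ ⟨x.1.fst, x.2.1⟩, Φ₁ ⟨x.1.snd, x.2.2⟩)
  map_add' := fun x y => by
    rw [← WithLp.toLp_add, Prod.mk_add_mk, ← map_add, ← map_add]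
    rfl
  map_smul' := fun c x => by
    rw [RingHom.id_apply, ← WithLp.toLp_smul, Prod.smul_mk, ← map_smul, ← map_smul]
    rfl

/-- The index of the Dirac operator of `d` is defined and equal to `n`: both `ker d` and `ker d*`
are finite dimensional and `dim ker d - dim ker d* = n`. -/
def HasIndex [CompleteSpace H₀] (d : H₀ →ₗ.[ℂ] H₁) (n : ℤ) : Prop :=
  FiniteDimensional ℂ (pmapKer d) ∧ FiniteDimensional ℂ (pmapKer d.adjoint) ∧
    (Module.finrank ℂ (pmapKer d) : ℤ) - (Module.finrank ℂ (pmapKer d.adjoint) : ℤ) = n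

/-- `Φ`, defined on `dom T`, maps `ker T` injectively into `ker S`. -/
def KerEmbedding (T : H₀ →ₗ.[ℂ] H₁) (S : K₀ →ₗ.[ℂ] K₁) (Φ : T.domain →ₗ[ℂ] K₀) : Prop :=
  (∀ x : T.domain, T x = 0 → Φ x ∈ pmapKer S) ∧
    ∀ x y : T.domain, T x = 0 → T y = 0 → Φ x = Φ y → x = y

/-- `Φ`, defined on `dom T`, restricts to an isomorphism (linear, bounded, with bounded inverse)
of `ker T` onto `ker S`. -/
def KerIsomorphism (T : H₀ →ₗ.[ℂ] H₁) (S : K₀ →ₗ.[ℂ] K₁) (Φ : T.domain →ₗ[ℂ] K₀) : Prop :=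
  ∃ ε : pmapKer T ≃L[ℂ] pmapKer S,
    ∀ (x : pmapKer T) (hx : (x : H₀) ∈ T.domain), (ε x : K₀) = Φ ⟨x, hx⟩

/-- The square root `L^{1/2}` of a bounded positive operator (continuous functional calculus). -/
def opSqrt [CompleteSpace H₀] (L : H₀ →L[ℂ] H₀) : H₀ →L[ℂ] H₀ := CFC.sqrt L

/-- The exterior derivative `d` trivially `0`-enlarged by `N`: `f ⊕ h ↦ d f`. -/
def zeroEnlarge (d : K₀ →L[ℂ] K₁) (N : Type*) [NormedAddCommGroup N] [InnerProductSpace ℂ N] :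
    WithLp 2 (K₀ × N) →L[ℂ] K₁ :=
  d.comp (WithLp.fstL 2 ℂ K₀ N)

/-- The exterior derivative `d` trivially `1`-enlarged by `N`: `f ↦ 0 ⊕ d f`. -/
def oneEnlarge (d : K₀ →L[ℂ] K₁) (N : Type*) [NormedAddCommGroup N] [InnerProductSpace ℂ N] :
    K₀ →L[ℂ] WithLp 2 (N × K₁) :=
  ((WithLp.prodContinuousLinearEquiv 2 ℂ N K₁).symm : (N × K₁) →L[ℂ] WithLp 2 (N × K₁)).comp
    ((0 : K₀ →L[ℂ] N).prod d)

end Susy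

/-! ### Sobolev functions on an interval -/

/-- `L²(0, ℓ)`. -/
abbrev IntervalL2 (ℓ : ℝ) : Type := Lp ℂ 2 (volume.restrict (Ioo (0 : ℝ) ℓ))

/-- `f` is (almost everywhere equal to) the absolutely continuous function on `[0, ℓ]` with value
`c` at `0` and with derivative `g`. -/
def IsPrimitive {ℓ : ℝ} (c : ℂ) (g f : IntervalL2 ℓ) : Prop :=
  ∀ᵐ x ∂(volume.restrict (Ioo (0 : ℝ) ℓ)), f x = c + ∫ t in (0 : ℝ)..x, g t

section Interval

variable {ℓ : ℝ}

theorem IntervalL2.integrableOn (g : IntervalL2 ℓ) : IntegrableOn g (Ioo 0 ℓ) :=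
  (Lp.memLp g).integrable (by norm_num)

theorem IntervalL2.intervalIntegrable (hℓ : 0 < ℓ) (g : IntervalL2 ℓ) :
    IntervalIntegrable g volume 0 ℓ :=
  (intervalIntegrable_iff_integrableOn_Ioo_of_le hℓ.le).2 g.integrableOn

theorem IntervalL2.intervalIntegrable' (hℓ : 0 < ℓ) (g : IntervalL2 ℓ) {x y : ℝ}
    (hx : x ∈ Icc 0 ℓ) (hy : y ∈ Icc 0 ℓ) : IntervalIntegrable g volume x y := by
  refine (g.intervalIntegrable hℓ).mono_set ?_
  rw [uIcc_of_le hℓ.le]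
  exact uIcc_subset_Icc hx hy

theorem ae_Ioo_mono {p : ℝ → Prop} {a b x : ℝ} (hx : x ∈ Icc a b)
    (h : ∀ᵐ t ∂(volume.restrict (Ioo a b)), p t) : ∀ᵐ t, t ∈ uIoc a x → p t := by
  have h1 : ∀ᵐ t : ℝ, t ∈ Ioo a b → p t := (ae_restrict_iff' measurableSet_Ioo).1 h
  have h2 : ∀ᵐ t : ℝ, t ≠ b := Measure.ae_ne volume b
  filter_upwards [h1, h2] with t h1 h2 ht
  rw [uIoc_of_le hx.1] at ht
  exact h1 ⟨ht.1, lt_of_le_of_ne (ht.2.trans hx.2) h2⟩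

theorem IsPrimitive.add (hℓ : 0 < ℓ) {c c' : ℂ} {g g' f f' : IntervalL2 ℓ}
    (h : IsPrimitive c g f) (h' : IsPrimitive c' g' f') :
    IsPrimitive (c + c') (g + g') (f + f') := by
  filter_upwards [h, h', Lp.coeFn_add f f', ae_restrict_mem measurableSet_Ioo] with x h1 h2 h3 hx
  have hx' : x ∈ Icc 0 ℓ := ⟨hx.1.le, hx.2.le⟩
  have : ∫ t in (0 : ℝ)..x, (g + g') t = ∫ t in (0 : ℝ)..x, (g t + g' t) :=
    intervalIntegral.integral_congr_ae (ae_Ioo_mono hx' (Lp.coeFn_add g g'))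
  rw [h3, Pi.add_apply, h1, h2, this, intervalIntegral.integral_add
    (g.intervalIntegrable' hℓ ⟨le_rfl, hℓ.le⟩ hx') (g'.intervalIntegrable' hℓ ⟨le_rfl, hℓ.le⟩ hx')]
  ring

theorem IsPrimitive.smul {c : ℂ} {g f : IntervalL2 ℓ} (a : ℂ)
    (h : IsPrimitive c g f) : IsPrimitive (a * c) (a • g) (a • f) := by
  filter_upwards [h, Lp.coeFn_smul a f, ae_restrict_mem measurableSet_Ioo] with x h1 h3 hx
  have hx' : x ∈ Icc 0 ℓ := ⟨hx.1.le, hx.2.le⟩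
  have : ∫ t in (0 : ℝ)..x, (a • g) t = ∫ t in (0 : ℝ)..x, a • g t :=
    intervalIntegral.integral_congr_ae (ae_Ioo_mono hx' (Lp.coeFn_smul a g))
  rw [h3, Pi.smul_apply, h1, this, intervalIntegral.integral_smul, smul_eq_mul, smul_eq_mul]
  ring

theorem isPrimitive_zero : IsPrimitive 0 (0 : IntervalL2 ℓ) 0 := by
  have h := ae_restrict_mem (μ := volume) (s := Ioo (0 : ℝ) ℓ) measurableSet_Ioo
  have h3 := Lp.coeFn_zero ℂ 2 (volume.restrict (Ioo (0 : ℝ) ℓ))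
  filter_upwards [h, h3] with x hx h3
  have hx' : x ∈ Icc 0 ℓ := ⟨hx.1.le, hx.2.le⟩
  have : ∫ t in (0 : ℝ)..x, (0 : IntervalL2 ℓ) t = ∫ t in (0 : ℝ)..x, (0 : ℂ) :=
    intervalIntegral.integral_congr_ae (ae_Ioo_mono hx' (Lp.coeFn_zero ℂ 2 _))
  rw [h3, this]
  simp

/-- The derivative and the boundary value of an absolutely continuous function are unique. -/
theorem IsPrimitive.eq_zero (hℓ : 0 < ℓ) {c : ℂ} {g : IntervalL2 ℓ}
    (h : IsPrimitive c g 0) : c = 0 ∧ g = 0 := by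
  have hint := g.intervalIntegrable hℓ
  have hcont : ContinuousOn (fun x => c + ∫ t in (0 : ℝ)..x, g t) (Icc 0 ℓ) := by
    have := intervalIntegral.continuousOn_primitive_interval' hint left_mem_uIcc
    rw [uIcc_of_le hℓ.le] at this
    exact continuousOn_const.add this
  have hae : (fun x => c + ∫ t in (0 : ℝ)..x, g t)
      =ᵐ[volume.restrict (Icc 0 ℓ)] fun _ => (0 : ℂ) := by
    rw [← Measure.restrict_congr_set (Ioo_ae_eq_Icc (μ := volume) (a := (0 : ℝ)) (b := ℓ))]
    filter_upwards [h, Lp.coeFn_zero ℂ 2 (volume.restrict (Ioo (0 : ℝ) ℓ))] with x h1 h2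
    rw [← h1, h2]; rfl
  have hz := Measure.eqOn_Icc_of_ae_eq volume hℓ.ne hae hcont continuousOn_const
  have hc : c = 0 := by simpa using hz ⟨le_rfl, hℓ.le⟩
  refine ⟨hc, ?_⟩
  rw [Lp.eq_zero_iff_ae_eq_zero]
  have hd := hint.ae_hasDerivAt_integral
  refine (ae_restrict_iff' measurableSet_Ioo).2 ?_
  filter_upwards [hd] with x hx hxm
  have hxm' : x ∈ uIcc 0 ℓ := by
    rw [uIcc_of_le hℓ.le]; exact ⟨hxm.1.le, hxm.2.le⟩
  have h1 := hx hxm' 0 left_mem_uIcc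
  have h2 : HasDerivAt (fun x => ∫ t in (0 : ℝ)..x, g t) 0 x := by
    refine (hasDerivAt_const x (0 : ℂ)).congr_of_eventuallyEq ?_
    filter_upwards [Ioo_mem_nhds hxm.1 hxm.2] with y hy
    have := hz ⟨hy.1.le, hy.2.le⟩
    simpa [hc] using this
  exact h1.unique h2

theorem IsPrimitive.unique (hℓ : 0 < ℓ) {c c' : ℂ} {g g' f : IntervalL2 ℓ}
    (h : IsPrimitive c g f) (h' : IsPrimitive c' g' f) : c = c' ∧ g = g' := by
  have h0 := h.add hℓ (h'.smul (-1))
  rw [neg_one_smul, neg_one_smul, add_neg_cancel] at h0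
  obtain ⟨h1, h2⟩ := h0.eq_zero hℓ
  exact ⟨by linear_combination h1, by rwa [add_neg_eq_zero] at h2⟩


theorem norm_setIntegral_sq_le {s : Set ℝ} (hs : MeasurableSet s) (hsub : s ⊆ Ioo 0 ℓ)
    (g : IntervalL2 ℓ) : ‖∫ t in s, g t‖ ^ 2 ≤ volume.real s * ‖g‖ ^ 2 := by
  have hfin : (volume.restrict (Ioo (0 : ℝ) ℓ)) s ≠ ∞ := measure_ne_top _ s
  have h1 := L2.inner_indicatorConstLp_one (𝕜 := ℂ) hs hfin g
  have h2 : (volume.restrict (Ioo (0 : ℝ) ℓ)).restrict s = volume.restrict s := by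
    rw [Measure.restrict_restrict hs, inter_eq_self_of_subset_left hsub]
  rw [h2] at h1
  rw [← h1]
  have h3 := norm_inner_le_norm (𝕜 := ℂ)
    (indicatorConstLp 2 hs hfin (1 : ℂ)) g
  have h4 : ‖indicatorConstLp 2 hs hfin (1 : ℂ)‖ ^ 2 = volume.real s := by
    rw [norm_indicatorConstLp (by norm_num) (by norm_num), norm_one, one_mul,
      ← Real.rpow_natCast, ← Real.rpow_mul measureReal_nonneg]
    norm_num
    rw [inter_eq_self_of_subset_left hsub]
  calc _ ≤ (‖indicatorConstLp 2 hs hfin (1 : ℂ)‖ * ‖g‖) ^ 2 := by gcongr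
    _ = _ := by rw [mul_pow, h4]

/-- The trace estimate on an interval. -/
theorem IsPrimitive.norm_value_sq_le {a p y : ℝ} (ha : 0 < a) (hp : 0 ≤ p) (hpl : p + a ≤ ℓ)
    (hy : y ∈ Icc p (p + a)) {c : ℂ} {g f : IntervalL2 ℓ} (h : IsPrimitive c g f) :
    ‖c + ∫ t in (0 : ℝ)..y, g t‖ ^ 2 ≤ 2 / a * ‖f‖ ^ 2 + 2 * a * ‖g‖ ^ 2 := by
  have hℓ : 0 < ℓ := by linarith
  have hy' : y ∈ Icc 0 ℓ := ⟨hp.trans hy.1, hy.2.trans hpl⟩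
  have hsub : Ioo p (p + a) ⊆ Ioo 0 ℓ := Ioo_subset_Ioo hp hpl
  have hvol : volume.real (Ioo p (p + a)) = a := by simp [ha.le]
  set b : ℂ := c + ∫ t in (0 : ℝ)..y, g t with hb
  have hrem : ∀ x ∈ Ioo p (p + a), ‖∫ t in y..x, g t‖ ≤ √a * ‖g‖ := by
    intro x hx
    have hsx : uIoo y x ⊆ Ioo p (p + a) := by
      intro t ht
      rw [uIoo, mem_Ioo] at ht
      have h1 : p ≤ y ⊓ x := le_inf hy.1 hx.1.le
      have h2 : y ⊔ x ≤ p + a := sup_le hy.2 hx.2.le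
      exact ⟨h1.trans_lt ht.1, ht.2.trans_le h2⟩
    have h1 : ‖∫ t in y..x, g t‖ = ‖∫ t in uIoo y x, g t‖ := by
      rw [intervalIntegral.norm_intervalIntegral_eq, uIoc, uIoo, integral_Ioc_eq_integral_Ioo]
    have h2 := norm_setIntegral_sq_le (measurableSet_Ioo : MeasurableSet (uIoo y x))
      (hsx.trans hsub) g
    have h3 : volume.real (uIoo y x) ≤ a := by
      rw [← hvol]
      exact measureReal_mono hsx (by simp)
    rw [h1]
    refine le_of_sq_le_sq ?_ (by positivity)
    rw [mul_pow, Real.sq_sqrt ha.le]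
    exact h2.trans (mul_le_mul_of_nonneg_right h3 (sq_nonneg _))
  have hfx : ∀ᵐ x ∂(volume.restrict (Ioo p (p + a))), b - f x = -∫ t in y..x, g t := by
    filter_upwards [ae_restrict_of_ae_restrict_of_subset hsub h,
      ae_restrict_mem measurableSet_Ioo] with x hx hxm
    have hx' : x ∈ Icc 0 ℓ := ⟨(hsub hxm).1.le, (hsub hxm).2.le⟩
    have h0 : (0 : ℝ) ∈ Icc 0 ℓ := ⟨le_rfl, hℓ.le⟩
    rw [hx, hb, ← intervalIntegral.integral_add_adjacent_intervals
      (g.intervalIntegrable' hℓ h0 hy') (g.intervalIntegrable' hℓ hy' hx')]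
    ring
  have hfi : IntegrableOn f (Ioo p (p + a)) := f.integrableOn.mono_set hsub
  have h1 : ‖∫ x in Ioo p (p + a), (b - f x)‖ ≤ √a * ‖g‖ * a := by
    have := norm_setIntegral_le_of_norm_le_const_ae' (μ := volume) (s := Ioo p (p + a))
      (f := fun x => b - f x) (C := √a * ‖g‖) (by simp) (by
        have h5 := (ae_restrict_iff' measurableSet_Ioo).1 hfx
        filter_upwards [h5] with x hx hxm
        rw [hx hxm, norm_neg]
        exact hrem x hxm)
    rwa [hvol] at this
  have h2 : ∫ x in Ioo p (p + a), (b - f x) = a * b - ∫ x in Ioo p (p + a), f x := by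
    rw [integral_sub (by simp) hfi, setIntegral_const, hvol]
    simp
  have h3 : ‖∫ x in Ioo p (p + a), f x‖ ≤ √a * ‖f‖ := by
    refine le_of_sq_le_sq ?_ (by positivity)
    have := norm_setIntegral_sq_le measurableSet_Ioo hsub f
    rw [hvol] at this
    rw [mul_pow, Real.sq_sqrt ha.le]
    exact this
  have h4 : a * ‖b‖ ≤ √a * (a * ‖g‖ + ‖f‖) := by
    have h5 : (a : ℂ) * b = (∫ x in Ioo p (p + a), (b - f x)) + ∫ x in Ioo p (p + a), f x := by
      rw [h2]; ring
    have h6 : ‖(a : ℂ) * b‖ = a * ‖b‖ := by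
      rw [norm_mul, Complex.norm_real, Real.norm_of_nonneg ha.le]
    rw [← h6, h5]
    refine (norm_add_le _ _).trans ?_
    linarith
  have h7 : (a * ‖b‖) ^ 2 ≤ a * (a * ‖g‖ + ‖f‖) ^ 2 := by
    calc (a * ‖b‖) ^ 2 ≤ (√a * (a * ‖g‖ + ‖f‖)) ^ 2 := by gcongr
      _ = a * (a * ‖g‖ + ‖f‖) ^ 2 := by rw [mul_pow, Real.sq_sqrt ha.le]
  have h8 : a * (a * ‖b‖ ^ 2) ≤ a * (2 * ‖f‖ ^ 2 + 2 * a ^ 2 * ‖g‖ ^ 2) := by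
    nlinarith [mul_nonneg ha.le (sq_nonneg (a * ‖g‖ - ‖f‖))]
  have h9 := le_of_mul_le_mul_left h8 ha
  have h10 : 2 / a * ‖f‖ ^ 2 + 2 * a * ‖g‖ ^ 2
      = (2 * ‖f‖ ^ 2 + 2 * a ^ 2 * ‖g‖ ^ 2) / a := by
    field_simp
  rw [h10, le_div_iff₀ ha]
  linarith

end Interval

/-! ### Metric graphs -/

/-- A metric graph: vertices `V`, (oriented) edges `E` with initial and terminal vertices, and
edge lengths with a positive lower bound.  Loops and multiple edges are allowed.  The edge `e` is
identified with the interval `(0, ℓ_e)`, oriented from its initial to its terminal vertex. -/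
structure MetricGraph (V E : Type*) where
  init : E → V
  term : E → V
  len : E → ℝ
  len_bddBelow : ∃ ℓ₀ : ℝ, 0 < ℓ₀ ∧ ∀ e, ℓ₀ ≤ len e

namespace MetricGraph

variable {V E : Type*} (Γ : MetricGraph V E)

theorem len_pos (e : E) : 0 < Γ.len e := by
  obtain ⟨ℓ₀, h0, h⟩ := Γ.len_bddBelow
  exact h0.trans_le (h e)

/-- `E_v`, the disjoint union of the sets `E_v⁺` (edges ending at `v`) and `E_v⁻` (edges starting
at `v`); a loop at `v` occurs twice. -/
def Star (v : V) : Type _ := {e : E // Γ.term e = v} ⊕ {e : E // Γ.init e = v}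

/-- All pairs `(v, e)` with `e ∈ E_v`. -/
def HalfEdge : Type _ := Σ v : V, Γ.Star v

/-- The end of `e` at its terminal vertex. -/
def termEnd (e : E) : Γ.HalfEdge := ⟨Γ.term e, Sum.inl ⟨e, rfl⟩⟩

/-- The end of `e` at its initial vertex. -/
def initEnd (e : E) : Γ.HalfEdge := ⟨Γ.init e, Sum.inr ⟨e, rfl⟩⟩

/-- Every edge has exactly one terminal and one initial end. -/
def halfEdgeEquiv : E ⊕ E ≃ Γ.HalfEdge where
  toFun := Sum.elim Γ.termEnd Γ.initEnd
  invFun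
    | ⟨_, Sum.inl e⟩ => Sum.inl e.1
    | ⟨_, Sum.inr e⟩ => Sum.inr e.1
  left_inv := by rintro (e | e) <;> rfl
  right_inv := by rintro ⟨_, (⟨e, rfl⟩ | ⟨e, rfl⟩)⟩ <;> rfl

/-- The maximal vertex space `𝒢^max = ⨁_v ℂ^{E_v}`, with
`‖F‖² = ∑_v ∑_{e ∈ E_v} |F_e(v)|²`. -/
abbrev Gmax : Type _ := lp (fun _ : Γ.HalfEdge => ℂ) 2

/-! #### The weighted space `ℓ²(E) = ⨁_e ℓ_e^{-1/2} ℂ` -/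

/-- The fibre of the `1`-forms at the edge `e`: `ℂ` with the norm `‖z‖² = |z|² / ℓ_e`. -/
def Fibre (_Γ : MetricGraph V E) (_e : E) : Type := ℂ

instance (e : E) : AddCommGroup (Γ.Fibre e) := inferInstanceAs (AddCommGroup ℂ)
instance (e : E) : Module ℂ (Γ.Fibre e) := inferInstanceAs (Module ℂ ℂ)

/-- A complex number as an element of the fibre over `e`. -/
def toFibre (e : E) : ℂ ≃ₗ[ℂ] Γ.Fibre e := LinearEquiv.refl ℂ ℂ

/-- The inner product `⟨z, w⟩ = z̄ w / ℓ_e` on the fibre over `e`. -/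
@[reducible]
def fibreCore (e : E) : InnerProductSpace.Core ℂ (Γ.Fibre e) where
  inner z w := (inner ℂ ((Γ.toFibre e).symm z) ((Γ.toFibre e).symm w)) / (Γ.len e : ℂ)
  conj_inner_symm z w := by
    rw [map_div₀, inner_conj_symm, Complex.conj_ofReal]
  re_inner_nonneg z := by
    rw [inner_self_eq_norm_sq_to_K]
    have h : ((‖(Γ.toFibre e).symm z‖ : ℂ) ^ 2 / (Γ.len e : ℂ))
        = ((‖(Γ.toFibre e).symm z‖ ^ 2 / Γ.len e : ℝ) : ℂ) := by push_cast; rfl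
    erw [h]
    have := (Γ.len_pos e).le
    change 0 ≤ ‖(Γ.toFibre e).symm z‖ ^ 2 / Γ.len e
    positivity
  add_left x y z := by rw [map_add, inner_add_left, add_div]
  smul_left x y r := by rw [map_smul, inner_smul_left, mul_div_assoc]
  definite z h := by
    have h1 : (Γ.len e : ℂ) ≠ 0 := by exact_mod_cast (Γ.len_pos e).ne'
    rw [div_eq_zero_iff, or_iff_left h1, inner_self_eq_zero] at h
    exact (LinearEquiv.map_eq_zero_iff _).1 h

instance (e : E) : NormedAddCommGroup (Γ.Fibre e) :=
  (Γ.fibreCore e).toNormedAddCommGroup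

instance (e : E) : InnerProductSpace ℂ (Γ.Fibre e) :=
  InnerProductSpace.ofCore (Γ.fibreCore e).toCore

instance (e : E) : FiniteDimensional ℂ (Γ.Fibre e) :=
  inferInstanceAs (FiniteDimensional ℂ ℂ)

instance (e : E) : CompleteSpace (Γ.Fibre e) := FiniteDimensional.complete ℂ _

theorem norm_toFibre_sq (e : E) (z : ℂ) : ‖Γ.toFibre e z‖ ^ 2 = ‖z‖ ^ 2 / Γ.len e := by
  have h : ((‖Γ.toFibre e z‖ ^ 2 : ℝ) : ℂ) = ((‖z‖ ^ 2 / Γ.len e : ℝ) : ℂ) := by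
    have h1 := inner_self_eq_norm_sq_to_K (𝕜 := ℂ) (Γ.toFibre e z)
    have h2 := inner_self_eq_norm_sq_to_K (𝕜 := ℂ) z
    change inner ℂ z z / (Γ.len e : ℂ) = _ at h1
    rw [h2] at h1
    push_cast
    exact h1.symm
  exact_mod_cast h

/-- The space `ℓ²(E)` of `1`-forms of the discrete graph, with `‖η‖² = ∑_e |η_e|² / ℓ_e`. -/
abbrev EdgeL2 : Type _ := lp (fun e => Γ.Fibre e) 2

/-! #### Square integrable and Sobolev functions on the metric graph -/

/-- `L²(X) = ⨁_e L²(0, ℓ_e)`. -/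
abbrev L2 : Type _ := lp (fun e => IntervalL2 (Γ.len e)) 2

/-- The decoupled Sobolev space `H¹_max(X) = ⨁_e H¹(0, ℓ_e)`: the functions in `L²(X)` which are
absolutely continuous on each edge, with derivative in `L²(X)`. -/
def H1max : Submodule ℂ Γ.L2 where
  carrier := {f | ∃ g : Γ.L2, ∀ e, ∃ c : ℂ, IsPrimitive c (g e) (f e)}
  zero_mem' := ⟨0, fun _ => ⟨0, isPrimitive_zero⟩⟩
  add_mem' := by
    rintro f f' ⟨g, h⟩ ⟨g', h'⟩
    refine ⟨g + g', fun e => ?_⟩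
    obtain ⟨c, hc⟩ := h e
    obtain ⟨c', hc'⟩ := h' e
    exact ⟨c + c', hc.add (Γ.len_pos e) hc'⟩
  smul_mem' := by
    rintro a f ⟨g, h⟩
    refine ⟨a • g, fun e => ?_⟩
    obtain ⟨c, hc⟩ := h e
    exact ⟨a * c, hc.smul a⟩

theorem deriv_unique {f : Γ.L2} {g g' : Γ.L2} {c c' : E → ℂ}
    (h : ∀ e, IsPrimitive (c e) (g e) (f e)) (h' : ∀ e, IsPrimitive (c' e) (g' e) (f e)) :
    g = g' ∧ c = c' :=
  ⟨lp.ext (funext fun e => ((h e).unique (Γ.len_pos e) (h' e)).2),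
    funext fun e => ((h e).unique (Γ.len_pos e) (h' e)).1⟩

/-- The derivative `f'` of `f ∈ H¹_max(X)`. -/
def derivFun (f : Γ.H1max) : Γ.L2 := f.2.choose

/-- The value `f_e(0)` of `f ∈ H¹_max(X)`. -/
def initVal (f : Γ.H1max) (e : E) : ℂ := (f.2.choose_spec e).choose

theorem isPrimitive_derivFun (f : Γ.H1max) (e : E) :
    IsPrimitive (Γ.initVal f e) (Γ.derivFun f e) ((f : Γ.L2) e) :=
  (f.2.choose_spec e).choose_spec

theorem derivFun_add (f f' : Γ.H1max) :
    Γ.derivFun (f + f') = Γ.derivFun f + Γ.derivFun f' ∧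
      Γ.initVal (f + f') = Γ.initVal f + Γ.initVal f' :=
  Γ.deriv_unique (Γ.isPrimitive_derivFun (f + f')) fun e =>
    (Γ.isPrimitive_derivFun f e).add (Γ.len_pos e) (Γ.isPrimitive_derivFun f' e)

theorem derivFun_smul (a : ℂ) (f : Γ.H1max) :
    Γ.derivFun (a • f) = a • Γ.derivFun f ∧ Γ.initVal (a • f) = a • Γ.initVal f :=
  Γ.deriv_unique (Γ.isPrimitive_derivFun (a • f)) fun e =>
    (Γ.isPrimitive_derivFun f e).smul a

/-- Differentiation `f ↦ f'` on `H¹_max(X)`. -/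
def deriv : Γ.H1max →ₗ[ℂ] Γ.L2 where
  toFun := Γ.derivFun
  map_add' f f' := (Γ.derivFun_add f f').1
  map_smul' a f := (Γ.derivFun_smul a f).1

/-- The (unoriented) evaluation of `f ∈ H¹_max(X)` at the ends of the edges: `f_e(v)` is
`f_e(ℓ_e)` if `v` is the terminal vertex of `e`, and `f_e(0)` if `v` is its initial vertex. -/
def endValue (f : Γ.H1max) : Γ.HalfEdge → ℂ
  | ⟨_, Sum.inl e⟩ => Γ.initVal f e.1 + ∫ t in (0 : ℝ)..Γ.len e.1, Γ.derivFun f e.1 t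
  | ⟨_, Sum.inr e⟩ => Γ.initVal f e.1

theorem summable_norm_sq {ι : Type*} {G : ι → Type*} [∀ i, NormedAddCommGroup (G i)]
    (f : lp G 2) : Summable fun i => ‖f i‖ ^ 2 := by
  have h := (lp.memℓp f).summable (by norm_num)
  norm_num at h
  exact h

theorem memℓp_two {ι : Type*} {G : ι → Type*} [∀ i, NormedAddCommGroup (G i)]
    {f : ∀ i, G i} (h : Summable fun i => ‖f i‖ ^ 2) : Memℓp f 2 := by
  refine memℓp_gen ?_
  norm_num
  exact h

theorem norm_sq_eq_tsum {ι : Type*} {G : ι → Type*} [∀ i, NormedAddCommGroup (G i)]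
    (f : lp G 2) : ‖f‖ ^ 2 = ∑' i, ‖f i‖ ^ 2 := by
  have h := lp.norm_rpow_eq_tsum (p := 2) (by norm_num) f
  norm_num at h
  exact h

theorem memℓp_endValue (f : Γ.H1max) : Memℓp (Γ.endValue f) 2 := by
  obtain ⟨a, ha, hl⟩ := Γ.len_bddBelow
  refine memℓp_two ?_
  rw [← Γ.halfEdgeEquiv.summable_iff]
  have hs : Summable fun e =>
      2 / a * ‖(f : Γ.L2) e‖ ^ 2 + 2 * a * ‖Γ.derivFun f e‖ ^ 2 :=
    ((summable_norm_sq (f : Γ.L2)).mul_left _).add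
      ((summable_norm_sq (Γ.derivFun f)).mul_left _)
  refine Summable.sum (f := (fun i => ‖Γ.endValue f i‖ ^ 2) ∘ Γ.halfEdgeEquiv) ?_ ?_
  · refine Summable.of_nonneg_of_le (fun _ => sq_nonneg _) (fun e => ?_) hs
    exact (Γ.isPrimitive_derivFun f e).norm_value_sq_le (p := Γ.len e - a) (y := Γ.len e) ha
      (by linarith [hl e]) (by linarith) ⟨by linarith, by linarith⟩
  · refine Summable.of_nonneg_of_le (fun _ => sq_nonneg _) (fun e => ?_) hs
    have := (Γ.isPrimitive_derivFun f e).norm_value_sq_le (p := 0) (y := 0) ha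
      le_rfl (by linarith [hl e]) ⟨by linarith, by linarith⟩
    simpa [endValue, halfEdgeEquiv, initEnd] using this

theorem endValue_add (f f' : Γ.H1max) (x : Γ.HalfEdge) :
    Γ.endValue (f + f') x = Γ.endValue f x + Γ.endValue f' x := by
  obtain ⟨h1, h2⟩ := Γ.derivFun_add f f'
  obtain ⟨v, e | e⟩ := x
  · have hl := Γ.len_pos e.1
    have h0 : (0 : ℝ) ∈ Icc 0 (Γ.len e.1) := ⟨le_rfl, hl.le⟩
    have h3 : Γ.len e.1 ∈ Icc 0 (Γ.len e.1) := ⟨hl.le, le_rfl⟩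
    have h4 : ∫ t in (0 : ℝ)..Γ.len e.1, Γ.derivFun (f + f') e.1 t
        = ∫ t in (0 : ℝ)..Γ.len e.1, (Γ.derivFun f e.1 t + Γ.derivFun f' e.1 t) := by
      rw [h1]
      exact intervalIntegral.integral_congr_ae (ae_Ioo_mono h3 (Lp.coeFn_add _ _))
    simp only [endValue]
    rw [h4, h2, intervalIntegral.integral_add ((Γ.derivFun f e.1).intervalIntegrable' hl h0 h3)
      ((Γ.derivFun f' e.1).intervalIntegrable' hl h0 h3), Pi.add_apply]
    ring
  · simp only [endValue]
    rw [h2, Pi.add_apply]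

theorem endValue_smul (a : ℂ) (f : Γ.H1max) (x : Γ.HalfEdge) :
    Γ.endValue (a • f) x = a * Γ.endValue f x := by
  obtain ⟨h1, h2⟩ := Γ.derivFun_smul a f
  obtain ⟨v, e | e⟩ := x
  · have hl := Γ.len_pos e.1
    have h3 : Γ.len e.1 ∈ Icc 0 (Γ.len e.1) := ⟨hl.le, le_rfl⟩
    have h4 : ∫ t in (0 : ℝ)..Γ.len e.1, Γ.derivFun (a • f) e.1 t
        = ∫ t in (0 : ℝ)..Γ.len e.1, a • Γ.derivFun f e.1 t := by
      rw [h1]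
      exact intervalIntegral.integral_congr_ae (ae_Ioo_mono h3 (Lp.coeFn_smul _ _))
    simp only [endValue]
    rw [h4, h2, intervalIntegral.integral_smul, Pi.smul_apply, smul_eq_mul, smul_eq_mul]
    ring
  · simp only [endValue]
    rw [h2, Pi.smul_apply, smul_eq_mul]

/-- The evaluation map `H¹_max(X) → 𝒢^max`, `f ↦ f̲ = {f_e(v)}`. -/
def trace : Γ.H1max →ₗ[ℂ] Γ.Gmax where
  toFun f := ⟨Γ.endValue f, Γ.memℓp_endValue f⟩
  map_add' f f' := lp.ext (funext (Γ.endValue_add f f'))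
  map_smul' a f := lp.ext (funext (Γ.endValue_smul a f))

theorem norm_integral_sq_le {ℓ : ℝ} (hℓ : 0 < ℓ) (g : IntervalL2 ℓ) :
    ‖∫ t in (0 : ℝ)..ℓ, g t‖ ^ 2 ≤ ℓ * ‖g‖ ^ 2 := by
  have := norm_setIntegral_sq_le measurableSet_Ioo le_rfl g
  rw [intervalIntegral.integral_of_le hℓ.le, integral_Ioc_eq_integral_Ioo]
  simpa [hℓ.le] using this

theorem norm_fibre_integral_sq_le (g : Γ.L2) (e : E) :
    ‖Γ.toFibre e (∫ t in (0 : ℝ)..Γ.len e, g e t)‖ ^ 2 ≤ ‖g e‖ ^ 2 := by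
  rw [norm_toFibre_sq, div_le_iff₀ (Γ.len_pos e), mul_comm]
  exact norm_integral_sq_le (Γ.len_pos e) (g e)

/-- Integration over the edges `L²(X) → ℓ²(E)`, `(∫ g)_e = ∫_0^{ℓ_e} g_e(x) dx`. -/
def edgeIntegral : Γ.L2 →ₗ[ℂ] Γ.EdgeL2 where
  toFun g := ⟨fun e => Γ.toFibre e (∫ t in (0 : ℝ)..Γ.len e, g e t),
    memℓp_two (Summable.of_nonneg_of_le (fun _ => by positivity)
      (Γ.norm_fibre_integral_sq_le g) (summable_norm_sq g))⟩
  map_add' g g' := by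
    refine lp.ext (funext fun e => ?_)
    have hl := Γ.len_pos e
    have h3 : Γ.len e ∈ Icc 0 (Γ.len e) := ⟨hl.le, le_rfl⟩
    have h4 : ∫ t in (0 : ℝ)..Γ.len e, (g + g') e t
        = ∫ t in (0 : ℝ)..Γ.len e, (g e t + g' e t) :=
      intervalIntegral.integral_congr_ae (ae_Ioo_mono h3 (Lp.coeFn_add (g e) (g' e)))
    rw [intervalIntegral.integral_add ((g e).intervalIntegrable hl)
      ((g' e).intervalIntegrable hl)] at h4
    change Γ.toFibre e _ = Γ.toFibre e _ + Γ.toFibre e _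
    rw [h4, map_add]
  map_smul' a g := by
    refine lp.ext (funext fun e => ?_)
    have hl := Γ.len_pos e
    have h3 : Γ.len e ∈ Icc 0 (Γ.len e) := ⟨hl.le, le_rfl⟩
    have h4 : ∫ t in (0 : ℝ)..Γ.len e, (a • g) e t = ∫ t in (0 : ℝ)..Γ.len e, a • g e t :=
      intervalIntegral.integral_congr_ae (ae_Ioo_mono h3 (Lp.coeFn_smul a (g e)))
    rw [intervalIntegral.integral_smul] at h4
    change Γ.toFibre e _ = a • Γ.toFibre e _
    rw [h4, map_smul]

/-! #### Discrete exterior derivatives -/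

theorem norm_fibre_sub_sq_le {a : ℝ} (ha : 0 < a) (hl : ∀ e, a ≤ Γ.len e) (F : Γ.Gmax) (e : E) :
    ‖Γ.toFibre e (F (Γ.termEnd e) - F (Γ.initEnd e))‖ ^ 2
      ≤ 2 / a * (‖F (Γ.termEnd e)‖ ^ 2 + ‖F (Γ.initEnd e)‖ ^ 2) := by
  rw [norm_toFibre_sq]
  have h1 : ‖F (Γ.termEnd e) - F (Γ.initEnd e)‖ ^ 2
      ≤ 2 * (‖F (Γ.termEnd e)‖ ^ 2 + ‖F (Γ.initEnd e)‖ ^ 2) := by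
    have h2 := norm_sub_le (F (Γ.termEnd e)) (F (Γ.initEnd e))
    calc _ ≤ (‖F (Γ.termEnd e)‖ + ‖F (Γ.initEnd e)‖) ^ 2 := by gcongr
      _ ≤ _ := add_sq_le
  calc _ ≤ 2 * (‖F (Γ.termEnd e)‖ ^ 2 + ‖F (Γ.initEnd e)‖ ^ 2) / a :=
        div_le_div₀ (by positivity) h1 ha (hl e)
    _ = _ := by ring

theorem summable_ends (F : Γ.Gmax) :
    (Summable fun e => ‖F (Γ.termEnd e)‖ ^ 2) ∧ Summable fun e => ‖F (Γ.initEnd e)‖ ^ 2 := by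
  have h := summable_norm_sq F
  exact ⟨h.comp_injective (Γ.halfEdgeEquiv.injective.comp Sum.inl_injective),
    h.comp_injective (Γ.halfEdgeEquiv.injective.comp Sum.inr_injective)⟩

theorem norm_sq_Gmax (F : Γ.Gmax) :
    ‖F‖ ^ 2 = ∑' e, (‖F (Γ.termEnd e)‖ ^ 2 + ‖F (Γ.initEnd e)‖ ^ 2) := by
  rw [norm_sq_eq_tsum, ← Γ.halfEdgeEquiv.tsum_eq, (Γ.summable_ends F).1.tsum_add
    (Γ.summable_ends F).2]
  exact Summable.tsum_sum (f := fun i => ‖F (Γ.halfEdgeEquiv i)‖ ^ 2)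
    (Γ.summable_ends F).1 (Γ.summable_ends F).2

theorem memℓp_dMax (F : Γ.Gmax) :
    Memℓp (fun e => Γ.toFibre e (F (Γ.termEnd e) - F (Γ.initEnd e))) 2 := by
  obtain ⟨a, ha, hl⟩ := Γ.len_bddBelow
  exact memℓp_two (Summable.of_nonneg_of_le (fun _ => by positivity)
    (Γ.norm_fibre_sub_sq_le ha hl F)
    (((Γ.summable_ends F).1.add (Γ.summable_ends F).2).mul_left _))

/-- The linear map underlying the maximal discrete exterior derivative. -/
def dMaxLin : Γ.Gmax →ₗ[ℂ] Γ.EdgeL2 where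
  toFun F := ⟨fun e => Γ.toFibre e (F (Γ.termEnd e) - F (Γ.initEnd e)), Γ.memℓp_dMax F⟩
  map_add' F F' := by
    refine lp.ext (funext fun e => ?_)
    change Γ.toFibre e ((F (Γ.termEnd e) + F' (Γ.termEnd e))
      - (F (Γ.initEnd e) + F' (Γ.initEnd e))) = Γ.toFibre e _ + Γ.toFibre e _
    rw [← map_add]
    congr 1
    ring
  map_smul' a F := by
    refine lp.ext (funext fun e => ?_)
    change Γ.toFibre e (a * F (Γ.termEnd e) - a * F (Γ.initEnd e)) = a • Γ.toFibre e _
    rw [← map_smul, smul_eq_mul, mul_sub]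

/-- The maximal discrete exterior derivative `𝒢^max → ℓ²(E)`,
`(d F)_e = F_e(∂₊ e) - F_e(∂₋ e)`, as a bounded operator. -/
def dMax : Γ.Gmax →L[ℂ] Γ.EdgeL2 :=
  Γ.dMaxLin.mkContinuousOfExistsBound <| by
    obtain ⟨a, ha, hl⟩ := Γ.len_bddBelow
    refine ⟨√(2 / a), fun F => ?_⟩
    refine le_of_sq_le_sq ?_ (by positivity)
    rw [mul_pow, Real.sq_sqrt (by positivity), norm_sq_eq_tsum, norm_sq_Gmax, ← tsum_mul_left]
    have hs := ((Γ.summable_ends F).1.add (Γ.summable_ends F).2).mul_left (2 / a)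
    exact Summable.tsum_le_tsum (Γ.norm_fibre_sub_sq_le ha hl F)
      (summable_norm_sq (Γ.dMaxLin F)) hs

/-- The discrete exterior derivative `d_𝒢`, the restriction of the maximal one to the vertex space
`𝒢`. -/
def dDisc (G : Submodule ℂ Γ.Gmax) : G →L[ℂ] Γ.EdgeL2 := Γ.dMax.comp G.subtypeL


/-! #### Vertex spaces -/

section VertexSpace

variable (G : Submodule ℂ Γ.Gmax)

/-- `H¹_𝒢(X)`: the functions `f ∈ H¹_max(X)` with `f̲ ∈ 𝒢`. -/
def H1G : Submodule ℂ Γ.L2 := (G.comap Γ.trace).map Γ.H1max.subtype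

/-- The inclusion `H¹_𝒢(X) → H¹_max(X)`. -/
def H1G.toH1max : Γ.H1G G →ₗ[ℂ] Γ.H1max :=
  Submodule.inclusion (Submodule.map_subtype_le _ _)

theorem trace_mem_of_mem_H1G (f : Γ.H1G G) : Γ.trace (H1G.toH1max Γ G f) ∈ G := by
  obtain ⟨f, ⟨f', hf', rfl⟩⟩ := f
  exact hf'

/-- The evaluation `H¹_𝒢(X) → 𝒢`, `f ↦ f̲`. -/
def traceG : Γ.H1G G →ₗ[ℂ] G :=
  (Γ.trace.comp (H1G.toH1max Γ G)).codRestrict G (Γ.trace_mem_of_mem_H1G G)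

variable {Γ G}
variable (L : G →L[ℂ] G)

/-- `𝒢₀ = ker L`, as a subspace of `𝒢^max`. -/
def vtxKer : Submodule ℂ Γ.Gmax := (LinearMap.ker (L : G →ₗ[ℂ] G)).map G.subtype

/-- `𝒢₁ = 𝒢 ⊖ ker L`, as a subspace of `𝒢^max`. -/
def vtxCoker : Submodule ℂ Γ.Gmax := G ⊓ (vtxKer L)ᗮ

instance [CompleteSpace G] : CompleteSpace (vtxKer L) := by
  have h1 : IsClosed ((LinearMap.ker (L : G →ₗ[ℂ] G) : Submodule ℂ G) : Set G) :=
    L.isClosed_ker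
  have h2 : IsComplete ((fun x : G => (x : Γ.Gmax)) ''
      ((LinearMap.ker (L : G →ₗ[ℂ] G) : Submodule ℂ G) : Set G)) :=
    (isComplete_image_iff isUniformEmbedding_subtype_val.isUniformInducing).2
      h1.isComplete
  exact completeSpace_coe_iff_isComplete.2 h2

instance [CompleteSpace G] : CompleteSpace (vtxCoker L) := by
  have h1 : IsClosed (G : Set Γ.Gmax) :=
    (completeSpace_coe_iff_isComplete.1 ‹CompleteSpace G›).isClosed
  have h2 : IsClosed ((vtxCoker L : Submodule ℂ Γ.Gmax) : Set Γ.Gmax) :=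
    h1.inter (vtxKer L).isClosed_orthogonal
  exact completeSpace_coe_iff_isComplete.2 h2.isComplete

end VertexSpace

/-- `x ↦ (A x, B x)`, into the Hilbert space direct sum. -/
def pairLin {M X Y : Type*} [AddCommGroup M] [Module ℂ M] [AddCommGroup X] [Module ℂ X]
    [AddCommGroup Y] [Module ℂ Y] (A : M →ₗ[ℂ] X) (B : M →ₗ[ℂ] Y) : M →ₗ[ℂ] WithLp 2 (X × Y) :=
  ((WithLp.linearEquiv 2 ℂ (X × Y)).symm : (X × Y) →ₗ[ℂ] WithLp 2 (X × Y)).comp (A.prod B)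

/-! #### The simple case -/

section Simple

variable (G : Submodule ℂ Γ.Gmax)

/-- `d f = f'` on `H¹_𝒢(X)`, as an operator in `L²(X)`. -/
def dSimple : Γ.L2 →ₗ.[ℂ] Γ.L2 := ⟨Γ.H1G G, Γ.deriv.comp (H1G.toH1max Γ G)⟩

/-- `Φ₀ f = f̲`. -/
def phiSimple₀ : (Γ.dSimple G).domain →ₗ[ℂ] G := Γ.traceG G

/-- `Φ₁ g = ∫ g`. -/
def phiSimple₁ : (Γ.dSimple G).adjoint.domain →ₗ[ℂ] Γ.EdgeL2 :=
  Γ.edgeIntegral.comp (Submodule.subtype _)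

end Simple

section Enlarged

variable {Γ}
variable {G : Submodule ℂ Γ.Gmax} [CompleteSpace G] (L : G →L[ℂ] G)

/-! #### The `0`-enlarged space -/

/-- The pairs `(f, F) ∈ H¹_max(X) ⊕ 𝒢` with `f̲ = L^{1/2} F` (in particular `f̲ ∈ 𝒢`). -/
def domZero : Submodule ℂ (WithLp 2 (Γ.L2 × G)) where
  carrier := {x | ∃ h : x.fst ∈ Γ.H1max, Γ.trace ⟨x.fst, h⟩ = (opSqrt L x.snd : G)}
  zero_mem' := ⟨Γ.H1max.zero_mem, by
    change Γ.trace 0 = (opSqrt L 0 : G)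
    rw [map_zero, map_zero, Submodule.coe_zero]⟩
  add_mem' := by
    rintro x y ⟨hx, hx'⟩ ⟨hy, hy'⟩
    refine ⟨Γ.H1max.add_mem hx hy, ?_⟩
    change Γ.trace (⟨x.fst, hx⟩ + ⟨y.fst, hy⟩) = (opSqrt L (x.snd + y.snd) : G)
    rw [map_add, map_add, hx', hy', Submodule.coe_add]
  smul_mem' := by
    rintro c x ⟨hx, hx'⟩
    refine ⟨Γ.H1max.smul_mem c hx, ?_⟩
    change Γ.trace (c • ⟨x.fst, hx⟩) = (opSqrt L (c • x.snd) : G)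
    rw [map_smul, map_smul, hx', Submodule.coe_smul]

/-- `(f, F) ↦ f`. -/
def domZero.fn : domZero L →ₗ[ℂ] Γ.H1max :=
  ((WithLp.fstₗ 2 ℂ Γ.L2 G).comp (domZero L).subtype).codRestrict Γ.H1max fun x => x.2.choose

/-- `(f, F) ↦ F`, with `F` regarded as an element of `𝒢^max`. -/
def domZero.vtx : domZero L →ₗ[ℂ] Γ.Gmax :=
  G.subtype.comp ((WithLp.sndₗ 2 ℂ Γ.L2 G).comp (domZero L).subtype)

/-- `d (f, F) = f'`. -/
def dZero : WithLp 2 (Γ.L2 × G) →ₗ.[ℂ] Γ.L2 := ⟨domZero L, Γ.deriv.comp (domZero.fn L)⟩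

/-- The discrete exterior derivative `𝒢₁ ⊕ 𝒢₀ → ℓ²(E)`, `F₁ ⊕ F₀ ↦ d F₁`. -/
def discZero : WithLp 2 (vtxCoker L × vtxKer L) →L[ℂ] Γ.EdgeL2 :=
  zeroEnlarge (Γ.dDisc (vtxCoker L)) (vtxKer L)

/-- `Φ₀ (f, F) = (P₁ f̲, P₀ F)`. -/
def phiZero₀ : (dZero L).domain →ₗ[ℂ] WithLp 2 (vtxCoker L × vtxKer L) :=
  pairLin
    (((vtxCoker L).orthogonalProjectionOnto : Γ.Gmax →ₗ[ℂ] vtxCoker L).comp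
      (Γ.trace.comp (domZero.fn L)))
    (((vtxKer L).orthogonalProjectionOnto : Γ.Gmax →ₗ[ℂ] vtxKer L).comp (domZero.vtx L))

/-- `Φ₁ g = ∫ g`. -/
def phiZero₁ : (dZero L).adjoint.domain →ₗ[ℂ] Γ.EdgeL2 :=
  Γ.edgeIntegral.comp (Submodule.subtype _)

/-! #### The `0`-enlarged space with projection -/

/-- The pairs `(f, F) ∈ H¹_max(X) ⊕ 𝒢` with `P f̲ = L^{1/2} F`. -/
def domZeroProj : Submodule ℂ (WithLp 2 (Γ.L2 × G)) where
  carrier := {x | ∃ h : x.fst ∈ Γ.H1max,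
    G.orthogonalProjectionOnto (Γ.trace ⟨x.fst, h⟩) = opSqrt L x.snd}
  zero_mem' := ⟨Γ.H1max.zero_mem, by
    change G.orthogonalProjectionOnto (Γ.trace 0) = opSqrt L 0
    rw [map_zero, map_zero, map_zero]⟩
  add_mem' := by
    rintro x y ⟨hx, hx'⟩ ⟨hy, hy'⟩
    refine ⟨Γ.H1max.add_mem hx hy, ?_⟩
    change G.orthogonalProjectionOnto (Γ.trace (⟨x.fst, hx⟩ + ⟨y.fst, hy⟩))
      = opSqrt L (x.snd + y.snd)
    rw [map_add, map_add, map_add, hx', hy']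
  smul_mem' := by
    rintro c x ⟨hx, hx'⟩
    refine ⟨Γ.H1max.smul_mem c hx, ?_⟩
    change G.orthogonalProjectionOnto (Γ.trace (c • ⟨x.fst, hx⟩)) = opSqrt L (c • x.snd)
    rw [map_smul, map_smul, map_smul, hx']

/-- `(f, F) ↦ f`. -/
def domZeroProj.fn : domZeroProj L →ₗ[ℂ] Γ.H1max :=
  ((WithLp.fstₗ 2 ℂ Γ.L2 G).comp (domZeroProj L).subtype).codRestrict Γ.H1max
    fun x => x.2.choose

/-- `(f, F) ↦ F`, with `F` regarded as an element of `𝒢^max`. -/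
def domZeroProj.vtx : domZeroProj L →ₗ[ℂ] Γ.Gmax :=
  G.subtype.comp ((WithLp.sndₗ 2 ℂ Γ.L2 G).comp (domZeroProj L).subtype)

/-- `d (f, F) = f'`. -/
def dZeroProj : WithLp 2 (Γ.L2 × G) →ₗ.[ℂ] Γ.L2 :=
  ⟨domZeroProj L, Γ.deriv.comp (domZeroProj.fn L)⟩

/-- The discrete exterior derivative `𝒢₀^⊥ ⊕ 𝒢₀ → ℓ²(E)`, `F₀^⊥ ⊕ F₀ ↦ d F₀^⊥`. -/
def discZeroProj : WithLp 2 ((vtxKer L)ᗮ × vtxKer L) →L[ℂ] Γ.EdgeL2 :=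
  zeroEnlarge (Γ.dDisc (vtxKer L)ᗮ) (vtxKer L)

/-- `Φ₀ (f, F) = (P₀^⊥ f̲, P₀ F)`. -/
def phiZeroProj₀ : (dZeroProj L).domain →ₗ[ℂ] WithLp 2 ((vtxKer L)ᗮ × vtxKer L) :=
  pairLin
    (((vtxKer L)ᗮ.orthogonalProjectionOnto :
      Γ.Gmax →ₗ[ℂ] ((vtxKer L)ᗮ : Submodule ℂ Γ.Gmax)).comp
      (Γ.trace.comp (domZeroProj.fn L)))
    (((vtxKer L).orthogonalProjectionOnto : Γ.Gmax →ₗ[ℂ] vtxKer L).comp (domZeroProj.vtx L))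

/-- `Φ₁ g = ∫ g`. -/
def phiZeroProj₁ : (dZeroProj L).adjoint.domain →ₗ[ℂ] Γ.EdgeL2 :=
  Γ.edgeIntegral.comp (Submodule.subtype _)

/-! #### The `1`-enlarged space -/

/-- `Φ₁ (g, G) = (P₀ G, ∫ g)`, on all square integrable `1`-forms. -/
def phiOneForm : WithLp 2 (Γ.L2 × G) →ₗ[ℂ] WithLp 2 (vtxKer L × Γ.EdgeL2) :=
  pairLin
    (((vtxKer L).orthogonalProjectionOnto : Γ.Gmax →ₗ[ℂ] vtxKer L).comp
      (G.subtype.comp (WithLp.sndₗ 2 ℂ Γ.L2 G)))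
    (Γ.edgeIntegral.comp (WithLp.fstₗ 2 ℂ Γ.L2 G))

/-- `d f = (f', L^{1/2} P f̲)` on `H¹_max(X)`. -/
def dOne : Γ.L2 →ₗ.[ℂ] WithLp 2 (Γ.L2 × G) :=
  ⟨Γ.H1max, pairLin Γ.deriv
    ((opSqrt L : G →ₗ[ℂ] G).comp
      ((G.orthogonalProjectionOnto : Γ.Gmax →ₗ[ℂ] G).comp Γ.trace))⟩

/-- The discrete exterior derivative `𝒢₁^⊥ → 𝒢₀ ⊕ ℓ²(E)`, `F₁^⊥ ↦ 0 ⊕ d F₁^⊥`. -/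
def discOne : ((vtxCoker L)ᗮ : Submodule ℂ Γ.Gmax) →L[ℂ] WithLp 2 (vtxKer L × Γ.EdgeL2) :=
  oneEnlarge (Γ.dDisc (vtxCoker L)ᗮ) (vtxKer L)

/-- `Φ₀ f = P₁^⊥ f̲`. -/
def phiOne₀ : (dOne L).domain →ₗ[ℂ] ((vtxCoker L)ᗮ : Submodule ℂ Γ.Gmax) :=
  ((vtxCoker L)ᗮ.orthogonalProjectionOnto :
    Γ.Gmax →ₗ[ℂ] ((vtxCoker L)ᗮ : Submodule ℂ Γ.Gmax)).comp Γ.trace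

/-- `Φ₁ (g, G) = (P₀ G, ∫ g)`. -/
def phiOne₁ : (dOne L).adjoint.domain →ₗ[ℂ] WithLp 2 (vtxKer L × Γ.EdgeL2) :=
  (phiOneForm L).comp (Submodule.subtype _)

/-! #### The `1`-enlarged space with projection -/

/-- `d f = (f', L^{1/2} f̲)` on `H¹_𝒢(X)`. -/
def dOneProj : Γ.L2 →ₗ.[ℂ] WithLp 2 (Γ.L2 × G) :=
  ⟨Γ.H1G G, pairLin (Γ.deriv.comp (H1G.toH1max Γ G))
    ((opSqrt L : G →ₗ[ℂ] G).comp (Γ.traceG G))⟩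

/-- The discrete exterior derivative `𝒢₀ → 𝒢₀ ⊕ ℓ²(E)`, `F₀ ↦ 0 ⊕ d F₀`. -/
def discOneProj : vtxKer L →L[ℂ] WithLp 2 (vtxKer L × Γ.EdgeL2) :=
  oneEnlarge (Γ.dDisc (vtxKer L)) (vtxKer L)

/-- `Φ₀ f = P₀ f̲`. -/
def phiOneProj₀ : (dOneProj L).domain →ₗ[ℂ] vtxKer L :=
  ((vtxKer L).orthogonalProjectionOnto : Γ.Gmax →ₗ[ℂ] vtxKer L).comp
    (Γ.trace.comp (H1G.toH1max Γ G))

/-- `Φ₁ (g, G) = (P₀ G, ∫ g)`. -/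
def phiOneProj₁ : (dOneProj L).adjoint.domain →ₗ[ℂ] WithLp 2 (vtxKer L × Γ.EdgeL2) :=
  (phiOneForm L).comp (Submodule.subtype _)

end Enlarged

/-- The index theorem comparing an exterior derivative `d` on the metric graph with a discrete one
`δ` by means of `Φ = Φ₀ ⊕ Φ₁`.  Here `fn` sends a `0`-form in `dom d` to its function component
`f ∈ H¹_max(X)`, `hyp₀` and `hyp₁` are the hypotheses under which `Φ₀` and `Φ₁` map the kernel
onto the discrete kernel (they are automatic on finite graphs), and `n` is the index for finite
graphs. -/
structure IndexTheorem {H₀ H₁ K₀ K₁ : Type*}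
    [NormedAddCommGroup H₀] [InnerProductSpace ℂ H₀] [CompleteSpace H₀]
    [NormedAddCommGroup H₁] [InnerProductSpace ℂ H₁]
    [NormedAddCommGroup K₀] [InnerProductSpace ℂ K₀] [CompleteSpace K₀]
    [NormedAddCommGroup K₁] [InnerProductSpace ℂ K₁]
    (d : H₀ →ₗ.[ℂ] H₁) (fn : d.domain →ₗ[ℂ] Γ.H1max) (δ : K₀ →L[ℂ] K₁)
    (Φ₀ : d.domain →ₗ[ℂ] K₀) (Φ₁ : d.adjoint.domain →ₗ[ℂ] K₁) (hyp₀ hyp₁ : Prop) (n : ℤ) : Prop where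
  /-- `d` is an exterior derivative: closed and densely defined. -/
  isExteriorDerivative : IsExteriorDerivative d
  /-- `Φ` is bounded by `2 / √ℓ₀`, in the Sobolev norm of `f` and the Hilbert space norm of all
  the other components (hence also in the Sobolev norm, and in the graph norm of `D`). -/
  bound : ∀ ℓ₀ : ℝ, 0 < ℓ₀ → ℓ₀ ≤ 1 → (∀ e, ℓ₀ ≤ Γ.len e) → ∀ x : (diracOp d).domain,
    ‖susySum Φ₀ Φ₁ x‖
      ≤ 2 / √ℓ₀ * √(‖(x : WithLp 2 (H₀ × H₁))‖ ^ 2 + ‖Γ.deriv (fn ⟨x.1.fst, x.2.1⟩)‖ ^ 2)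
  /-- `Φ` maps the kernels injectively into each other. -/
  kerEmbedding : KerEmbedding (diracOp d) (diracOp (bddPMap δ)) (susySum Φ₀ Φ₁) ∧
    KerEmbedding d (bddPMap δ) Φ₀ ∧ KerEmbedding d.adjoint (bddPMap δ).adjoint Φ₁
  /-- `Φ₀` is an isomorphism of `ker d` onto the kernel of the discrete exterior derivative. -/
  kerIsomorphism₀ : hyp₀ → KerIsomorphism d (bddPMap δ) Φ₀
  /-- `Φ₁` is an isomorphism of `ker d*` onto the kernel of the discrete adjoint. -/
  kerIsomorphism₁ : hyp₁ → KerIsomorphism d.adjoint (bddPMap δ).adjoint Φ₁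
  /-- `Φ` is an isomorphism between the kernels of the Dirac operators. -/
  kerIsomorphism : hyp₀ → hyp₁ →
    KerIsomorphism (diracOp d) (diracOp (bddPMap δ)) (susySum Φ₀ Φ₁)
  /-- The indices agree: if one of them is defined, so is the other, with the same value. -/
  index_eq : hyp₀ → hyp₁ → ∀ m : ℤ, HasIndex d m ↔ HasIndex (bddPMap δ) m
  /-- On a finite graph, `Φ₀`, `Φ₁` and `Φ` are isomorphisms between the kernels, and both indices
  are defined, with value `n`. -/
  finite : Finite E → KerIsomorphism d (bddPMap δ) Φ₀ ∧
    KerIsomorphism d.adjoint (bddPMap δ).adjoint Φ₁ ∧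
    KerIsomorphism (diracOp d) (diracOp (bddPMap δ)) (susySum Φ₀ Φ₁) ∧
    HasIndex d n ∧ HasIndex (bddPMap δ) n

end MetricGraph

end

/-! ### Kernels of closed operators, adjoints and Dirac operators. -/

section Kernels

variable {H₀ H₁ K₀ K₁ : Type*}
  [NormedAddCommGroup H₀] [InnerProductSpace ℂ H₀]
  [NormedAddCommGroup H₁] [InnerProductSpace ℂ H₁]
  [NormedAddCommGroup K₀] [InnerProductSpace ℂ K₀]
  [NormedAddCommGroup K₁] [InnerProductSpace ℂ K₁]

/-! On both sides the kernels consist of edgewise constant data. If `d` kills a 0-form, its function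
component is constant on each edge, so it is determined by its vertex values `f̲`, and `f̲` has
vanishing discrete derivative. Conversely a vertex function `F` with `dMax F = 0` extends edgewise
constantly; the extension is square integrable once the lengths are bounded above, since a constant
`c` on `e` has squared norm `|c|² ℓ_e`.

For 1-forms, `ker d*` is the orthogonal complement of the range of `d`. Testing against functions
vanishing at all ends forces the function component `g` of such a form to be constant on each edge,
and for such `g` the weights `1/ℓ_e` give `⟪g, g'⟫ = ⟪∫g, ∫g'⟫` for every `g'`
(`inner_eq_inner_edgeIntegral`). Together with the fundamental theorem of calculus `∫f' = d f̲`
(`edgeIntegral_deriv`) this yields `⟪g, f'⟫ = ⟪∫g, d f̲⟫` (`inner_edgeIntegral_dMax`). As every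
element of `𝒢^max` is a boundary value (`exists_trace_eq`), orthogonality to the range of `d` turns
into orthogonality to the discrete range. Integration is isometric on edgewise constant forms, so no
upper bound on the lengths enters here.

In the enlarged cases `L^{1/2}` has kernel `𝒢₀` and range dense in `𝒢₁`. Density is enough to map
kernels into kernels. For surjectivity an equation `L^{1/2} K = w` with `w ∈ 𝒢₁` has to be solved,
and this is where closed range is used (`exists_opSqrt_eq_of_mem_vtxCoker`); the solution is unique
up to `𝒢₀`, and the component `P₀ F` or `P₀ G` of `Φ` records that freedom.

Boundedness of `Φ` comes from the trace estimate `norm_trace_sq_le`, bounded inverses from the open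
mapping theorem. On a finite graph all spaces of discrete forms are finite dimensional, so
rank-nullity makes the discrete index the difference of their dimensions; `dim 𝒢^max = 2|E|` then
gives the five values. -/

theorem mem_pmapKer {T : H₀ →ₗ.[ℂ] H₁} {x : H₀} :
    x ∈ pmapKer T ↔ ∃ h : x ∈ T.domain, T ⟨x, h⟩ = 0 := by
  constructor
  · rintro ⟨y, hy, rfl⟩
    exact ⟨y.2, hy⟩
  · rintro ⟨h, h0⟩
    exact ⟨⟨x, h⟩, h0, rfl⟩

/-- The kernel is the slice of the closed graph at second coordinate `0`. -/
theorem isClosed_pmapKer {T : H₀ →ₗ.[ℂ] H₁} (hT : T.IsClosed) :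
    IsClosed (pmapKer T : Set H₀) := by
  have h : (pmapKer T : Set H₀) = (fun x => (x, (0 : H₁))) ⁻¹' (T.graph : Set (H₀ × H₁)) := by
    ext x
    simp only [SetLike.mem_coe, mem_pmapKer, mem_preimage, LinearPMap.mem_graph_iff]
    constructor
    · rintro ⟨h, h0⟩
      exact ⟨⟨x, h⟩, rfl, h0⟩
    · rintro ⟨y, rfl, h0⟩
      exact ⟨y.2, h0⟩
  rw [h]
  exact IsClosed.preimage (by fun_prop) hT

/-- Since `ker T* = (ran T)ᗮ`, all later arguments about `d*` can be made by orthogonality, without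
determining the domain or the action of the adjoint. -/
theorem mem_pmapKer_adjoint [CompleteSpace H₀] {T : H₀ →ₗ.[ℂ] H₁}
    (hT : Dense (T.domain : Set H₀)) {y : H₁} :
    y ∈ pmapKer T.adjoint ↔ ∀ x, ⟪y, T x⟫_ℂ = 0 := by
  rw [mem_pmapKer]
  constructor
  · rintro ⟨h, h0⟩ x
    have := LinearPMap.adjoint_isFormalAdjoint hT ⟨y, h⟩ x
    rw [h0, inner_zero_left] at this
    exact this.symm
  · intro h
    have hy : y ∈ T.adjoint.domain :=
      T.mem_adjoint_domain_of_exists y ⟨0, fun x => by rw [h, inner_zero_left]⟩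
    exact ⟨hy, LinearPMap.adjoint_apply_eq hT _ fun x => by rw [h, inner_zero_left]⟩

theorem bddPMap_domain (T : H₀ →L[ℂ] H₁) : (bddPMap T).domain = ⊤ := rfl

theorem dense_bddPMap_domain (T : H₀ →L[ℂ] H₁) : Dense ((bddPMap T).domain : Set H₀) := by
  rw [bddPMap_domain]
  exact dense_univ

theorem mem_pmapKer_bddPMap {T : H₀ →L[ℂ] H₁} {x : H₀} :
    x ∈ pmapKer (bddPMap T) ↔ T x = 0 := by
  rw [mem_pmapKer]
  exact ⟨fun ⟨_, h⟩ => h, fun h => ⟨trivial, h⟩⟩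

theorem pmapKer_bddPMap (T : H₀ →L[ℂ] H₁) :
    pmapKer (bddPMap T) = LinearMap.ker (T : H₀ →ₗ[ℂ] H₁) := by
  ext x
  exact mem_pmapKer_bddPMap

theorem mem_pmapKer_adjoint_bddPMap [CompleteSpace H₀] {T : H₀ →L[ℂ] H₁} {y : H₁} :
    y ∈ pmapKer (bddPMap T).adjoint ↔ ∀ x, ⟪y, T x⟫_ℂ = 0 := by
  rw [mem_pmapKer_adjoint (dense_bddPMap_domain T)]
  exact ⟨fun h x => h ⟨x, trivial⟩, fun h x => h x⟩

theorem pmapKer_adjoint_bddPMap [CompleteSpace H₀] (T : H₀ →L[ℂ] H₁) :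
    pmapKer (bddPMap T).adjoint = (LinearMap.range (T : H₀ →ₗ[ℂ] H₁))ᗮ := by
  ext y
  rw [mem_pmapKer_adjoint_bddPMap, Submodule.mem_orthogonal']
  exact ⟨fun h _ ⟨x, hx⟩ => hx ▸ h x, fun h x => h _ ⟨x, rfl⟩⟩

theorem isExteriorDerivative_bddPMap (T : H₀ →L[ℂ] H₁) :
    IsExteriorDerivative (bddPMap T) := by
  refine ⟨dense_bddPMap_domain T, ?_⟩
  have h : ((bddPMap T).graph : Set (H₀ × H₁)) = {p | T p.1 = p.2} := by
    ext p
    simp only [SetLike.mem_coe, LinearPMap.mem_graph_iff, mem_ofPred_eq]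
    constructor
    · rintro ⟨y, hy, h⟩
      rw [← hy, ← h]
      rfl
    · intro h
      exact ⟨⟨p.1, trivial⟩, rfl, h⟩
  rw [LinearPMap.IsClosed, h]
  exact isClosed_eq (by fun_prop) (by fun_prop)

theorem mem_pmapKer_diracOp [CompleteSpace H₀] {d : H₀ →ₗ.[ℂ] H₁} {x : WithLp 2 (H₀ × H₁)} :
    x ∈ pmapKer (diracOp d) ↔ x.fst ∈ pmapKer d ∧ x.snd ∈ pmapKer d.adjoint := by
  simp only [mem_pmapKer]
  constructor
  · rintro ⟨h, h0⟩
    exact ⟨⟨h.1, congrArg WithLp.snd h0⟩, ⟨h.2, congrArg WithLp.fst h0⟩⟩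
  · rintro ⟨⟨h1, h1'⟩, ⟨h2, h2'⟩⟩
    refine ⟨⟨h1, h2⟩, ?_⟩
    change WithLp.toLp 2 (d.adjoint ⟨x.snd, h2⟩, d ⟨x.fst, h1⟩) = 0
    rw [h1', h2']
    rfl

theorem isClosed_pmapKer_diracOp [CompleteSpace H₀] {d : H₀ →ₗ.[ℂ] H₁}
    (hd : IsExteriorDerivative d) :
    IsClosed (pmapKer (diracOp d) : Set (WithLp 2 (H₀ × H₁))) := by
  have h : (pmapKer (diracOp d) : Set (WithLp 2 (H₀ × H₁)))
      = (WithLp.fst ⁻¹' (pmapKer d : Set H₀)) ∩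
        (WithLp.snd ⁻¹' (pmapKer d.adjoint : Set H₁)) := by
    ext x
    exact mem_pmapKer_diracOp
  rw [h]
  exact ((isClosed_pmapKer hd.2).preimage (WithLp.fstL 2 ℂ H₀ H₁).continuous).inter
    ((isClosed_pmapKer (LinearPMap.adjoint_isClosed hd.1)).preimage
      (WithLp.sndL 2 ℂ H₀ H₁).continuous)

/-- A bounded bijection between closed kernels is an isomorphism, by the open mapping theorem. -/
theorem KerEmbedding.kerIsomorphism [CompleteSpace H₀] [CompleteSpace K₀]
    {T : H₀ →ₗ.[ℂ] H₁} {S : K₀ →ₗ.[ℂ] K₁} {Φ : T.domain →ₗ[ℂ] K₀}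
    (hT : IsClosed (pmapKer T : Set H₀)) (hS : IsClosed (pmapKer S : Set K₀))
    {C : ℝ} (hC : ∀ x : T.domain, T x = 0 → ‖Φ x‖ ≤ C * ‖(x : H₀)‖)
    (h : KerEmbedding T S Φ) (hsurj : ∀ k ∈ pmapKer S, ∃ x : T.domain, T x = 0 ∧ Φ x = k) :
    KerIsomorphism T S Φ := by
  have hle : pmapKer T ≤ T.domain := Submodule.map_subtype_le _ _
  have hz : ∀ x : pmapKer T, T (Submodule.inclusion hle x) = 0 :=
    fun x => (mem_pmapKer.1 x.2).choose_spec
  let A : pmapKer T →ₗ[ℂ] pmapKer S :=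
    (Φ.comp (Submodule.inclusion hle)).codRestrict (pmapKer S) fun x => h.1 _ (hz x)
  let B : pmapKer T →L[ℂ] pmapKer S := A.mkContinuous C fun x => hC _ (hz x)
  have : CompleteSpace (pmapKer T) := completeSpace_coe_iff_isComplete.2 hT.isComplete
  have : CompleteSpace (pmapKer S) := completeSpace_coe_iff_isComplete.2 hS.isComplete
  have hinj : LinearMap.ker (B : pmapKer T →ₗ[ℂ] pmapKer S) = ⊥ := by
    refine LinearMap.ker_eq_bot.2 fun x y hxy => ?_
    have h1 := h.2 _ _ (hz x) (hz y) (congrArg Subtype.val hxy)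
    exact Submodule.inclusion_injective hle h1
  have hrange : LinearMap.range (B : pmapKer T →ₗ[ℂ] pmapKer S) = ⊤ := by
    refine LinearMap.range_eq_top.2 fun k => ?_
    obtain ⟨x, hx, hxk⟩ := hsurj k k.2
    exact ⟨⟨x, mem_pmapKer.2 ⟨x.2, hx⟩⟩, Subtype.ext hxk⟩
  -- The open mapping theorem applies because both kernels are closed, hence complete.
  exact ⟨ContinuousLinearEquiv.ofBijective B hinj hrange, fun x hx => rfl⟩

theorem KerEmbedding.susySum [CompleteSpace H₀] [CompleteSpace K₀]
    {d : H₀ →ₗ.[ℂ] H₁} {δ : K₀ →ₗ.[ℂ] K₁}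
    {Φ₀ : d.domain →ₗ[ℂ] K₀} {Φ₁ : d.adjoint.domain →ₗ[ℂ] K₁}
    (h₀ : KerEmbedding d δ Φ₀) (h₁ : KerEmbedding d.adjoint δ.adjoint Φ₁) :
    KerEmbedding (diracOp d) (diracOp δ) (susySum Φ₀ Φ₁) := by
  have key : ∀ x : (diracOp d).domain, diracOp d x = 0 →
      d ⟨x.1.fst, x.2.1⟩ = 0 ∧ d.adjoint ⟨x.1.snd, x.2.2⟩ = 0 := fun x hx =>
    ⟨congrArg WithLp.snd hx, congrArg WithLp.fst hx⟩
  constructor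
  · intro x hx
    exact mem_pmapKer_diracOp.2 ⟨h₀.1 _ (key x hx).1, h₁.1 _ (key x hx).2⟩
  · intro x y hx hy hxy
    have e₀ := h₀.2 _ _ (key x hx).1 (key y hy).1 (congrArg WithLp.fst hxy)
    have e₁ := h₁.2 _ _ (key x hx).2 (key y hy).2 (congrArg WithLp.snd hxy)
    refine Subtype.ext ((WithLp.ofLp_injective 2) (Prod.ext ?_ ?_))
    · exact congrArg Subtype.val e₀
    · exact congrArg Subtype.val e₁

theorem HasIndex.congr [CompleteSpace H₀] [CompleteSpace K₀]
    {d : H₀ →ₗ.[ℂ] H₁} {δ : K₀ →ₗ.[ℂ] K₁} (e₀ : pmapKer d ≃ₗ[ℂ] pmapKer δ)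
    (e₁ : pmapKer d.adjoint ≃ₗ[ℂ] pmapKer δ.adjoint) {m : ℤ} (h : HasIndex δ m) :
    HasIndex d m := by
  obtain ⟨h0, h1, h2⟩ := h
  refine ⟨e₀.symm.finiteDimensional, e₁.symm.finiteDimensional, ?_⟩
  rw [e₀.finrank_eq, e₁.finrank_eq, h2]

/-- By rank-nullity the rank cancels: the index depends only on the two dimensions, not on the
operator. -/
theorem hasIndex_bddPMap [CompleteSpace H₀] [FiniteDimensional ℂ H₀] [FiniteDimensional ℂ H₁]
    (T : H₀ →L[ℂ] H₁) {n : ℤ} (hn : (Module.finrank ℂ H₀ : ℤ) - Module.finrank ℂ H₁ = n) :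
    HasIndex (bddPMap T) n := by
  refine ⟨inferInstance, inferInstance, ?_⟩
  rw [pmapKer_bddPMap, pmapKer_adjoint_bddPMap, ← hn]
  have h1 := LinearMap.finrank_range_add_finrank_ker (T : H₀ →ₗ[ℂ] H₁)
  have h2 := Submodule.finrank_add_finrank_orthogonal (LinearMap.range (T : H₀ →ₗ[ℂ] H₁))
  omega

end Kernels

/-! ### Reduction of the index theorem to orthogonality statements. -/

namespace MetricGraph

theorem exists_len_lower_bound {V E : Type*} (Γ : MetricGraph V E) :
    ∃ a : ℝ, 0 < a ∧ a ≤ 1 ∧ ∀ e, a ≤ Γ.len e := by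
  obtain ⟨a, ha, hl⟩ := Γ.len_bddBelow
  exact ⟨min a 1, by positivity, min_le_right _ _, fun e => (min_le_left _ _).trans (hl e)⟩

/-- The index theorem, reduced to statements about the kernel of `d` and about the orthogonal
complement of its range. -/
theorem IndexTheorem.of_kernels {V E : Type*} (Γ : MetricGraph V E) {H₀ H₁ K₀ K₁ : Type*}
    [NormedAddCommGroup H₀] [InnerProductSpace ℂ H₀] [CompleteSpace H₀]
    [NormedAddCommGroup H₁] [InnerProductSpace ℂ H₁] [CompleteSpace H₁]
    [NormedAddCommGroup K₀] [InnerProductSpace ℂ K₀] [CompleteSpace K₀]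
    [NormedAddCommGroup K₁] [InnerProductSpace ℂ K₁] [CompleteSpace K₁]
    {d : H₀ →ₗ.[ℂ] H₁} {fn : d.domain →ₗ[ℂ] Γ.H1max} {δ : K₀ →L[ℂ] K₁}
    {Φ₀ : d.domain →ₗ[ℂ] K₀} (Ψ : H₁ →ₗ[ℂ] K₁) {hyp₀ hyp₁ : Prop} {n : ℤ}
    (hd : IsExteriorDerivative d)
    (bound₀ : ∀ ℓ₀ : ℝ, 0 < ℓ₀ → ℓ₀ ≤ 1 → (∀ e, ℓ₀ ≤ Γ.len e) → ∀ x : d.domain,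
      ‖Φ₀ x‖ ^ 2 ≤ 4 / ℓ₀ * (‖(x : H₀)‖ ^ 2 + ‖Γ.deriv (fn x)‖ ^ 2))
    (bound₁ : ∀ y, ‖Ψ y‖ ≤ ‖y‖)
    (hderiv : ∀ x, d x = 0 → Γ.deriv (fn x) = 0)
    (ker₀ : ∀ x, d x = 0 → δ (Φ₀ x) = 0)
    (inj₀ : ∀ x, d x = 0 → Φ₀ x = 0 → x = 0)
    (surj₀ : hyp₀ → ∀ k, δ k = 0 → ∃ x, d x = 0 ∧ Φ₀ x = k)
    (ker₁ : ∀ y, (∀ x, ⟪y, d x⟫_ℂ = 0) → ∀ k, ⟪Ψ y, δ k⟫_ℂ = 0)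
    (inj₁ : ∀ y, (∀ x, ⟪y, d x⟫_ℂ = 0) → Ψ y = 0 → y = 0)
    (surj₁ : hyp₁ → ∀ η, (∀ k, ⟪η, δ k⟫_ℂ = 0) → ∃ y, (∀ x, ⟪y, d x⟫_ℂ = 0) ∧ Ψ y = η)
    (fin : Finite E → hyp₀ ∧ hyp₁ ∧ FiniteDimensional ℂ K₀ ∧ FiniteDimensional ℂ K₁ ∧
      (Module.finrank ℂ K₀ : ℤ) - Module.finrank ℂ K₁ = n) :
    Γ.IndexTheorem d fn δ Φ₀ (Ψ.comp (Submodule.subtype d.adjoint.domain)) hyp₀ hyp₁ n := by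
  obtain ⟨a, ha, ha1, hl⟩ := Γ.exists_len_lower_bound
  have hbound : ∀ ℓ₀ : ℝ, 0 < ℓ₀ → ℓ₀ ≤ 1 → (∀ e, ℓ₀ ≤ Γ.len e) → ∀ x : (diracOp d).domain,
      ‖susySum Φ₀ (Ψ.comp (Submodule.subtype d.adjoint.domain)) x‖
        ≤ 2 / √ℓ₀ *
          √(‖(x : WithLp 2 (H₀ × H₁))‖ ^ 2 + ‖Γ.deriv (fn ⟨x.1.fst, x.2.1⟩)‖ ^ 2) := by
    intro ℓ₀ h0 h1 hℓ x
    refine le_of_sq_le_sq ?_ (by positivity)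
    rw [mul_pow, div_pow, Real.sq_sqrt h0.le, Real.sq_sqrt (by positivity),
      WithLp.prod_norm_sq_eq_of_L2, WithLp.prod_norm_sq_eq_of_L2]
    have b0 := bound₀ ℓ₀ h0 h1 hℓ ⟨x.1.fst, x.2.1⟩
    have b1 : ‖Ψ x.1.snd‖ ^ 2 ≤ ‖x.1.snd‖ ^ 2 := by gcongr; exact bound₁ _
    -- The 1-form part satisfies the contraction bound; since `ℓ₀ ≤ 1` it fits under the constant `4
    -- / ℓ₀` of the 0-form part.
    have h4 : 1 ≤ 4 / ℓ₀ := by rw [le_div_iff₀ h0]; linarith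
    have h5 : ‖x.1.snd‖ ^ 2 ≤ 4 / ℓ₀ * ‖x.1.snd‖ ^ 2 := le_mul_of_one_le_left (sq_nonneg _) h4
    change ‖Φ₀ ⟨x.1.fst, x.2.1⟩‖ ^ 2 + ‖Ψ x.1.snd‖ ^ 2 ≤ _
    change ‖Φ₀ ⟨x.1.fst, x.2.1⟩‖ ^ 2
      ≤ 4 / ℓ₀ * (‖x.1.fst‖ ^ 2 + ‖Γ.deriv (fn ⟨x.1.fst, x.2.1⟩)‖ ^ 2) at b0
    norm_num
    linarith
  have hadj : ∀ y : d.adjoint.domain, d.adjoint y = 0 → ∀ x, ⟪(y : H₁), d x⟫_ℂ = 0 :=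
    fun y hy => (mem_pmapKer_adjoint hd.1).1 (mem_pmapKer.2 ⟨y.2, hy⟩)
  have hemb₀ : KerEmbedding d (bddPMap δ) Φ₀ := by
    refine ⟨fun x hx => mem_pmapKer_bddPMap.2 (ker₀ x hx), fun x y hx hy hxy => ?_⟩
    rw [← sub_eq_zero]
    exact inj₀ _ (by rw [LinearPMap.map_sub, hx, hy, sub_zero]) (by rw [map_sub, hxy, sub_self])
  have hemb₁ : KerEmbedding d.adjoint (bddPMap δ).adjoint
      (Ψ.comp (Submodule.subtype d.adjoint.domain)) := by
    refine ⟨fun y hy => mem_pmapKer_adjoint_bddPMap.2 (ker₁ y (hadj y hy)),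
      fun x y hx hy hxy => ?_⟩
    rw [← sub_eq_zero]
    refine Subtype.ext (inj₁ _ (hadj (x - y) ?_) ?_)
    · rw [LinearPMap.map_sub, hx, hy, sub_zero]
    · change Ψ (x : H₁) = Ψ (y : H₁) at hxy
      rw [Submodule.coe_sub, map_sub, hxy, sub_self]
  have hemb := hemb₀.susySum hemb₁
  have hδ := isExteriorDerivative_bddPMap δ
  have hiso₀ : hyp₀ → KerIsomorphism d (bddPMap δ) Φ₀ := fun h => by
    -- On `ker d` the derivative term in `bound₀` vanishes, so `Φ₀` is bounded there in the Hilbert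
    -- space norm alone.
    refine hemb₀.kerIsomorphism (isClosed_pmapKer hd.2) (isClosed_pmapKer hδ.2) (C := √(4 / a))
      (fun x hx => ?_) fun k hk => surj₀ h k (mem_pmapKer_bddPMap.1 hk)
    refine le_of_sq_le_sq ?_ (by positivity)
    have := bound₀ a ha ha1 hl x
    rw [mul_pow, Real.sq_sqrt (by positivity)]
    simpa [hderiv x hx] using this
  have hiso₁ : hyp₁ → KerIsomorphism d.adjoint (bddPMap δ).adjoint
      (Ψ.comp (Submodule.subtype d.adjoint.domain)) := fun h => by
    refine hemb₁.kerIsomorphism (isClosed_pmapKer (LinearPMap.adjoint_isClosed hd.1))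
      (isClosed_pmapKer (LinearPMap.adjoint_isClosed hδ.1)) (C := 1)
      (fun x _ => by rw [one_mul]; exact bound₁ _) fun η hη => ?_
    obtain ⟨y, hy, hyη⟩ := surj₁ h η (mem_pmapKer_adjoint_bddPMap.1 hη)
    obtain ⟨h1, h2⟩ := mem_pmapKer.1 ((mem_pmapKer_adjoint hd.1).2 hy)
    exact ⟨⟨y, h1⟩, h2, hyη⟩
  have hiso : hyp₀ → hyp₁ → KerIsomorphism (diracOp d) (diracOp (bddPMap δ))
      (susySum Φ₀ (Ψ.comp (Submodule.subtype d.adjoint.domain))) := fun h h' => by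
    refine hemb.kerIsomorphism (isClosed_pmapKer_diracOp hd) (isClosed_pmapKer_diracOp hδ)
      (C := 2 / √a) (fun x hx => ?_) fun k hk => ?_
    · have h1 := hbound a ha ha1 hl x
      have h2 : d ⟨x.1.fst, x.2.1⟩ = 0 := congrArg WithLp.snd hx
      rw [hderiv _ h2] at h1
      simpa using h1
    · obtain ⟨hk0, hk1⟩ := mem_pmapKer_diracOp.1 hk
      obtain ⟨x, hx, hxk⟩ := surj₀ h _ (mem_pmapKer_bddPMap.1 hk0)
      obtain ⟨y, hy, hyk⟩ := surj₁ h' _ (mem_pmapKer_adjoint_bddPMap.1 hk1)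
      obtain ⟨h1, h2⟩ := mem_pmapKer.1 ((mem_pmapKer_diracOp (x := WithLp.toLp 2 ((x : H₀), y))).2
        ⟨mem_pmapKer.2 ⟨x.2, hx⟩, (mem_pmapKer_adjoint hd.1).2 hy⟩)
      exact ⟨⟨_, h1⟩, h2, (WithLp.ofLp_injective 2) (Prod.ext hxk hyk)⟩
  have hindex : hyp₀ → hyp₁ → ∀ m : ℤ, HasIndex d m ↔ HasIndex (bddPMap δ) m :=
    fun h h' m => by
      obtain ⟨e₀, -⟩ := hiso₀ h
      obtain ⟨e₁, -⟩ := hiso₁ h'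
      exact ⟨fun hm => hm.congr e₀.symm.toLinearEquiv e₁.symm.toLinearEquiv,
        fun hm => hm.congr e₀.toLinearEquiv e₁.toLinearEquiv⟩
  refine ⟨hd, hbound, ⟨hemb, hemb₀, hemb₁⟩, hiso₀, hiso₁, hiso, hindex, fun hE => ?_⟩
  obtain ⟨h0, h1, hK0, hK1, hn⟩ := fin hE
  have := hasIndex_bddPMap δ hn
  exact ⟨hiso₀ h0, hiso₁ h1, hiso h0 h1, (hindex h0 h1 n).2 this, this⟩

end MetricGraph

/-! ### Primitives on an interval: the Volterra operator and hat functions. -/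

noncomputable section

namespace IntervalL2

variable {ℓ : ℝ}

/-- The constant function `1` on `(0, ℓ)`. -/
def one (ℓ : ℝ) : IntervalL2 ℓ := Lp.const 2 _ 1

theorem coeFn_one : ∀ᵐ x ∂(volume.restrict (Ioo (0 : ℝ) ℓ)), one ℓ x = 1 :=
  Lp.coeFn_const 2 _ _

theorem inner_one_left (hℓ : 0 < ℓ) (g : IntervalL2 ℓ) :
    ⟪one ℓ, g⟫_ℂ = ∫ t in (0 : ℝ)..ℓ, g t := by
  rw [L2.inner_def, intervalIntegral.integral_of_le hℓ.le, integral_Ioc_eq_integral_Ioo]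
  refine integral_congr_ae ?_
  filter_upwards [coeFn_one (ℓ := ℓ)] with x hx
  rw [hx]
  simp

theorem integral_one (hℓ : 0 < ℓ) : ∫ t in (0 : ℝ)..ℓ, one ℓ t = ℓ := by
  rw [intervalIntegral.integral_congr_ae (g := fun _ => (1 : ℂ))
    (ae_Ioo_mono ⟨hℓ.le, le_rfl⟩ coeFn_one)]
  simp

theorem norm_one_sq (hℓ : 0 < ℓ) : ‖one ℓ‖ ^ 2 = ℓ := by
  have h := inner_self_eq_norm_sq_to_K (𝕜 := ℂ) (one ℓ)
  rw [inner_one_left hℓ, integral_one hℓ] at h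
  exact Complex.ofReal_injective (by simpa using h.symm)

theorem norm_primitive_le (g : IntervalL2 ℓ) {x : ℝ} (hx : x ∈ Ioo 0 ℓ) :
    ‖∫ t in (0 : ℝ)..x, g t‖ ≤ √ℓ * ‖g‖ := by
  have hℓ : 0 < ℓ := hx.1.trans hx.2
  refine le_of_sq_le_sq ?_ (by positivity)
  rw [mul_pow, Real.sq_sqrt hℓ.le, intervalIntegral.integral_of_le hx.1.le,
    integral_Ioc_eq_integral_Ioo]
  refine (norm_setIntegral_sq_le measurableSet_Ioo (Ioo_subset_Ioo_right hx.2.le) g).trans ?_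
  gcongr
  simpa [hx.1.le] using hx.2.le

theorem continuousOn_primitive (hℓ : 0 < ℓ) (g : IntervalL2 ℓ) :
    ContinuousOn (fun x => ∫ t in (0 : ℝ)..x, g t) (Icc 0 ℓ) := by
  have := intervalIntegral.continuousOn_primitive_interval' (g.intervalIntegrable hℓ)
    left_mem_uIcc
  rwa [uIcc_of_le hℓ.le] at this

theorem memLp_primitive (hℓ : 0 < ℓ) (g : IntervalL2 ℓ) :
    MemLp (fun x => ∫ t in (0 : ℝ)..x, g t) 2 (volume.restrict (Ioo (0 : ℝ) ℓ)) := by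
  refine MemLp.of_bound
    (((continuousOn_primitive hℓ g).mono Ioo_subset_Icc_self).aestronglyMeasurable
      measurableSet_Ioo) (√ℓ * ‖g‖) ?_
  filter_upwards [ae_restrict_mem measurableSet_Ioo] with x hx using norm_primitive_le g hx

/-- The primitive of `g` with value `0` at `0`. -/
def volterraFun (hℓ : 0 < ℓ) (g : IntervalL2 ℓ) : IntervalL2 ℓ := (memLp_primitive hℓ g).toLp _

theorem isPrimitive_volterraFun (hℓ : 0 < ℓ) (g : IntervalL2 ℓ) :
    IsPrimitive 0 g (volterraFun hℓ g) := by
  filter_upwards [(memLp_primitive hℓ g).coeFn_toLp] with x hx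
  rw [volterraFun, hx, zero_add]

theorem _root_.IsPrimitive.unique_fn {c : ℂ} {g f f' : IntervalL2 ℓ} (h : IsPrimitive c g f)
    (h' : IsPrimitive c g f') : f = f' := by
  refine Lp.ext ?_
  filter_upwards [h, h'] with x h1 h2
  rw [h1, h2]

/-- The Volterra operator on `L²(0, ℓ)`, which maps `g` to its primitive vanishing at `0`. -/
def volterra (hℓ : 0 < ℓ) : IntervalL2 ℓ →L[ℂ] IntervalL2 ℓ :=
  LinearMap.mkContinuous
    { toFun := volterraFun hℓ
      map_add' := fun g g' => (isPrimitive_volterraFun hℓ (g + g')).unique_fn <| by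
        simpa using (isPrimitive_volterraFun hℓ g).add hℓ (isPrimitive_volterraFun hℓ g')
      map_smul' := fun a g => (isPrimitive_volterraFun hℓ (a • g)).unique_fn <| by
        simpa using (isPrimitive_volterraFun hℓ g).smul a }
    (((volume.restrict (Ioo (0 : ℝ) ℓ)).real univ) ^ (2 : ℝ)⁻¹ * √ℓ) fun g => by
      rw [mul_assoc]
      refine Lp.norm_le_of_ae_bound (p := 2) (by positivity) ?_
      filter_upwards [(memLp_primitive hℓ g).coeFn_toLp, ae_restrict_mem measurableSet_Ioo]
        with x hx hxm
      change ‖volterraFun hℓ g x‖ ≤ _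
      rw [volterraFun, hx]
      exact norm_primitive_le g hxm

theorem isPrimitive_volterra (hℓ : 0 < ℓ) (g : IntervalL2 ℓ) :
    IsPrimitive 0 g (volterra hℓ g) :=
  isPrimitive_volterraFun hℓ g

theorem isPrimitive_one : IsPrimitive 1 0 (one ℓ) := by
  filter_upwards [coeFn_one (ℓ := ℓ), ae_restrict_mem measurableSet_Ioo] with x h1 hx
  have hx' : x ∈ Icc 0 ℓ := ⟨hx.1.le, hx.2.le⟩
  have : ∫ t in (0 : ℝ)..x, (0 : IntervalL2 ℓ) t = ∫ t in (0 : ℝ)..x, (0 : ℂ) :=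
    intervalIntegral.integral_congr_ae (ae_Ioo_mono hx' (Lp.coeFn_zero ℂ 2 _))
  rw [h1, this]
  simp

theorem isPrimitive_const (c : ℂ) : IsPrimitive c 0 (c • one ℓ) := by
  simpa using (isPrimitive_one (ℓ := ℓ)).smul c

/-- This replaces the almost everywhere condition by an identity in the Hilbert space, so that
closedness and density of Sobolev functions become operator statements. -/
theorem isPrimitive_iff (hℓ : 0 < ℓ) {c : ℂ} {g f : IntervalL2 ℓ} :
    IsPrimitive c g f ↔ f = c • one ℓ + volterra hℓ g := by
  have h : IsPrimitive c g (c • one ℓ + volterra hℓ g) := by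
    simpa using (isPrimitive_const c).add hℓ (isPrimitive_volterra hℓ g)
  exact ⟨fun h' => h'.unique_fn h, fun h' => h' ▸ h⟩

/-- Integration by parts, obtained from Fubini on the triangle `t ≤ x`: the adjoint of the Volterra
operator sends `h` to `∫_x^ℓ h`, that is, to the total integral minus the primitive. -/
theorem inner_volterra_left (hℓ : 0 < ℓ) (g h : IntervalL2 ℓ) :
    ⟪volterra hℓ g, h⟫_ℂ = ⟪g, (∫ t in (0 : ℝ)..ℓ, h t) • one ℓ - volterra hℓ h⟫_ℂ := by
  set μ := volume.restrict (Ioo (0 : ℝ) ℓ) with hμ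
  let S : Set (ℝ × ℝ) := {p | p.2 ≤ p.1}
  have hS : MeasurableSet S := measurableSet_le measurable_snd measurable_fst
  let K : ℝ → ℝ → ℂ := fun x t => S.indicator (fun p => h p.1 * (starRingEnd ℂ) (g p.2)) (x, t)
  have hint : Integrable (Function.uncurry K) (μ.prod μ) := by
    have h1 : Integrable (fun t => (starRingEnd ℂ) (g t)) μ :=
      ((LinearIsometryEquiv.integrable_comp_iff Complex.conjLIE).2 g.integrableOn :)
    have h2 : Integrable (fun p : ℝ × ℝ => h p.1 * (starRingEnd ℂ) (g p.2)) (μ.prod μ) :=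
      Integrable.mul_prod h.integrableOn h1
    exact h2.indicator hS
  have hl : ⟪volterra hℓ g, h⟫_ℂ = ∫ x, ∫ t, K x t ∂μ ∂μ := by
    rw [L2.inner_def]
    refine integral_congr_ae ?_
    filter_upwards [isPrimitive_volterra hℓ g, ae_restrict_mem measurableSet_Ioo] with x hx hxm
    have h1 : (fun t => K x t) = (Iic x).indicator fun t => h x * (starRingEnd ℂ) (g t) := by
      ext t
      simp only [K, S, indicator, mem_ofPred_eq, mem_Iic]
    have h2 : Iic x ∩ Ioo 0 ℓ = Ioc 0 x := by
      ext t
      simp only [mem_inter_iff, mem_Iic, mem_Ioo, mem_Ioc]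
      exact ⟨fun h => ⟨h.2.1, h.1⟩, fun h => ⟨h.2, h.1, h.2.trans_lt hxm.2⟩⟩
    rw [h1, integral_indicator measurableSet_Iic, hμ, Measure.restrict_restrict measurableSet_Iic,
      h2, integral_const_mul, integral_conj, ← intervalIntegral.integral_of_le hxm.1.le, hx]
    simp
  have hr : ⟪g, (∫ t in (0 : ℝ)..ℓ, h t) • one ℓ - volterra hℓ h⟫_ℂ
      = ∫ t, ∫ x, K x t ∂μ ∂μ := by
    rw [L2.inner_def]
    refine integral_congr_ae ?_
    filter_upwards [isPrimitive_volterra hℓ h, ae_restrict_mem measurableSet_Ioo,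
      coeFn_one (ℓ := ℓ), Lp.coeFn_sub ((∫ t in (0 : ℝ)..ℓ, h t) • one ℓ) (volterra hℓ h),
      Lp.coeFn_smul (∫ t in (0 : ℝ)..ℓ, h t) (one ℓ)] with t ht htm h1 h2 h3
    have h4 : (fun x => K x t) = (Ici t).indicator fun x => h x * (starRingEnd ℂ) (g t) := by
      ext x
      simp only [K, S, indicator, mem_ofPred_eq, mem_Ici]
    have h5 : Ici t ∩ Ioo 0 ℓ = Ico t ℓ := by
      ext x
      simp only [mem_inter_iff, mem_Ici, mem_Ioo, mem_Ico]
      exact ⟨fun h => ⟨h.1, h.2.2⟩, fun h => ⟨h.1, htm.1.trans_le h.1, h.2⟩⟩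
    have h0 : (0 : ℝ) ∈ Icc 0 ℓ := ⟨le_rfl, hℓ.le⟩
    have htm' : t ∈ Icc 0 ℓ := ⟨htm.1.le, htm.2.le⟩
    have h6 := intervalIntegral.integral_add_adjacent_intervals
      (h.intervalIntegrable' hℓ h0 htm') (h.intervalIntegrable' hℓ htm' ⟨hℓ.le, le_rfl⟩)
    rw [h4, integral_indicator measurableSet_Ici, hμ, Measure.restrict_restrict measurableSet_Ici,
      h5, integral_mul_const, integral_Ico_eq_integral_Ioo, ← integral_Ioc_eq_integral_Ioo,
      ← intervalIntegral.integral_of_le htm.2.le, h2, Pi.sub_apply, h3, Pi.smul_apply, h1, ht,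
      ← h6]
    simp
  rw [hl, hr, integral_integral_swap hint]

/-- A function orthogonal to all functions with vanishing integral is constant. -/
theorem eq_const_of_orthogonal (hℓ : 0 < ℓ) {q : IntervalL2 ℓ}
    (h : ∀ u : IntervalL2 ℓ, ∫ t in (0 : ℝ)..ℓ, u t = 0 → ⟪q, u⟫_ℂ = 0) :
    q = ((∫ t in (0 : ℝ)..ℓ, q t) / ℓ) • one ℓ := by
  have hl : (ℓ : ℂ) ≠ 0 := by exact_mod_cast hℓ.ne'
  set c : ℂ := (∫ t in (0 : ℝ)..ℓ, q t) / ℓ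
  have h1 : ∫ t in (0 : ℝ)..ℓ, (q - c • one ℓ) t = 0 := by
    rw [← inner_one_left hℓ, inner_sub_right, inner_smul_right, inner_one_left hℓ,
      inner_one_left hℓ, integral_one hℓ, div_mul_cancel₀ _ hl, sub_self]
  -- Subtracting its mean `c` from `q` leaves a function with integral zero; it is orthogonal to `q`
  -- by assumption and to constants by the choice of `c`, hence to itself.
  have h2 : ⟪q - c • one ℓ, q - c • one ℓ⟫_ℂ = 0 := by
    rw [inner_sub_left (z := q - c • one ℓ), h _ h1, inner_smul_left, inner_one_left hℓ, h1,
      mul_zero, sub_zero]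
  exact sub_eq_zero.1 (inner_self_eq_zero.1 h2)

/-- `H¹`-functions vanishing at both ends are dense. -/
theorem eq_zero_of_orthogonal_volterra (hℓ : 0 < ℓ) {h : IntervalL2 ℓ}
    (hh : ∀ u : IntervalL2 ℓ, ∫ t in (0 : ℝ)..ℓ, u t = 0 → ⟪volterra hℓ u, h⟫_ℂ = 0) :
    h = 0 := by
  set k : ℂ := ∫ t in (0 : ℝ)..ℓ, h t
  -- The adjoint of the Volterra operator applied to `h` is orthogonal to all functions of integral
  -- zero, hence constant. So the zero function is a primitive of `h`, and uniqueness of derivatives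
  -- gives `h = 0`.
  have h1 := eq_const_of_orthogonal hℓ (q := k • one ℓ - volterra hℓ h) fun u hu => by
    rw [← inner_conj_symm, ← inner_volterra_left, hh u hu, map_zero]
  set c : ℂ := (∫ t in (0 : ℝ)..ℓ, (k • one ℓ - volterra hℓ h) t) / ℓ
  have h2 : IsPrimitive (c - k) h 0 := by
    rw [isPrimitive_iff hℓ, sub_smul, ← h1]
    abel
  exact (h2.eq_zero hℓ).2

/-- The pair `(f, g)` qualifies exactly when `f` minus the Volterra primitive of `g` lies on the
line of constants, which is closed because it is finite dimensional. -/
theorem isClosed_primitives (hℓ : 0 < ℓ) :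
    IsClosed {p : IntervalL2 ℓ × IntervalL2 ℓ | ∃ c, IsPrimitive c p.2 p.1} := by
  have h : {p : IntervalL2 ℓ × IntervalL2 ℓ | ∃ c, IsPrimitive c p.2 p.1}
      = (fun p => p.1 - volterra hℓ p.2) ⁻¹'
        ((Submodule.span ℂ {one ℓ} : Submodule ℂ (IntervalL2 ℓ)) : Set (IntervalL2 ℓ)) := by
    ext p
    simp only [mem_ofPred_eq, mem_preimage, SetLike.mem_coe, Submodule.mem_span_singleton,
      isPrimitive_iff hℓ, eq_sub_iff_add_eq, eq_comm]
  rw [h]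
  exact (Submodule.closed_of_finiteDimensional _).preimage (by fun_prop)

theorem integral_indicatorConstLp {s : Set ℝ} (hs : MeasurableSet s)
    (hfin : volume.restrict (Ioo (0 : ℝ) ℓ) s ≠ ∞) (c : ℂ) {x : ℝ} (hx : x ∈ Icc 0 ℓ) :
    ∫ t in (0 : ℝ)..x, indicatorConstLp 2 hs hfin c t = volume.real (Ioc 0 x ∩ s) • c := by
  rw [intervalIntegral.integral_congr_ae (g := s.indicator fun _ => c)
    (ae_Ioo_mono hx indicatorConstLp_coeFn), intervalIntegral.integral_of_le hx.1,
    setIntegral_indicator hs, setIntegral_const]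

theorem norm_indicatorConstLp_sq {s : Set ℝ} (hs : MeasurableSet s) (hsub : s ⊆ Ioo 0 ℓ)
    (hfin : volume.restrict (Ioo (0 : ℝ) ℓ) s ≠ ∞) (c : ℂ) :
    ‖indicatorConstLp 2 hs hfin c‖ ^ 2 = volume.real s * ‖c‖ ^ 2 := by
  rw [norm_indicatorConstLp (by norm_num) (by norm_num), mul_pow,
    ← Real.rpow_natCast, ← Real.rpow_natCast, ← Real.rpow_mul measureReal_nonneg]
  norm_num
  rw [inter_eq_self_of_subset_left hsub, mul_comm]

/-- The hat function which decreases from `1` to `0` on `(0, a)`. -/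
theorem exists_hat_init {a : ℝ} (ha : 0 < a) (hl : a ≤ ℓ) :
    ∃ γ χ : IntervalL2 ℓ, IsPrimitive 1 γ χ ∧ ∫ t in (0 : ℝ)..ℓ, γ t = -1 ∧
      ‖γ‖ ^ 2 ≤ 1 / a ∧ ‖χ‖ ^ 2 ≤ a := by
  have hℓ : 0 < ℓ := ha.trans_le hl
  have hsub : Ioo 0 a ⊆ Ioo 0 ℓ := Ioo_subset_Ioo_right hl
  have hfin : volume.restrict (Ioo (0 : ℝ) ℓ) (Ioo 0 a) ≠ ∞ := measure_ne_top _ _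
  have hvol : volume.real (Ioo 0 a) = a := by simp [ha.le]
  -- Slope `-1/a` on `(0, a)` and `0` afterwards; then `‖γ‖² = a · a⁻²`.
  let γ : IntervalL2 ℓ := indicatorConstLp 2 measurableSet_Ioo hfin (-1 / a : ℂ)
  have ha' : (a : ℂ) ≠ 0 := by exact_mod_cast ha.ne'
  have hprim : ∀ x ∈ Icc 0 ℓ, ∫ t in (0 : ℝ)..x, γ t = -((min x a / a : ℝ) : ℂ) := by
    intro x hx
    have h1 : volume.real (Ioc 0 x ∩ Ioo 0 a) = min x a := by
      have : (Ioc 0 x ∩ Ioo 0 a : Set ℝ) =ᵐ[volume] Ioc 0 (min x a) := by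
        have := (ae_eq_refl (Ioc 0 x)).inter (Ioo_ae_eq_Ioc (μ := volume) (a := (0 : ℝ)) (b := a))
        refine this.trans ?_
        rw [Ioc_inter_Ioc, sup_idem]
        exact Filter.EventuallyEq.rfl
      rw [measureReal_congr this]
      simp [hx.1, ha.le]
    rw [integral_indicatorConstLp measurableSet_Ioo hfin _ hx, h1, Complex.real_smul]
    push_cast
    ring
  refine ⟨γ, (1 : ℂ) • one ℓ + volterra hℓ γ, (isPrimitive_iff hℓ).2 rfl, ?_, ?_, ?_⟩
  · rw [hprim ℓ ⟨hℓ.le, le_rfl⟩, min_eq_right hl, div_self ha.ne', Complex.ofReal_one]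
  · rw [norm_indicatorConstLp_sq measurableSet_Ioo hsub, hvol]
    simp only [norm_div, norm_neg, norm_one, Complex.norm_real, Real.norm_of_nonneg ha.le]
    apply le_of_eq
    field_simp
  -- The hat takes values in `[0, 1]` and vanishes past `a`, so it is dominated by the indicator of
  -- `(0, a)`. Both norm bounds thus depend on `a` only, not on `ℓ`.
  · have h1 : ‖(1 : ℂ) • one ℓ + volterra hℓ γ‖
        ≤ ‖(indicatorConstLp 2 measurableSet_Ioo hfin (1 : ℂ) : IntervalL2 ℓ)‖ := by
      refine Lp.norm_le_norm_of_ae_le ?_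
      have hp : IsPrimitive 1 γ ((1 : ℂ) • one ℓ + volterra hℓ γ) := (isPrimitive_iff hℓ).2 rfl
      filter_upwards [hp, ae_restrict_mem measurableSet_Ioo,
        indicatorConstLp_coeFn (p := 2) (hs := measurableSet_Ioo) (hμs := hfin) (c := (1 : ℂ))]
        with x hx hxm hxi
      rw [hx, hxi, hprim x ⟨hxm.1.le, hxm.2.le⟩, ← sub_eq_add_neg, ← Complex.ofReal_one,
        ← Complex.ofReal_sub, Complex.norm_real]
      by_cases hxa : x < a
      · rw [indicator_of_mem (show x ∈ Ioo 0 a from ⟨hxm.1, hxa⟩), min_eq_left hxa.le]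
        have h2 : 0 ≤ x / a := div_nonneg hxm.1.le ha.le
        have h3 : x / a ≤ 1 := (div_le_one ha).2 hxa.le
        rw [Complex.ofReal_one, norm_one, Real.norm_of_nonneg (by linarith)]
        linarith
      · rw [min_eq_right (not_lt.1 hxa), div_self ha.ne', sub_self, norm_zero]
        exact norm_nonneg _
    refine (pow_le_pow_left₀ (norm_nonneg _) h1 2).trans ?_
    rw [norm_indicatorConstLp_sq measurableSet_Ioo hsub, hvol]
    simp

/-- The hat function which increases from `0` to `1` on `(ℓ - a, ℓ)`. -/
theorem exists_hat_term {a : ℝ} (ha : 0 < a) (hl : a ≤ ℓ) :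
    ∃ γ χ : IntervalL2 ℓ, IsPrimitive 0 γ χ ∧ ∫ t in (0 : ℝ)..ℓ, γ t = 1 ∧
      ‖γ‖ ^ 2 ≤ 1 / a ∧ ‖χ‖ ^ 2 ≤ a := by
  have hℓ : 0 < ℓ := ha.trans_le hl
  have hsub : Ioo (ℓ - a) ℓ ⊆ Ioo 0 ℓ := Ioo_subset_Ioo_left (by linarith)
  have hfin : volume.restrict (Ioo (0 : ℝ) ℓ) (Ioo (ℓ - a) ℓ) ≠ ∞ := measure_ne_top _ _
  have hvol : volume.real (Ioo (ℓ - a) ℓ) = a := by simp [ha.le]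
  let γ : IntervalL2 ℓ := indicatorConstLp 2 measurableSet_Ioo hfin (1 / a : ℂ)
  have ha' : (a : ℂ) ≠ 0 := by exact_mod_cast ha.ne'
  have hprim : ∀ x ∈ Icc 0 ℓ, ∫ t in (0 : ℝ)..x, γ t = ((max (x - (ℓ - a)) 0 / a : ℝ) : ℂ) := by
    intro x hx
    have h1 : volume.real (Ioc 0 x ∩ Ioo (ℓ - a) ℓ) = max (x - (ℓ - a)) 0 := by
      have : (Ioc 0 x ∩ Ioo (ℓ - a) ℓ : Set ℝ) =ᵐ[volume] Ioc (ℓ - a) x := by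
        have := (ae_eq_refl (Ioc 0 x)).inter (Ioo_ae_eq_Ioc (μ := volume) (a := ℓ - a) (b := ℓ))
        refine this.trans ?_
        -- For `x ≤ ℓ - a` this interval is empty, which the positive part in `h1` takes into
        -- account.
        rw [Ioc_inter_Ioc, sup_eq_right.2 (by linarith), inf_eq_left.2 hx.2]
        exact Filter.EventuallyEq.rfl
      rw [measureReal_congr this, measureReal_def, Real.volume_Ioc, ENNReal.toReal_ofReal']
    rw [integral_indicatorConstLp measurableSet_Ioo hfin _ hx, h1, Complex.real_smul]
    push_cast
    ring
  refine ⟨γ, volterra hℓ γ, isPrimitive_volterra hℓ γ, ?_, ?_, ?_⟩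
  · rw [hprim ℓ ⟨hℓ.le, le_rfl⟩, sub_sub_cancel, max_eq_left ha.le, div_self ha.ne',
      Complex.ofReal_one]
  · rw [norm_indicatorConstLp_sq measurableSet_Ioo hsub, hvol]
    simp only [norm_div, norm_one, Complex.norm_real, Real.norm_of_nonneg ha.le]
    apply le_of_eq
    field_simp
  · have h1 : ‖volterra hℓ γ‖
        ≤ ‖(indicatorConstLp 2 measurableSet_Ioo hfin (1 : ℂ) : IntervalL2 ℓ)‖ := by
      refine Lp.norm_le_norm_of_ae_le ?_
      filter_upwards [isPrimitive_volterra hℓ γ, ae_restrict_mem measurableSet_Ioo,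
        indicatorConstLp_coeFn (p := 2) (hs := measurableSet_Ioo) (hμs := hfin) (c := (1 : ℂ))]
        with x hx hxm hxi
      rw [hx, hxi, hprim x ⟨hxm.1.le, hxm.2.le⟩, zero_add, Complex.norm_real]
      by_cases hxa : ℓ - a < x
      · rw [indicator_of_mem (show x ∈ Ioo (ℓ - a) ℓ from ⟨hxa, hxm.2⟩),
          max_eq_left (by linarith), norm_one, Real.norm_of_nonneg
            (div_nonneg (by linarith) ha.le), div_le_one ha]
        linarith [hxm.2]
      · rw [max_eq_right (by linarith), zero_div, norm_zero]
        exact norm_nonneg _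
    refine (pow_le_pow_left₀ (norm_nonneg _) h1 2).trans ?_
    rw [norm_indicatorConstLp_sq measurableSet_Ioo hsub, hvol]
    simp

end IntervalL2
end

/-! ### Sobolev functions and 1-forms on the metric graph. -/

namespace MetricGraph

open IntervalL2 Filter Topology

variable {V E : Type*} {Γ : MetricGraph V E}

/-- The derivative and the initial values of an element of `H1max` are obtained by choice.
Uniqueness identifies them with prescribed data, so concrete functions are constructed through this
lemma. -/
theorem exists_H1max {f g : Γ.L2} {c : E → ℂ} (h : ∀ e, IsPrimitive (c e) (g e) (f e)) :
    ∃ m : Γ.H1max, (m : Γ.L2) = f ∧ Γ.deriv m = g ∧ (∀ e, Γ.trace m (Γ.initEnd e) = c e) ∧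
      ∀ e, Γ.trace m (Γ.termEnd e) = c e + ∫ t in (0 : ℝ)..Γ.len e, g e t := by
  let m : Γ.H1max := ⟨f, g, fun e => ⟨c e, h e⟩⟩
  obtain ⟨h1, h2⟩ := Γ.deriv_unique (Γ.isPrimitive_derivFun m) h
  refine ⟨m, rfl, h1, fun e => congrFun h2 e, fun e => ?_⟩
  change Γ.initVal m e + ∫ t in (0 : ℝ)..Γ.len e, Γ.derivFun m e t = _
  rw [h1, h2]

theorem Gmax_ext {F F' : Γ.Gmax} (h : ∀ e, F (Γ.initEnd e) = F' (Γ.initEnd e))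
    (h' : ∀ e, F (Γ.termEnd e) = F' (Γ.termEnd e)) : F = F' := by
  refine lp.ext (funext fun x => ?_)
  obtain ⟨e | e, rfl⟩ := Γ.halfEdgeEquiv.surjective x
  exacts [h' e, h e]

/-- The fundamental theorem of calculus: `∫ f' = d f̲`. -/
theorem edgeIntegral_deriv (m : Γ.H1max) :
    Γ.edgeIntegral (Γ.deriv m) = Γ.dMax (Γ.trace m) := by
  refine lp.ext (funext fun e => ?_)
  change Γ.toFibre e (∫ t in (0 : ℝ)..Γ.len e, Γ.derivFun m e t) = Γ.toFibre e
    ((Γ.initVal m e + ∫ t in (0 : ℝ)..Γ.len e, Γ.derivFun m e t) - Γ.initVal m e)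
  rw [add_sub_cancel_left]

theorem norm_edgeIntegral_le (g : Γ.L2) : ‖Γ.edgeIntegral g‖ ≤ ‖g‖ := by
  refine le_of_sq_le_sq ?_ (norm_nonneg _)
  rw [norm_sq_eq_tsum, norm_sq_eq_tsum]
  exact Summable.tsum_le_tsum (Γ.norm_fibre_integral_sq_le g)
    (summable_norm_sq (Γ.edgeIntegral g)) (summable_norm_sq g)

/-- The interval estimate is used on the subinterval of length `a` next to each end. The two ends
add up to `(4/a)‖f‖² + 4a‖f'‖²`, and `a ≤ 1/a` because `a ≤ 1`. -/
theorem norm_trace_sq_le {a : ℝ} (ha : 0 < a) (ha1 : a ≤ 1) (hl : ∀ e, a ≤ Γ.len e)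
    (m : Γ.H1max) :
    ‖Γ.trace m‖ ^ 2 ≤ 4 / a * (‖(m : Γ.L2)‖ ^ 2 + ‖Γ.deriv m‖ ^ 2) := by
  have hs1 := summable_norm_sq (m : Γ.L2)
  have hs2 := summable_norm_sq (Γ.deriv m)
  rw [norm_sq_Gmax, norm_sq_eq_tsum (m : Γ.L2), norm_sq_eq_tsum (Γ.deriv m), ← hs1.tsum_add hs2,
    ← tsum_mul_left]
  refine Summable.tsum_le_tsum (fun e => ?_)
    ((Γ.summable_ends _).1.add (Γ.summable_ends _).2) ((hs1.add hs2).mul_left _)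
  have h1 : ‖Γ.trace m (Γ.termEnd e)‖ ^ 2 ≤ _ :=
    (Γ.isPrimitive_derivFun m e).norm_value_sq_le (p := Γ.len e - a) (y := Γ.len e) ha
      (by linarith [hl e]) (by linarith) ⟨by linarith, by linarith⟩
  have h2 := (Γ.isPrimitive_derivFun m e).norm_value_sq_le (p := 0) (y := 0) ha
      le_rfl (by linarith [hl e]) ⟨by linarith, by linarith⟩
  rw [intervalIntegral.integral_same, add_zero] at h2
  change ‖Γ.trace m (Γ.initEnd e)‖ ^ 2 ≤ _ at h2
  change _ ≤ 4 / a * (‖(m : Γ.L2) e‖ ^ 2 + ‖Γ.derivFun m e‖ ^ 2)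
  have h3 : a ≤ 1 / a := by rw [le_div_iff₀ ha]; nlinarith
  have h4 : a * ‖Γ.derivFun m e‖ ^ 2 ≤ 1 / a * ‖Γ.derivFun m e‖ ^ 2 := by gcongr
  have h5 : 4 / a * (‖(m : Γ.L2) e‖ ^ 2 + ‖Γ.derivFun m e‖ ^ 2)
      = 2 * (2 / a * ‖(m : Γ.L2) e‖ ^ 2) + 4 * (1 / a * ‖Γ.derivFun m e‖ ^ 2) := by ring
  rw [h5]
  linarith

/-- The functions supported on a single edge, with vanishing boundary values. -/
theorem exists_single (e : E) (u : IntervalL2 (Γ.len e))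
    (hu : ∫ t in (0 : ℝ)..Γ.len e, u t = 0) :
    ∃ m : Γ.H1max, Γ.trace m = 0 ∧ (∀ h : Γ.L2,
      ⟪(m : Γ.L2), h⟫_ℂ = ⟪volterra (Γ.len_pos e) u, h e⟫_ℂ ∧ ⟪h, Γ.deriv m⟫_ℂ = ⟪h e, u⟫_ℂ) := by
  classical
  have hp : ∀ e', IsPrimitive 0 ((lp.single 2 e u : Γ.L2) e')
      ((lp.single 2 e (volterra (Γ.len_pos e) u) : Γ.L2) e') := by
    intro e'
    by_cases h : e' = e
    · subst h
      rw [lp.single_apply_self, lp.single_apply_self]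
      exact isPrimitive_volterra _ u
    · rw [lp.single_apply_ne _ _ _ h, lp.single_apply_ne _ _ _ h]
      exact isPrimitive_zero
  obtain ⟨m, h1, h2, h3, h4⟩ := exists_H1max hp
  refine ⟨m, Gmax_ext h3 fun e' => ?_, fun h => ⟨?_, ?_⟩⟩
  · rw [h4, zero_add]
    by_cases h : e' = e
    · subst h
      rw [lp.single_apply_self, hu]
      rfl
    · rw [lp.single_apply_ne _ _ _ h, ← inner_one_left (Γ.len_pos e'), inner_zero_right]
      rfl
  · rw [h1, lp.inner_single_left]
  · rw [h2, lp.inner_single_right]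

/-- A `1`-form orthogonal to the derivatives of all functions vanishing at the vertices is
constant on each edge, so that its inner products are those of its edge integrals. -/
theorem inner_eq_inner_edgeIntegral {g : Γ.L2}
    (hg : ∀ m : Γ.H1max, Γ.trace m = 0 → ⟪g, Γ.deriv m⟫_ℂ = 0) (g' : Γ.L2) :
    ⟪g, g'⟫_ℂ = ⟪Γ.edgeIntegral g, Γ.edgeIntegral g'⟫_ℂ := by
  rw [lp.inner_eq_tsum, lp.inner_eq_tsum]
  refine tsum_congr fun e => ?_
  have h1 := eq_const_of_orthogonal (Γ.len_pos e) (q := g e) fun u hu => by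
    obtain ⟨m, hm, h⟩ := exists_single e u hu
    rw [← (h g).2, hg m hm]
  change _ = ⟪∫ t in (0 : ℝ)..Γ.len e, g e t, ∫ t in (0 : ℝ)..Γ.len e, g' e t⟫_ℂ
    / (Γ.len e : ℂ)
  set c := ∫ t in (0 : ℝ)..Γ.len e, g e t
  -- With `g_e = c / ℓ_e` constant, the left side is `c̄ / ℓ_e` times the integral of `g'_e`, which
  -- is the inner product of the fibre.
  rw [h1, inner_smul_left, inner_one_left (Γ.len_pos e), map_div₀, Complex.conj_ofReal,
    RCLike.inner_apply]
  ring

theorem eq_zero_of_edgeIntegral_eq_zero {g : Γ.L2}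
    (hg : ∀ m : Γ.H1max, Γ.trace m = 0 → ⟪g, Γ.deriv m⟫_ℂ = 0) (h : Γ.edgeIntegral g = 0) :
    g = 0 := by
  rw [← inner_self_eq_zero (𝕜 := ℂ), inner_eq_inner_edgeIntegral hg, h, inner_zero_left]

/-- The `1`-form which is constant on each edge, with given edge integrals. -/
theorem exists_edgeIntegral_eq (η : Γ.EdgeL2) :
    ∃ g : Γ.L2, Γ.edgeIntegral g = η ∧ ∀ g', ⟪g, g'⟫_ℂ = ⟪η, Γ.edgeIntegral g'⟫_ℂ := by
  let c : E → ℂ := fun e => (Γ.toFibre e).symm (η e)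
  have hc : ∀ e, Γ.toFibre e (c e) = η e := fun e => (Γ.toFibre e).apply_symm_apply _
  -- The constant `c_e / ℓ_e` has integral `c_e` and squared norm `|c_e|² / ℓ_e`, the weight of
  -- `ℓ²(E)`; square summability therefore needs no bound on the lengths.
  have hn : ∀ e, ‖(c e / Γ.len e) • one (Γ.len e)‖ ^ 2 = ‖η e‖ ^ 2 := by
    intro e
    have := (Γ.len_pos e).ne'
    rw [← hc, norm_toFibre_sq, norm_smul, mul_pow, norm_one_sq (Γ.len_pos e), norm_div,
      Complex.norm_real, Real.norm_of_nonneg (Γ.len_pos e).le]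
    field_simp
  let g : Γ.L2 := ⟨fun e => (c e / Γ.len e) • one (Γ.len e), memℓp_two <| by
    simp only [hn]
    exact summable_norm_sq η⟩
  have hg : ∀ e, g e = (c e / Γ.len e) • one (Γ.len e) := fun _ => rfl
  refine ⟨g, lp.ext (funext fun e => ?_), fun g' => ?_⟩
  · have hl : (Γ.len e : ℂ) ≠ 0 := by exact_mod_cast (Γ.len_pos e).ne'
    change Γ.toFibre e (∫ t in (0 : ℝ)..Γ.len e, g e t) = η e
    rw [← inner_one_left (Γ.len_pos e), hg, inner_smul_right, inner_one_left (Γ.len_pos e),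
      integral_one (Γ.len_pos e), div_mul_cancel₀ _ hl, hc]
  · rw [lp.inner_eq_tsum, lp.inner_eq_tsum]
    refine tsum_congr fun e => ?_
    rw [← hc]
    change _ = ⟪c e, ∫ t in (0 : ℝ)..Γ.len e, g' e t⟫_ℂ / (Γ.len e : ℂ)
    rw [hg, inner_smul_left, inner_one_left (Γ.len_pos e), map_div₀, Complex.conj_ofReal,
      RCLike.inner_apply]
    ring

/-- Functions vanishing at all ends are dense, by the interval statement applied on one edge at a
time. They belong to every domain considered below (paired with `F = 0` where needed), so this gives
density of all of them in the function component. -/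
theorem eq_zero_of_orthogonal_ker_trace {h : Γ.L2}
    (hh : ∀ m : Γ.H1max, Γ.trace m = 0 → ⟪(m : Γ.L2), h⟫_ℂ = 0) : h = 0 := by
  refine lp.ext (funext fun e => eq_zero_of_orthogonal_volterra (Γ.len_pos e) fun u hu => ?_)
  obtain ⟨m, hm, h'⟩ := exists_single e u hu
  rw [← (h' h).1, hh m hm]

theorem eq_zero_of_deriv_of_trace {m : Γ.H1max} (h : Γ.deriv m = 0) (h' : Γ.trace m = 0) :
    m = 0 := by
  refine Subtype.ext (lp.ext (funext fun e => ?_))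
  have h1 := Γ.isPrimitive_derivFun m e
  have h2 : Γ.initVal m e = 0 := congrArg (fun F : Γ.Gmax => F (Γ.initEnd e)) h'
  have h3 : Γ.derivFun m = 0 := h
  rw [h2, h3] at h1
  exact h1.unique_fn isPrimitive_zero

/-- A locally constant function with given boundary values, if the edge lengths are bounded. -/
theorem exists_deriv_eq_zero (hb : BddAbove (range Γ.len)) {F : Γ.Gmax} (hF : Γ.dMax F = 0) :
    ∃ m : Γ.H1max, Γ.deriv m = 0 ∧ Γ.trace m = F := by
  obtain ⟨M, hM⟩ := hb
  have hMl : ∀ e, Γ.len e ≤ M := fun e => hM ⟨e, rfl⟩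
  have hF' : ∀ e, F (Γ.termEnd e) = F (Γ.initEnd e) := fun e => by
    have h : Γ.toFibre e (F (Γ.termEnd e) - F (Γ.initEnd e)) = 0 :=
      congrArg (fun η : Γ.EdgeL2 => η e) hF
    exact sub_eq_zero.1 ((LinearEquiv.map_eq_zero_iff _).1 h)
  -- The edge `e` contributes `|F_e|² ℓ_e ≤ M |F_e|²` to the squared norm. This is the point where
  -- the upper bound on the lengths is used.
  let f : Γ.L2 := ⟨fun e => F (Γ.initEnd e) • one (Γ.len e), memℓp_two <| by
    refine Summable.of_nonneg_of_le (fun _ => sq_nonneg _) (fun e => ?_)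
      ((Γ.summable_ends F).2.mul_right M)
    rw [norm_smul, mul_pow, norm_one_sq (Γ.len_pos e)]
    exact mul_le_mul_of_nonneg_left (hMl e) (sq_nonneg _)⟩
  obtain ⟨m, h1, h2, h3, h4⟩ := exists_H1max (Γ := Γ) (f := f) (g := 0)
    (c := fun e => F (Γ.initEnd e)) fun e => isPrimitive_const _
  refine ⟨m, h2, Gmax_ext h3 fun e => ?_⟩
  have : ∫ t in (0 : ℝ)..Γ.len e, (0 : Γ.L2) e t = 0 := by
    rw [← inner_one_left (Γ.len_pos e)]
    exact inner_zero_right _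
  rw [h4, this, add_zero, hF']

/-- Interpolation by hat functions of one common width `a`, a lower bound for all lengths. Their
norms are bounded uniformly over the edges, so the sum and its derivative are square integrable. The
two hats of an edge may overlap; this is harmless, since each vanishes at the opposite end. -/
theorem exists_trace_eq (F : Γ.Gmax) : ∃ m : Γ.H1max, Γ.trace m = F := by
  obtain ⟨a, ha, hl⟩ := Γ.len_bddBelow
  choose γ₀ χ₀ hp₀ hi₀ hγ₀ hχ₀ using fun e => exists_hat_init ha (hl e)
  choose γ₁ χ₁ hp₁ hi₁ hγ₁ hχ₁ using fun e => exists_hat_term ha (hl e)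
  have hmem : ∀ (u v : ∀ e, IntervalL2 (Γ.len e)) (C : ℝ), (∀ e, ‖u e‖ ^ 2 ≤ C) →
      (∀ e, ‖v e‖ ^ 2 ≤ C) →
      Memℓp (fun e => F (Γ.initEnd e) • u e + F (Γ.termEnd e) • v e) 2 := by
    intro u v C hu hv
    refine memℓp_two (Summable.of_nonneg_of_le (fun _ => sq_nonneg _) (fun e => ?_)
      (((Γ.summable_ends F).2.add (Γ.summable_ends F).1).mul_right (2 * C)))
    calc ‖F (Γ.initEnd e) • u e + F (Γ.termEnd e) • v e‖ ^ 2
        ≤ (‖F (Γ.initEnd e) • u e‖ + ‖F (Γ.termEnd e) • v e‖) ^ 2 := by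
          gcongr; exact norm_add_le _ _
      _ ≤ 2 * (‖F (Γ.initEnd e) • u e‖ ^ 2 + ‖F (Γ.termEnd e) • v e‖ ^ 2) := add_sq_le
      _ = 2 * (‖F (Γ.initEnd e)‖ ^ 2 * ‖u e‖ ^ 2 + ‖F (Γ.termEnd e)‖ ^ 2 * ‖v e‖ ^ 2) := by
          rw [norm_smul, norm_smul, mul_pow, mul_pow]
      _ ≤ 2 * (‖F (Γ.initEnd e)‖ ^ 2 * C + ‖F (Γ.termEnd e)‖ ^ 2 * C) := by
          gcongr
          exacts [hu e, hv e]
      _ = _ := by ring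
  let f : Γ.L2 := ⟨_, hmem χ₀ χ₁ a hχ₀ hχ₁⟩
  let g : Γ.L2 := ⟨_, hmem γ₀ γ₁ (1 / a) hγ₀ hγ₁⟩
  obtain ⟨m, h1, h2, h3, h4⟩ := exists_H1max (Γ := Γ) (f := f) (g := g)
    (c := fun e => F (Γ.initEnd e)) fun e => by
      simpa using ((hp₀ e).smul (F (Γ.initEnd e))).add (Γ.len_pos e)
        ((hp₁ e).smul (F (Γ.termEnd e)))
  refine ⟨m, Gmax_ext h3 fun e => ?_⟩
  have : ∫ t in (0 : ℝ)..Γ.len e, g e t = -F (Γ.initEnd e) + F (Γ.termEnd e) := by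
    rw [← inner_one_left (Γ.len_pos e)]
    change ⟪one (Γ.len e), F (Γ.initEnd e) • γ₀ e + F (Γ.termEnd e) • γ₁ e⟫_ℂ = _
    rw [inner_add_right, inner_smul_right, inner_smul_right, inner_one_left (Γ.len_pos e),
      inner_one_left (Γ.len_pos e), hi₀, hi₁]
    ring
  rw [h4, this]
  ring

/-- Differentiation on `H¹_max(X)` is closed, and the evaluation at the vertices is continuous in
the graph norm. -/
theorem exists_tendsto_trace {m : ℕ → Γ.H1max} {f g : Γ.L2}
    (hf : Tendsto (fun n => (m n : Γ.L2)) atTop (𝓝 f))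
    (hg : Tendsto (fun n => Γ.deriv (m n)) atTop (𝓝 g)) :
    ∃ m' : Γ.H1max, (m' : Γ.L2) = f ∧ Γ.deriv m' = g ∧
      Tendsto (fun n => Γ.trace (m n)) atTop (𝓝 (Γ.trace m')) := by
  -- Convergence on the graph implies convergence on each edge, where being a primitive is a closed
  -- condition.
  have hp : ∀ e, ∃ c, IsPrimitive c (g e) (f e) := fun e => by
    have hf' := ((lp.evalCLM ℂ (fun e => IntervalL2 (Γ.len e)) 2 e).continuous.tendsto f).comp hf
    have hg' := ((lp.evalCLM ℂ (fun e => IntervalL2 (Γ.len e)) 2 e).continuous.tendsto g).comp hg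
    exact (isClosed_primitives (Γ.len_pos e)).mem_of_tendsto (hf'.prodMk_nhds hg')
      (Eventually.of_forall fun n => ⟨_, Γ.isPrimitive_derivFun (m n) e⟩)
  choose c hc using hp
  obtain ⟨m', rfl, rfl, -, -⟩ := exists_H1max hc
  refine ⟨m', rfl, rfl, ?_⟩
  obtain ⟨a, ha, ha1, hl⟩ := Γ.exists_len_lower_bound
  rw [tendsto_iff_norm_sub_tendsto_zero] at hf hg ⊢
  -- The trace estimate, applied to the differences, upgrades graph norm convergence to convergence
  -- of the boundary values.
  have hlim : Tendsto (fun n => √(4 / a * (‖(m n : Γ.L2) - m'‖ ^ 2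
      + ‖Γ.deriv (m n) - Γ.deriv m'‖ ^ 2))) atTop (𝓝 0) := by
    have := (((hf.pow 2).add (hg.pow 2)).const_mul (4 / a)).sqrt
    simpa using this
  refine squeeze_zero (fun _ => norm_nonneg _) (fun n => ?_) hlim
  refine Real.le_sqrt_of_sq_le ?_
  rw [← map_sub, ← map_sub]
  exact norm_trace_sq_le ha ha1 hl (m n - m')

end MetricGraph

/-! ### Hilbert space tools: closed operators, density, square roots. -/

theorem WithLp.prod_ext {A B : Type*} {x y : WithLp 2 (A × B)} (h : x.fst = y.fst)
    (h' : x.snd = y.snd) : x = y :=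
  WithLp.ofLp_injective 2 (Prod.ext h h')

section Hilbert

open Filter Topology

variable {H H' : Type*} [NormedAddCommGroup H] [InnerProductSpace ℂ H]
  [NormedAddCommGroup H'] [InnerProductSpace ℂ H']

theorem LinearPMap.isClosed_of_tendsto {T : H →ₗ.[ℂ] H'}
    (h : ∀ (x : ℕ → T.domain) (u : H) (v : H'), Tendsto (fun n => (x n : H)) atTop (𝓝 u) →
      Tendsto (fun n => T (x n)) atTop (𝓝 v) → ∃ y : T.domain, (y : H) = u ∧ T y = v) :
    T.IsClosed := by
  refine IsSeqClosed.isClosed fun p q hp hq => ?_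
  choose x hx hx' using fun n => (LinearPMap.mem_graph_iff T).1 (hp n)
  obtain ⟨y, hy, hy'⟩ := h x q.1 q.2 (by simpa only [hx, Function.comp_def] using (continuous_fst.tendsto q).comp hq)
    (by simpa only [hx', Function.comp_def] using (continuous_snd.tendsto q).comp hq)
  exact (LinearPMap.mem_graph_iff T).2 ⟨y, hy, hy'⟩

theorem Submodule.dense_of_orthogonal [CompleteSpace H] {S : Submodule ℂ H}
    (h : ∀ w, (∀ x ∈ S, ⟪x, w⟫_ℂ = 0) → w = 0) : Dense (S : Set H) := by
  rw [Submodule.dense_iff_topologicalClosure_eq_top, Submodule.topologicalClosure_eq_top_iff,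
    Submodule.eq_bot_iff]
  exact fun w hw => h w ((Submodule.mem_orthogonal _ _).1 hw)

theorem Submodule.coe_orthogonalProjectionOnto_of_mem {K : Submodule ℂ H}
    [K.HasOrthogonalProjection] {x : H} (hx : x ∈ K) : (K.orthogonalProjectionOnto x : H) = x :=
  congrArg Subtype.val (Submodule.orthogonalProjectionOnto_mem_subspace_eq_self (⟨x, hx⟩ : K))

variable [CompleteSpace H] {L : H →L[ℂ] H}

theorem opSqrt_apply_apply (hL : L.IsPositive) (x : H) : opSqrt L (opSqrt L x) = L x := by
  have h : opSqrt L * opSqrt L = L :=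
    CFC.sqrt_mul_sqrt_self L ((ContinuousLinearMap.nonneg_iff_isPositive L).2 hL)
  exact congrArg (fun A : H →L[ℂ] H => A x) h

theorem inner_opSqrt_left (L : H →L[ℂ] H) (x y : H) :
    ⟪opSqrt L x, y⟫_ℂ = ⟪x, opSqrt L y⟫_ℂ :=
  ((ContinuousLinearMap.nonneg_iff_isPositive _).1 (CFC.sqrt_nonneg L)).isSymmetric x y

/-- For the nontrivial direction, `‖L^{1/2} x‖² = ⟪x, L x⟫`. -/
theorem opSqrt_eq_zero_iff (hL : L.IsPositive) {x : H} : opSqrt L x = 0 ↔ L x = 0 := by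
  constructor
  · intro h
    rw [← opSqrt_apply_apply hL, h, map_zero]
  · intro h
    rw [← inner_self_eq_zero (𝕜 := ℂ), inner_opSqrt_left, opSqrt_apply_apply hL, h,
      inner_zero_right]

/-- For self-adjoint `L` the closure of the range is `(ker L)ᗮ`; with closed range `x = L y =
L^{1/2}(L^{1/2} y)`, which exhibits the preimage. -/
theorem exists_opSqrt_eq (hL : L.IsPositive) (hr : IsClosed (range L)) {x : H}
    (hx : ∀ y, L y = 0 → ⟪y, x⟫_ℂ = 0) : ∃ y, opSqrt L y = x := by
  have h1 : x ∈ (LinearMap.ker (L : H →ₗ[ℂ] H))ᗮ := (Submodule.mem_orthogonal _ _).2 hx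
  have h2 := ContinuousLinearMap.orthogonal_ker L
  rw [hL.isSelfAdjoint.adjoint_eq] at h2
  rw [h2, ← SetLike.mem_coe, Submodule.topologicalClosure_coe] at h1
  have h3 : closure ((LinearMap.range (L : H →ₗ[ℂ] H) : Submodule ℂ H) : Set H) = range L :=
    hr.closure_eq
  rw [h3] at h1
  obtain ⟨y, rfl⟩ := h1
  exact ⟨opSqrt L y, opSqrt_apply_apply hL y⟩

end Hilbert

/-! ### Dimensions, and the decomposition of the vertex space by `L`. -/

namespace MetricGraph

open Filter Topology

variable {V E : Type*} {Γ : MetricGraph V E}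

/-- The bridge between the two kernels of adjoints: pairing `g` with a derivative only sees the
boundary values of the function. -/
theorem inner_edgeIntegral_dMax {g : Γ.L2}
    (hg : ∀ m : Γ.H1max, Γ.trace m = 0 → ⟪g, Γ.deriv m⟫_ℂ = 0) (m : Γ.H1max) :
    ⟪Γ.edgeIntegral g, Γ.dMax (Γ.trace m)⟫_ℂ = ⟪g, Γ.deriv m⟫_ℂ := by
  rw [← edgeIntegral_deriv, inner_eq_inner_edgeIntegral hg]

section Dimension

theorem finiteDimensional_Gmax [Finite E] : FiniteDimensional ℂ Γ.Gmax := by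
  have : Finite Γ.HalfEdge := Finite.of_equiv _ Γ.halfEdgeEquiv
  have := Fintype.ofFinite Γ.HalfEdge
  exact (lpPiLpₗᵢ (p := 2) (fun _ : Γ.HalfEdge => ℂ) ℂ).symm.toLinearEquiv.finiteDimensional

/-- Each edge has two ends; only `E` needs to be finite, as vertices without edges contribute
nothing. -/
theorem finrank_Gmax [Finite E] : Module.finrank ℂ Γ.Gmax = 2 * Nat.card E := by
  have : Finite Γ.HalfEdge := Finite.of_equiv _ Γ.halfEdgeEquiv
  have := Fintype.ofFinite Γ.HalfEdge
  rw [(lpPiLpₗᵢ (p := 2) (fun _ : Γ.HalfEdge => ℂ) ℂ).toLinearEquiv.finrank_eq,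
    (WithLp.linearEquiv 2 ℂ (Γ.HalfEdge → ℂ)).finrank_eq, Module.finrank_fintype_fun_eq_card,
    ← Nat.card_eq_fintype_card, ← Nat.card_congr Γ.halfEdgeEquiv, Nat.card_sum, two_mul]

theorem finiteDimensional_EdgeL2 [Finite E] : FiniteDimensional ℂ Γ.EdgeL2 := by
  have := Fintype.ofFinite E
  exact (lpPiLpₗᵢ (p := 2) (fun e : E => Γ.Fibre e) ℂ).symm.toLinearEquiv.finiteDimensional

theorem finrank_EdgeL2 [Finite E] : Module.finrank ℂ Γ.EdgeL2 = Nat.card E := by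
  have := Fintype.ofFinite E
  rw [(lpPiLpₗᵢ (p := 2) (fun e : E => Γ.Fibre e) ℂ).toLinearEquiv.finrank_eq,
    (WithLp.linearEquiv 2 ℂ (∀ e : E, Γ.Fibre e)).finrank_eq, Module.finrank_pi_fintype]
  simp only [← (Γ.toFibre _).finrank_eq, Module.finrank_self, Finset.sum_const,
    Finset.card_univ, smul_eq_mul, mul_one, Nat.card_eq_fintype_card]

theorem finrank_withLp_prod {A B : Type*} [NormedAddCommGroup A] [InnerProductSpace ℂ A]
    [NormedAddCommGroup B] [InnerProductSpace ℂ B] [FiniteDimensional ℂ A]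
    [FiniteDimensional ℂ B] :
    Module.finrank ℂ (WithLp 2 (A × B)) = Module.finrank ℂ A + Module.finrank ℂ B := by
  rw [(WithLp.linearEquiv 2 ℂ (A × B)).finrank_eq, Module.finrank_prod]

theorem bddAbove_range_len [Finite E] : BddAbove (range Γ.len) := (finite_range Γ.len).bddAbove

variable {G : Submodule ℂ Γ.Gmax} (L : G →L[ℂ] G)

theorem isClosed_range_of_finite [Finite E] : IsClosed (range L) := by
  have := finiteDimensional_Gmax (Γ := Γ)
  exact Submodule.closed_of_finiteDimensional (LinearMap.range (L : G →ₗ[ℂ] G))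

theorem vtxKer_le : vtxKer L ≤ G := Submodule.map_subtype_le _ _

theorem vtxCoker_le : vtxCoker L ≤ G := inf_le_left

theorem finrank_vtxKer_add_finrank_vtxCoker [Finite E] :
    Module.finrank ℂ (vtxKer L) + Module.finrank ℂ (vtxCoker L) = Module.finrank ℂ G := by
  have := finiteDimensional_Gmax (Γ := Γ)
  rw [← Submodule.finrank_add_inf_finrank_orthogonal (vtxKer_le L), vtxCoker, inf_comm]

theorem finrank_add_finrank_orthogonal_Gmax [Finite E] (K : Submodule ℂ Γ.Gmax) :
    Module.finrank ℂ K + Module.finrank ℂ Kᗮ = 2 * Nat.card E := by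
  have := finiteDimensional_Gmax (Γ := Γ)
  rw [Submodule.finrank_add_finrank_orthogonal, finrank_Gmax]

end Dimension

section VertexKernel

variable {G : Submodule ℂ Γ.Gmax} {L : G →L[ℂ] G}

theorem coe_mem_vtxKer {x : G} : (x : Γ.Gmax) ∈ vtxKer L ↔ L x = 0 := by
  constructor
  · rintro ⟨y, hy, h⟩
    rwa [← Subtype.ext h]
  · exact fun h => ⟨x, h, rfl⟩

theorem inner_vtxKer_vtxCoker {x y : Γ.Gmax} (hx : x ∈ vtxKer L) (hy : y ∈ vtxCoker L) :
    ⟪x, y⟫_ℂ = 0 :=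
  (Submodule.mem_orthogonal _ _).1 hy.2 x hx

theorem vtxKer_le_orthogonal_vtxCoker : vtxKer L ≤ (vtxCoker L)ᗮ := fun _ hx =>
  (Submodule.mem_orthogonal' _ _).2 fun _ hy => inner_vtxKer_vtxCoker hx hy

variable [CompleteSpace G]

theorem opSqrt_eq_zero_iff_mem (hL : L.IsPositive) {x : G} :
    opSqrt L x = 0 ↔ (x : Γ.Gmax) ∈ vtxKer L := by
  rw [opSqrt_eq_zero_iff hL, coe_mem_vtxKer]

theorem opSqrt_mem_vtxCoker (hL : L.IsPositive) (x : G) :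
    (opSqrt L x : Γ.Gmax) ∈ vtxCoker L := by
  refine ⟨(opSqrt L x).2, (Submodule.mem_orthogonal _ _).2 ?_⟩
  rintro _ ⟨y, hy, rfl⟩
  change ⟪y, opSqrt L x⟫_ℂ = 0
  rw [← inner_opSqrt_left, (opSqrt_eq_zero_iff hL).2 hy, inner_zero_left]

/-- `ran L^{1/2}` is dense in `𝒢₁`. -/
theorem inner_eq_zero_of_mem_vtxCoker (hL : L.IsPositive) {w : Γ.Gmax}
    (h : ∀ x : G, ⟪w, (opSqrt L x : G)⟫_ℂ = 0) {F : Γ.Gmax} (hF : F ∈ vtxCoker L) :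
    ⟪w, F⟫_ℂ = 0 := by
  -- With `P` the projection onto `𝒢`, `‖L^{1/2} P w‖² = ⟪w, L^{1/2} L^{1/2} P w⟫ = 0`. Hence `P w ∈
  -- 𝒢₀`, which is orthogonal to `𝒢₁`.
  have h1 : opSqrt L (G.orthogonalProjectionOnto w) = 0 := by
    rw [← inner_self_eq_zero (𝕜 := ℂ), inner_opSqrt_left,
      Submodule.inner_orthogonalProjectionOnto_eq_of_mem_right, h]
  have h2 := inner_vtxKer_vtxCoker ((opSqrt_eq_zero_iff_mem hL).1 h1) hF
  rwa [← Submodule.coe_inner _ (G.orthogonalProjectionOnto w) ⟨F, vtxCoker_le L hF⟩,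
    Submodule.inner_orthogonalProjectionOnto_eq_of_mem_right] at h2

/-- Removing the `𝒢₀` part of a preimage does not change its image under `L^{1/2}`. With the
preimage in `𝒢₁`, a component in `𝒢₀` can afterwards be prescribed independently. -/
theorem exists_opSqrt_eq_of_mem_vtxCoker (hL : L.IsPositive) (hr : IsClosed (range L))
    {F : Γ.Gmax} (hF : F ∈ vtxCoker L) :
    ∃ x : G, (opSqrt L x : Γ.Gmax) = F ∧ (x : Γ.Gmax) ∈ vtxCoker L := by
  have key : ∀ F ∈ vtxCoker L, ∃ x : G, (opSqrt L x : Γ.Gmax) = F := fun F hF => by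
    obtain ⟨x, hx⟩ := exists_opSqrt_eq hL hr (x := (⟨F, vtxCoker_le L hF⟩ : G)) fun y hy =>
      inner_vtxKer_vtxCoker (coe_mem_vtxKer.2 hy) hF
    exact ⟨x, congrArg Subtype.val hx⟩
  obtain ⟨x, hx⟩ := key F hF
  let p : G := ⟨(vtxKer L).orthogonalProjectionOnto x,
    vtxKer_le L ((vtxKer L).orthogonalProjectionOnto (x : Γ.Gmax)).2⟩
  refine ⟨x - p, ?_, (x - p).2, ?_⟩
  · rw [map_sub, (opSqrt_eq_zero_iff_mem hL (x := p)).2 (SetLike.coe_mem _), sub_zero, hx]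
  · exact Submodule.sub_starProjection_mem_orthogonal _

theorem eq_zero_of_mem_vtxKer_of_proj {F : Γ.Gmax} (hF : F ∈ vtxKer L)
    (h : (vtxKer L).orthogonalProjectionOnto F = 0) : F = 0 := by
  rw [← Submodule.coe_orthogonalProjectionOnto_of_mem hF, h]
  rfl

theorem proj_vtxKer_of_mem_vtxCoker {F : Γ.Gmax} (hF : F ∈ vtxCoker L) :
    (vtxKer L).orthogonalProjectionOnto F = 0 :=
  Submodule.orthogonalProjectionOnto_eq_zero_iff.2 hF.2

/-- `𝒢₁ᗮ ∩ 𝒢 = 𝒢₀`. -/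
theorem mem_vtxKer_of_mem_orthogonal {F : Γ.Gmax} (hG : F ∈ G) (hF : F ∈ (vtxCoker L)ᗮ) :
    F ∈ vtxKer L := by
  obtain ⟨p, hp, hFp⟩ : ∃ p ∈ vtxKer L, F - p ∈ (vtxKer L)ᗮ :=
    ⟨_, ((vtxKer L).orthogonalProjectionOnto F).2, Submodule.sub_starProjection_mem_orthogonal _⟩
  have h1 : F - p ∈ vtxCoker L := ⟨G.sub_mem hG (vtxKer_le L hp), hFp⟩
  have h2 : F - p ∈ (vtxCoker L)ᗮ :=
    Submodule.sub_mem _ hF (vtxKer_le_orthogonal_vtxCoker hp)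
  have h3 : F - p = 0 := inner_self_eq_zero.1 ((Submodule.mem_orthogonal _ _).1 h2 _ h1)
  rwa [sub_eq_zero.1 h3]

end VertexKernel

/-! ### The simple exterior derivative. -/

section Simple

variable {G : Submodule ℂ Γ.Gmax}

theorem exists_H1G {m : Γ.H1max} (hm : Γ.trace m ∈ G) : ∃ x : Γ.H1G G, H1G.toH1max Γ G x = m :=
  ⟨⟨m, m, hm, rfl⟩, rfl⟩

theorem dense_H1G : Dense (Γ.H1G G : Set Γ.L2) :=
  Submodule.dense_of_orthogonal fun _ hw => eq_zero_of_orthogonal_ker_trace fun m hm =>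
    hw m ⟨m, Submodule.mem_comap.2 (hm ▸ G.zero_mem), rfl⟩

theorem isClosed_coe [CompleteSpace G] : IsClosed (G : Set Γ.Gmax) :=
  (completeSpace_coe_iff_isComplete.1 ‹CompleteSpace G›).isClosed

theorem isClosed_dSimple [CompleteSpace G] : (Γ.dSimple G).IsClosed := by
  refine LinearPMap.isClosed_of_tendsto fun x u v hu hv => ?_
  obtain ⟨m, rfl, rfl, ht⟩ :=
    exists_tendsto_trace (m := fun n => H1G.toH1max Γ G (x n)) hu hv
  obtain ⟨y, rfl⟩ := exists_H1G (isClosed_coe.mem_of_tendsto ht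
    (Eventually.of_forall fun n => Γ.trace_mem_of_mem_H1G G (x n)))
  exact ⟨y, rfl, rfl⟩

/-- The index theorem in the simple case. -/
theorem indexTheorem_simple (G : Submodule ℂ Γ.Gmax) [CompleteSpace G] :
    Γ.IndexTheorem (Γ.dSimple G) (H1G.toH1max Γ G) (Γ.dDisc G) (Γ.phiSimple₀ G) (Γ.phiSimple₁ G)
      (BddAbove (range Γ.len)) True ((Module.finrank ℂ G : ℤ) - Nat.card E) := by
  have hker : ∀ g : Γ.L2, (∀ x, ⟪g, Γ.dSimple G x⟫_ℂ = 0) →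
      ∀ m : Γ.H1max, Γ.trace m ∈ G → ⟪g, Γ.deriv m⟫_ℂ = 0 := fun g hg m hm => by
    obtain ⟨x, rfl⟩ := exists_H1G hm
    exact hg x
  have hker' : ∀ g : Γ.L2, (∀ x, ⟪g, Γ.dSimple G x⟫_ℂ = 0) →
      ∀ m : Γ.H1max, Γ.trace m = 0 → ⟪g, Γ.deriv m⟫_ℂ = 0 :=
    fun g hg m hm => hker g hg m (hm ▸ G.zero_mem)
  refine IndexTheorem.of_kernels Γ Γ.edgeIntegral ⟨dense_H1G, isClosed_dSimple⟩
    ?_ norm_edgeIntegral_le (fun _ hx => hx) ?_ ?_ ?_ ?_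
    (fun g hg h => eq_zero_of_edgeIntegral_eq_zero (hker' g hg) h) ?_ ?_
  · exact fun ℓ₀ h0 h1 hl x => norm_trace_sq_le h0 h1 hl (H1G.toH1max Γ G x)
  · intro x hx
    change Γ.dMax (Γ.trace (H1G.toH1max Γ G x)) = 0
    have hx' : Γ.deriv (H1G.toH1max Γ G x) = 0 := hx
    rw [← edgeIntegral_deriv, hx', map_zero]
  · intro x hx h
    have := eq_zero_of_deriv_of_trace (m := H1G.toH1max Γ G x) hx (congrArg Subtype.val h)
    exact Subtype.ext (congrArg Subtype.val this :)
  · intro hb F hF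
    obtain ⟨m, hm, hmF⟩ := exists_deriv_eq_zero hb (F := (F : Γ.Gmax)) hF
    obtain ⟨x, rfl⟩ := exists_H1G (m := m) (hmF ▸ F.2)
    exact ⟨x, hm, Subtype.ext hmF⟩
  · intro g hg F
    -- Any extension of `F` to the metric graph lies in the domain of `d` and transports the
    -- orthogonality.
    obtain ⟨m, hm⟩ := exists_trace_eq (F : Γ.Gmax)
    change ⟪_, Γ.dMax F⟫_ℂ = 0
    rw [← hm, inner_edgeIntegral_dMax (hker' g hg), hker g hg m (hm ▸ F.2)]
  · intro _ η hη
    obtain ⟨g, rfl, hg⟩ := exists_edgeIntegral_eq η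
    refine ⟨g, fun x => ?_, rfl⟩
    change ⟪g, Γ.deriv (H1G.toH1max Γ G x)⟫_ℂ = 0
    rw [hg, edgeIntegral_deriv]
    exact hη (Γ.traceG G x)
  · intro _
    have := finiteDimensional_Gmax (Γ := Γ)
    exact ⟨bddAbove_range_len, trivial, inferInstance, finiteDimensional_EdgeL2, by
      rw [finrank_EdgeL2]⟩

end Simple

end MetricGraph

/-! ### The enlarged exterior derivatives. -/

namespace MetricGraph

open Filter Topology

variable {V E : Type*} {Γ : MetricGraph V E} {G : Submodule ℂ Γ.Gmax} [CompleteSpace G]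
  {L : G →L[ℂ] G}

theorem norm_sq_proj_add_proj_le {a : ℝ} (ha : 0 < a) (ha1 : a ≤ 1) (hl : ∀ e, a ≤ Γ.len e)
    (K K' : Submodule ℂ Γ.Gmax) [K.HasOrthogonalProjection] [K'.HasOrthogonalProjection]
    (m : Γ.H1max) (F : Γ.Gmax) :
    ‖K.orthogonalProjectionOnto (Γ.trace m)‖ ^ 2 + ‖K'.orthogonalProjectionOnto F‖ ^ 2
      ≤ 4 / a * (‖(m : Γ.L2)‖ ^ 2 + ‖F‖ ^ 2 + ‖Γ.deriv m‖ ^ 2) := by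
  have h1 : ‖K.orthogonalProjectionOnto (Γ.trace m)‖ ^ 2 ≤ ‖Γ.trace m‖ ^ 2 := by
    gcongr; exact K.norm_orthogonalProjectionOnto_apply_le _
  have h2 : ‖K'.orthogonalProjectionOnto F‖ ^ 2 ≤ ‖F‖ ^ 2 := by
    gcongr; exact K'.norm_orthogonalProjectionOnto_apply_le _
  have h3 := norm_trace_sq_le ha ha1 hl m
  have h4 : ‖F‖ ^ 2 ≤ 4 / a * ‖F‖ ^ 2 :=
    le_mul_of_one_le_left (sq_nonneg _) (by rw [le_div_iff₀ ha]; linarith)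
  linarith

/-! ### The 0-enlarged case. -/

section ZeroEnlarged

theorem trace_domZero (x : domZero L) :
    Γ.trace (domZero.fn L x) = (opSqrt L x.1.snd : G) :=
  x.2.choose_spec

theorem exists_domZero {m : Γ.H1max} {F : G} (h : Γ.trace m = (opSqrt L F : G)) :
    ∃ x : domZero L, domZero.fn L x = m ∧ x.1.snd = F :=
  ⟨⟨WithLp.toLp 2 ((m : Γ.L2), F), m.2, h⟩, rfl, rfl⟩

theorem domZero_ext {x y : domZero L} (h : domZero.fn L x = domZero.fn L y)
    (h' : x.1.snd = y.1.snd) : x = y :=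
  Subtype.ext (WithLp.prod_ext (congrArg Subtype.val h) h')

/-- Functions vanishing at the ends, paired with `F = 0`, kill the first component of an orthogonal
`w`. An extension of `L^{1/2} w₁`, paired with `w₁` itself, then gives `‖w₁‖² = 0` for the second
component `w₁`. -/
theorem dense_domZero : Dense (domZero L : Set (WithLp 2 (Γ.L2 × G))) := by
  refine Submodule.dense_of_orthogonal fun w hw => ?_
  have key : ∀ (m : Γ.H1max) (F : G), Γ.trace m = (opSqrt L F : G) →
      ⟪(m : Γ.L2), w.fst⟫_ℂ + ⟪(F : Γ.Gmax), w.snd⟫_ℂ = 0 := fun m F h => by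
    obtain ⟨x, rfl, rfl⟩ := exists_domZero h
    exact hw x x.2
  have h1 : w.fst = 0 := eq_zero_of_orthogonal_ker_trace fun m hm => by
    simpa using key m 0 (by rw [hm, map_zero]; rfl)
  refine WithLp.prod_ext h1 ?_
  obtain ⟨m, hm⟩ := exists_trace_eq (opSqrt L w.snd : Γ.Gmax)
  have h2 := key m w.snd hm
  rw [h1, inner_zero_right, zero_add, inner_self_eq_zero] at h2
  exact Subtype.ext h2

theorem isClosed_dZero : (dZero L).IsClosed := by
  refine LinearPMap.isClosed_of_tendsto fun x u v hu hv => ?_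
  have hu₀ := ((WithLp.fstL 2 ℂ Γ.L2 G).continuous.tendsto u).comp hu
  have hu₁ := ((WithLp.sndL 2 ℂ Γ.L2 G).continuous.tendsto u).comp hu
  obtain ⟨m, hm, rfl, ht⟩ := exists_tendsto_trace (m := fun n => domZero.fn L (x n)) hu₀ hv
  have ht' : Tendsto (fun n => Γ.trace (domZero.fn L (x n))) atTop
      (𝓝 (opSqrt L u.snd : G)) :=
    (((G.subtypeL.comp (opSqrt L)).continuous.tendsto u.snd).comp hu₁).congr
      fun n => (trace_domZero (x n)).symm
  obtain ⟨y, rfl, hy⟩ := exists_domZero (tendsto_nhds_unique ht ht')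
  exact ⟨y, WithLp.prod_ext hm hy, rfl⟩

/-- The index theorem in the `0`-enlarged case. -/
theorem indexTheorem_zero (hL : L.IsPositive) :
    Γ.IndexTheorem (dZero L) (domZero.fn L) (discZero L) (phiZero₀ L) (phiZero₁ L)
      (BddAbove (range Γ.len) ∧ IsClosed (range L)) True
      ((Module.finrank ℂ G : ℤ) - Nat.card E) := by
  have hker : ∀ g : Γ.L2, (∀ x, ⟪g, dZero L x⟫_ℂ = 0) →
      ∀ (m : Γ.H1max) (F : G), Γ.trace m = (opSqrt L F : G) → ⟪g, Γ.deriv m⟫_ℂ = 0 :=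
    fun g hg m F h => by
      obtain ⟨x, rfl, -⟩ := exists_domZero h
      exact hg x
  have hker' : ∀ g : Γ.L2, (∀ x, ⟪g, dZero L x⟫_ℂ = 0) →
      ∀ m : Γ.H1max, Γ.trace m = 0 → ⟪g, Γ.deriv m⟫_ℂ = 0 :=
    fun g hg m hm => hker g hg m 0 (by rw [hm, map_zero]; rfl)
  -- Boundary values in the domain lie in the range of `L^{1/2}`, so the projection `P₁` in `Φ₀`
  -- leaves them unchanged.
  have htr : ∀ x : domZero L, Γ.trace (domZero.fn L x) ∈ vtxCoker L := fun x => by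
    rw [trace_domZero]
    exact opSqrt_mem_vtxCoker hL _
  have hfst : ∀ x, ((phiZero₀ L x).fst : Γ.Gmax) = Γ.trace (domZero.fn L x) := fun x =>
    Submodule.coe_orthogonalProjectionOnto_of_mem (htr x)
  refine IndexTheorem.of_kernels Γ Γ.edgeIntegral ⟨dense_domZero, isClosed_dZero⟩
    ?_ norm_edgeIntegral_le (fun _ hx => hx) ?_ ?_ ?_ ?_
    (fun g hg h => eq_zero_of_edgeIntegral_eq_zero (hker' g hg) h) ?_ ?_
  · intro ℓ₀ h0 h1 hl x
    rw [WithLp.prod_norm_sq_eq_of_L2, WithLp.prod_norm_sq_eq_of_L2]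
    exact norm_sq_proj_add_proj_le h0 h1 hl (vtxCoker L) (vtxKer L) (domZero.fn L x)
      (domZero.vtx L x)
  · intro x hx
    change Γ.dMax ((phiZero₀ L x).fst : Γ.Gmax) = 0
    have hx' : Γ.deriv (domZero.fn L x) = 0 := hx
    rw [hfst, ← edgeIntegral_deriv, hx', map_zero]
  · intro x hx h
    have h1 : Γ.trace (domZero.fn L x) = 0 := by rw [← hfst, h]; rfl
    have h2 := eq_zero_of_deriv_of_trace (m := domZero.fn L x) hx h1
    -- Once `f = 0`, the constraint gives `L^{1/2} F = 0`, so `F ∈ 𝒢₀`, and `P₀ F = 0` finishes.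
    refine domZero_ext h2 (Subtype.ext (eq_zero_of_mem_vtxKer_of_proj
      ((opSqrt_eq_zero_iff_mem hL).1 ?_) (congrArg WithLp.snd h)))
    exact Subtype.ext ((trace_domZero x).symm.trans h1)
  · rintro ⟨hb, hr⟩ k hk
    obtain ⟨m, hm, hmk⟩ := exists_deriv_eq_zero hb (F := (k.fst : Γ.Gmax)) hk
    obtain ⟨F, hF, hF'⟩ := exists_opSqrt_eq_of_mem_vtxCoker hL hr k.fst.2
    let F₀ : G := ⟨k.snd, vtxKer_le L k.snd.2⟩
    have hF₀ : opSqrt L F₀ = 0 := (opSqrt_eq_zero_iff_mem hL).2 k.snd.2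
    -- `F ∈ 𝒢₁` produces the required boundary values, and `F₀ ∈ 𝒢₀` supplies the second component
    -- without affecting them.
    obtain ⟨x, rfl, hx⟩ := exists_domZero (L := L) (m := m) (F := F + F₀)
      (by rw [map_add, hF₀, add_zero, hF, hmk])
    refine ⟨x, hm, WithLp.prod_ext (Subtype.ext ((hfst x).trans hmk)) ?_⟩
    change (vtxKer L).orthogonalProjectionOnto (x.1.snd : Γ.Gmax) = k.snd
    rw [hx, Submodule.coe_add, map_add, proj_vtxKer_of_mem_vtxCoker hF', zero_add]
    exact Submodule.orthogonalProjectionOnto_mem_subspace_eq_self _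
  · intro g hg k
    change ⟪Γ.edgeIntegral g, Γ.dMax (k.fst : Γ.Gmax)⟫_ℂ = 0
    -- Boundary values of the domain exhaust only the range of `L^{1/2}`. With `dMax` moved to the
    -- left, its density in `𝒢₁` covers all of `𝒢₁`.
    rw [← ContinuousLinearMap.adjoint_inner_left]
    refine inner_eq_zero_of_mem_vtxCoker hL (fun F => ?_) k.fst.2
    obtain ⟨m, hm⟩ := exists_trace_eq (opSqrt L F : Γ.Gmax)
    rw [ContinuousLinearMap.adjoint_inner_left, ← hm, inner_edgeIntegral_dMax (hker' g hg),
      hker g hg m F hm]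
  · intro _ η hη
    obtain ⟨g, rfl, hg⟩ := exists_edgeIntegral_eq η
    refine ⟨g, fun x => ?_, rfl⟩
    change ⟪g, Γ.deriv (domZero.fn L x)⟫_ℂ = 0
    rw [hg, edgeIntegral_deriv]
    exact hη (WithLp.toLp 2 (⟨_, htr x⟩, 0))
  · intro _
    have := finiteDimensional_Gmax (Γ := Γ)
    refine ⟨⟨bddAbove_range_len, isClosed_range_of_finite L⟩, trivial, inferInstance,
      finiteDimensional_EdgeL2, ?_⟩
    rw [finrank_EdgeL2, finrank_withLp_prod, add_comm, finrank_vtxKer_add_finrank_vtxCoker]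

end ZeroEnlarged

/-! ### The 0-enlarged case with projection. -/

section ZeroEnlargedProjection

theorem trace_domZeroProj (x : domZeroProj L) :
    G.orthogonalProjectionOnto (Γ.trace (domZeroProj.fn L x)) = opSqrt L x.1.snd :=
  x.2.choose_spec

theorem exists_domZeroProj {m : Γ.H1max} {F : G}
    (h : G.orthogonalProjectionOnto (Γ.trace m) = opSqrt L F) :
    ∃ x : domZeroProj L, domZeroProj.fn L x = m ∧ x.1.snd = F :=
  ⟨⟨WithLp.toLp 2 ((m : Γ.L2), F), m.2, h⟩, rfl, rfl⟩

theorem domZeroProj_ext {x y : domZeroProj L} (h : domZeroProj.fn L x = domZeroProj.fn L y)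
    (h' : x.1.snd = y.1.snd) : x = y :=
  Subtype.ext (WithLp.prod_ext (congrArg Subtype.val h) h')

theorem domZero_le_domZeroProj : domZero L ≤ domZeroProj L := by
  rintro x ⟨h, h'⟩
  exact ⟨h, by rw [h']; exact Submodule.orthogonalProjectionOnto_mem_subspace_eq_self _⟩

theorem dense_domZeroProj : Dense (domZeroProj L : Set (WithLp 2 (Γ.L2 × G))) :=
  dense_domZero.mono domZero_le_domZeroProj

theorem isClosed_dZeroProj : (dZeroProj L).IsClosed := by
  refine LinearPMap.isClosed_of_tendsto fun x u v hu hv => ?_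
  have hu₀ := ((WithLp.fstL 2 ℂ Γ.L2 G).continuous.tendsto u).comp hu
  have hu₁ := ((WithLp.sndL 2 ℂ Γ.L2 G).continuous.tendsto u).comp hu
  obtain ⟨m, hm, rfl, ht⟩ :=
    exists_tendsto_trace (m := fun n => domZeroProj.fn L (x n)) hu₀ hv
  have ht₁ := (G.orthogonalProjectionOnto.continuous.tendsto (Γ.trace m)).comp ht
  have ht₂ : Tendsto (fun n => G.orthogonalProjectionOnto (Γ.trace (domZeroProj.fn L (x n))))
      atTop (𝓝 (opSqrt L u.snd)) :=
    (((opSqrt L).continuous.tendsto u.snd).comp hu₁).congr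
      fun n => (trace_domZeroProj (x n)).symm
  obtain ⟨y, rfl, hy⟩ := exists_domZeroProj (tendsto_nhds_unique ht₁ ht₂)
  exact ⟨y, WithLp.prod_ext hm hy, rfl⟩

/-- This is `𝒢₀ᗮ = 𝒢₁ ⊕ 𝒢ᗮ`: as `𝒢₀ ⊆ 𝒢`, pairing with `𝒢₀` only sees the projection to `𝒢`. -/
theorem mem_orthogonal_vtxKer_iff {F : Γ.Gmax} :
    F ∈ (vtxKer L)ᗮ ↔ (G.orthogonalProjectionOnto F : Γ.Gmax) ∈ vtxCoker L := by
  have key : ∀ y ∈ vtxKer L, ⟪y, (G.orthogonalProjectionOnto F : Γ.Gmax)⟫_ℂ = ⟪y, F⟫_ℂ :=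
    fun y hy => Submodule.inner_orthogonalProjectionOnto_eq_of_mem_left
      (⟨y, vtxKer_le L hy⟩ : G) F
  rw [vtxCoker, Submodule.mem_inf, Submodule.mem_orthogonal, Submodule.mem_orthogonal]
  exact ⟨fun h => ⟨SetLike.coe_mem _, fun y hy => (key y hy).trans (h y hy)⟩,
    fun h y hy => (key y hy).symm.trans (h.2 y hy)⟩

/-- The index theorem in the `0`-enlarged case with projection. -/
theorem indexTheorem_zeroProj (hL : L.IsPositive) :
    Γ.IndexTheorem (dZeroProj L) (domZeroProj.fn L) (discZeroProj L)
      (phiZeroProj₀ L) (phiZeroProj₁ L)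
      (BddAbove (range Γ.len) ∧ IsClosed (range L)) True (Nat.card E : ℤ) := by
  have hker : ∀ g : Γ.L2, (∀ x, ⟪g, dZeroProj L x⟫_ℂ = 0) → ∀ (m : Γ.H1max) (F : G),
      G.orthogonalProjectionOnto (Γ.trace m) = opSqrt L F → ⟪g, Γ.deriv m⟫_ℂ = 0 :=
    fun g hg m F h => by
      obtain ⟨x, rfl, -⟩ := exists_domZeroProj h
      exact hg x
  have hker' : ∀ g : Γ.L2, (∀ x, ⟪g, dZeroProj L x⟫_ℂ = 0) →
      ∀ m : Γ.H1max, Γ.trace m = 0 → ⟪g, Γ.deriv m⟫_ℂ = 0 :=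
    fun g hg m hm => hker g hg m 0 (by rw [hm, map_zero, map_zero])
  have htr : ∀ x : domZeroProj L, Γ.trace (domZeroProj.fn L x) ∈ (vtxKer L)ᗮ := fun x => by
    rw [mem_orthogonal_vtxKer_iff, trace_domZeroProj]
    exact opSqrt_mem_vtxCoker hL _
  have hfst : ∀ x, ((phiZeroProj₀ L x).fst : Γ.Gmax) = Γ.trace (domZeroProj.fn L x) :=
    fun x => Submodule.coe_orthogonalProjectionOnto_of_mem (htr x)
  refine IndexTheorem.of_kernels Γ Γ.edgeIntegral ⟨dense_domZeroProj, isClosed_dZeroProj⟩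
    ?_ norm_edgeIntegral_le (fun _ hx => hx) ?_ ?_ ?_ ?_
    (fun g hg h => eq_zero_of_edgeIntegral_eq_zero (hker' g hg) h) ?_ ?_
  · intro ℓ₀ h0 h1 hl x
    rw [WithLp.prod_norm_sq_eq_of_L2, WithLp.prod_norm_sq_eq_of_L2]
    exact norm_sq_proj_add_proj_le h0 h1 hl (vtxKer L)ᗮ (vtxKer L) (domZeroProj.fn L x)
      (domZeroProj.vtx L x)
  · intro x hx
    change Γ.dMax ((phiZeroProj₀ L x).fst : Γ.Gmax) = 0
    have hx' : Γ.deriv (domZeroProj.fn L x) = 0 := hx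
    rw [hfst, ← edgeIntegral_deriv, hx', map_zero]
  · intro x hx h
    have h1 : Γ.trace (domZeroProj.fn L x) = 0 := by rw [← hfst, h]; rfl
    have h2 := eq_zero_of_deriv_of_trace (m := domZeroProj.fn L x) hx h1
    refine domZeroProj_ext h2 (Subtype.ext (eq_zero_of_mem_vtxKer_of_proj
      ((opSqrt_eq_zero_iff_mem hL).1 ?_) (congrArg WithLp.snd h)))
    exact (trace_domZeroProj x).symm.trans (by rw [h1, map_zero])
  · rintro ⟨hb, hr⟩ k hk
    obtain ⟨m, hm, hmk⟩ := exists_deriv_eq_zero hb (F := (k.fst : Γ.Gmax)) hk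
    obtain ⟨F, hF, hF'⟩ :=
      exists_opSqrt_eq_of_mem_vtxCoker hL hr (mem_orthogonal_vtxKer_iff.1 k.fst.2)
    let F₀ : G := ⟨k.snd, vtxKer_le L k.snd.2⟩
    have hF₀ : opSqrt L F₀ = 0 := (opSqrt_eq_zero_iff_mem hL).2 k.snd.2
    obtain ⟨x, rfl, hx⟩ := exists_domZeroProj (L := L) (m := m) (F := F + F₀)
      (by rw [map_add, hF₀, add_zero, hmk]; exact Subtype.ext hF.symm)
    refine ⟨x, hm, WithLp.prod_ext (Subtype.ext ((hfst x).trans hmk)) ?_⟩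
    change (vtxKer L).orthogonalProjectionOnto (x.1.snd : Γ.Gmax) = k.snd
    rw [hx, Submodule.coe_add, map_add, proj_vtxKer_of_mem_vtxCoker hF', zero_add]
    exact Submodule.orthogonalProjectionOnto_mem_subspace_eq_self _
  · intro g hg k
    change ⟪Γ.edgeIntegral g, Γ.dMax (k.fst : Γ.Gmax)⟫_ℂ = 0
    -- The vertex function splits into `p ∈ 𝒢₁`, treated by density as in the case without
    -- projection, and a part in `𝒢ᗮ`, any extension of which is admissible with `F = 0`.
    set p : G := G.orthogonalProjectionOnto (k.fst : Γ.Gmax)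
    have h1 : ⟪Γ.edgeIntegral g, Γ.dMax (p : Γ.Gmax)⟫_ℂ = 0 := by
      rw [← ContinuousLinearMap.adjoint_inner_left]
      refine inner_eq_zero_of_mem_vtxCoker hL (fun F => ?_)
        (mem_orthogonal_vtxKer_iff.1 k.fst.2)
      obtain ⟨m, hm⟩ := exists_trace_eq (opSqrt L F : Γ.Gmax)
      rw [ContinuousLinearMap.adjoint_inner_left, ← hm, inner_edgeIntegral_dMax (hker' g hg),
        hker g hg m F (by
          rw [hm]; exact Submodule.orthogonalProjectionOnto_mem_subspace_eq_self _)]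
    have h2 : ⟪Γ.edgeIntegral g, Γ.dMax ((k.fst : Γ.Gmax) - (p : Γ.Gmax))⟫_ℂ = 0 := by
      obtain ⟨m, hm⟩ := exists_trace_eq ((k.fst : Γ.Gmax) - (p : Γ.Gmax))
      rw [← hm, inner_edgeIntegral_dMax (hker' g hg), hker g hg m 0]
      rw [hm, map_sub, map_zero, Submodule.orthogonalProjectionOnto_mem_subspace_eq_self,
        sub_self]
    rw [← sub_add_cancel (k.fst : Γ.Gmax) (p : Γ.Gmax), map_add, inner_add_right, h1, h2, add_zero]
  · intro _ η hη
    obtain ⟨g, rfl, hg⟩ := exists_edgeIntegral_eq η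
    refine ⟨g, fun x => ?_, rfl⟩
    change ⟪g, Γ.deriv (domZeroProj.fn L x)⟫_ℂ = 0
    rw [hg, edgeIntegral_deriv]
    exact hη (WithLp.toLp 2 (⟨_, htr x⟩, 0))
  · intro _
    have := finiteDimensional_Gmax (Γ := Γ)
    refine ⟨⟨bddAbove_range_len, isClosed_range_of_finite L⟩, trivial, inferInstance,
      finiteDimensional_EdgeL2, ?_⟩
    have := finrank_add_finrank_orthogonal_Gmax (vtxKer L)
    rw [finrank_EdgeL2, finrank_withLp_prod]
    omega

end ZeroEnlargedProjection

/-! ### The 1-enlarged cases, without and with projection. -/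

section OneEnlarged

theorem norm_phiOneForm_le (y : WithLp 2 (Γ.L2 × G)) : ‖phiOneForm L y‖ ≤ ‖y‖ := by
  refine le_of_sq_le_sq ?_ (norm_nonneg _)
  rw [WithLp.prod_norm_sq_eq_of_L2, WithLp.prod_norm_sq_eq_of_L2, add_comm]
  have h1 : ‖Γ.edgeIntegral y.fst‖ ^ 2 ≤ ‖y.fst‖ ^ 2 := by
    gcongr; exact norm_edgeIntegral_le _
  have h2 : ‖(vtxKer L).orthogonalProjectionOnto (y.snd : Γ.Gmax)‖ ^ 2 ≤ ‖y.snd‖ ^ 2 := by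
    gcongr; exact (vtxKer L).norm_orthogonalProjectionOnto_apply_le _
  exact add_le_add h1 h2

theorem dense_H1max : Dense (Γ.H1max : Set Γ.L2) :=
  Submodule.dense_of_orthogonal fun _ hw => eq_zero_of_orthogonal_ker_trace fun m _ => hw m m.2

theorem isClosed_dOne : (dOne L).IsClosed := by
  refine LinearPMap.isClosed_of_tendsto fun x u v hu hv => ?_
  have hv₀ := ((WithLp.fstL 2 ℂ Γ.L2 G).continuous.tendsto v).comp hv
  have hv₁ := ((WithLp.sndL 2 ℂ Γ.L2 G).continuous.tendsto v).comp hv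
  obtain ⟨m, rfl, hm, ht⟩ := exists_tendsto_trace (m := x) hu hv₀
  have ht₁ := (((opSqrt L).comp G.orthogonalProjectionOnto).continuous.tendsto
    (Γ.trace m)).comp ht
  exact ⟨m, rfl, WithLp.prod_ext hm (tendsto_nhds_unique ht₁ hv₁)⟩

theorem isClosed_dOneProj : (dOneProj L).IsClosed := by
  refine LinearPMap.isClosed_of_tendsto fun x u v hu hv => ?_
  have hv₀ := ((WithLp.fstL 2 ℂ Γ.L2 G).continuous.tendsto v).comp hv
  have hv₁ := ((WithLp.sndL 2 ℂ Γ.L2 G).continuous.tendsto v).comp hv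
  obtain ⟨m, rfl, hm, ht⟩ :=
    exists_tendsto_trace (m := fun n => H1G.toH1max Γ G (x n)) hu hv₀
  obtain ⟨y, rfl⟩ := exists_H1G (isClosed_coe.mem_of_tendsto ht
    (Eventually.of_forall fun n => Γ.trace_mem_of_mem_H1G G (x n)))
  have ht' : Tendsto (fun n => Γ.traceG G (x n)) atTop (𝓝 (Γ.traceG G y)) :=
    tendsto_subtype_rng.2 ht
  exact ⟨y, rfl, WithLp.prod_ext hm
    (tendsto_nhds_unique (((opSqrt L).continuous.tendsto _).comp ht') hv₁)⟩

/-- This is `𝒢₁ᗮ = 𝒢₀ ⊕ 𝒢ᗮ`. -/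
theorem mem_orthogonal_vtxCoker_iff {F : Γ.Gmax} :
    F ∈ (vtxCoker L)ᗮ ↔ (G.orthogonalProjectionOnto F : Γ.Gmax) ∈ vtxKer L := by
  have key : ∀ y ∈ vtxCoker L, ⟪y, (G.orthogonalProjectionOnto F : Γ.Gmax)⟫_ℂ = ⟪y, F⟫_ℂ :=
    fun y hy => Submodule.inner_orthogonalProjectionOnto_eq_of_mem_left
      (⟨y, vtxCoker_le L hy⟩ : G) F
  constructor
  · refine fun h => mem_vtxKer_of_mem_orthogonal (SetLike.coe_mem _)
      ((Submodule.mem_orthogonal _ _).2 fun y hy => ?_)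
    rw [key y hy, (Submodule.mem_orthogonal _ _).1 h y hy]
  · refine fun h => (Submodule.mem_orthogonal _ _).2 fun y hy => ?_
    rw [← key y hy, ← inner_conj_symm, inner_vtxKer_vtxCoker h hy, map_zero]

/-- The kernel of `Φ₁` on the pairs `(g, K)` with `d* (g, K) = 0` is trivial. -/
theorem eq_zero_of_phiOneForm_eq_zero (hL : L.IsPositive) {y : WithLp 2 (Γ.L2 × G)}
    (h : ∀ m : Γ.H1max, Γ.trace m ∈ G →
      ⟪y.fst, Γ.deriv m⟫_ℂ + ⟪(opSqrt L y.snd : Γ.Gmax), Γ.trace m⟫_ℂ = 0)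
    (hy : phiOneForm L y = 0) : y = 0 := by
  have h1 : y.fst = 0 := eq_zero_of_edgeIntegral_eq_zero (fun m hm => by
    simpa [hm] using h m (hm ▸ G.zero_mem)) (congrArg WithLp.snd hy)
  -- Once `g = 0`, testing with an extension of `L^{1/2} K`, where `K` is the vertex component of
  -- `y`, yields `‖L^{1/2} K‖² = 0`. Its boundary values lie in `𝒢`, so it is admissible in both
  -- 1-enlarged cases.
  obtain ⟨m, hm⟩ := exists_trace_eq (opSqrt L y.snd : Γ.Gmax)
  have h2 := h m (hm ▸ SetLike.coe_mem _)
  rw [h1, inner_zero_left, zero_add, hm, inner_self_eq_zero] at h2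
  exact WithLp.prod_ext h1 (Subtype.ext (eq_zero_of_mem_vtxKer_of_proj
    ((opSqrt_eq_zero_iff_mem hL).1 (Subtype.ext h2)) (congrArg WithLp.fst hy)))

/-- The index theorem in the `1`-enlarged case. -/
theorem indexTheorem_one (hL : L.IsPositive) :
    Γ.IndexTheorem (dOne L) LinearMap.id (discOne L) (phiOne₀ L) (phiOne₁ L)
      (BddAbove (range Γ.len)) (IsClosed (range L))
      ((Nat.card E : ℤ) - Module.finrank ℂ G) := by
  have hinner : ∀ (y : WithLp 2 (Γ.L2 × G)) (m : Γ.H1max), ⟪y, dOne L m⟫_ℂ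
      = ⟪y.fst, Γ.deriv m⟫_ℂ + ⟪(opSqrt L y.snd : Γ.Gmax), Γ.trace m⟫_ℂ := fun y m => by
    rw [WithLp.prod_inner_apply,
      ← Submodule.inner_orthogonalProjectionOnto_eq_of_mem_left, inner_opSqrt_left]
    rfl
  have hker' : ∀ y : WithLp 2 (Γ.L2 × G), (∀ m, ⟪y, dOne L m⟫_ℂ = 0) →
      ∀ m : Γ.H1max, Γ.trace m = 0 → ⟪y.fst, Γ.deriv m⟫_ℂ = 0 := fun y hy m hm => by
    simpa [hm] using (hinner y m).symm.trans (hy m)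
  -- Unlike in the 0-enlarged cases, the projection in `Φ₀` need not fix all boundary values in the
  -- domain; it does so on `ker d`.
  have htr : ∀ m : Γ.H1max, dOne L m = 0 → Γ.trace m ∈ (vtxCoker L)ᗮ := fun m hm =>
    mem_orthogonal_vtxCoker_iff.2 ((opSqrt_eq_zero_iff_mem hL).1 (congrArg WithLp.snd hm))
  have hphi : ∀ m : Γ.H1max, dOne L m = 0 → (phiOne₀ L m : Γ.Gmax) = Γ.trace m := fun m hm =>
    Submodule.coe_orthogonalProjectionOnto_of_mem (htr m hm)
  refine IndexTheorem.of_kernels Γ (phiOneForm L) ⟨dense_H1max, isClosed_dOne⟩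
    ?_ norm_phiOneForm_le (fun _ hx => congrArg WithLp.fst hx) ?_ ?_ ?_ ?_
    (fun y hy => eq_zero_of_phiOneForm_eq_zero hL fun m _ => (hinner y m).symm.trans (hy m)) ?_ ?_
  · intro ℓ₀ h0 h1 hl m
    refine le_trans ?_ (norm_trace_sq_le h0 h1 hl m)
    gcongr
    exact (vtxCoker L)ᗮ.norm_orthogonalProjectionOnto_apply_le _
  · intro (m : Γ.H1max) hm
    refine WithLp.prod_ext rfl ?_
    change Γ.dMax (phiOne₀ L m : Γ.Gmax) = 0
    have hm' : Γ.deriv m = 0 := congrArg WithLp.fst hm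
    rw [hphi m hm, ← edgeIntegral_deriv, hm', map_zero]
  · intro m hm h
    refine eq_zero_of_deriv_of_trace (congrArg WithLp.fst hm) ?_
    rw [← hphi m hm, h]
    rfl
  · intro hb F hF
    obtain ⟨m, hm, hmF⟩ := exists_deriv_eq_zero hb (F := (F : Γ.Gmax)) (congrArg WithLp.snd hF)
    have hd : dOne L m = 0 :=
      WithLp.prod_ext hm ((opSqrt_eq_zero_iff_mem hL).2
        (mem_orthogonal_vtxCoker_iff.1 (hmF ▸ F.2)))
    exact ⟨m, hd, Subtype.ext ((hphi m hd).trans hmF)⟩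
  · intro y hy F
    obtain ⟨m, hm⟩ := exists_trace_eq (F : Γ.Gmax)
    have h1 := (hinner y m).symm.trans (hy m)
    -- The vertex term drops out, since `L^{1/2}` maps into `𝒢₁` and `F` is orthogonal to `𝒢₁`.
    rw [hm, (Submodule.mem_orthogonal _ _).1 F.2 _ (opSqrt_mem_vtxCoker hL y.snd), add_zero,
      ← inner_edgeIntegral_dMax (hker' y hy), hm] at h1
    change ⟪_, (0 : vtxKer L)⟫_ℂ + ⟪Γ.edgeIntegral y.fst, Γ.dMax (F : Γ.Gmax)⟫_ℂ = 0
    rw [h1, inner_zero_right, add_zero]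
  · intro hr η hη
    obtain ⟨g, hgη, hg⟩ := exists_edgeIntegral_eq η.snd
    -- The vertex component must satisfy `L^{1/2} K = -dMax* η`, to cancel the pairing `⟪η, dMax
    -- f̲⟫`. The discrete condition on `η` puts the right side in `𝒢₁ᗮᗮ = 𝒢₁`, where closed range
    -- makes the equation solvable.
    have h1 : -ContinuousLinearMap.adjoint Γ.dMax η.snd ∈ vtxCoker L := by
      rw [← (vtxCoker L).orthogonal_orthogonal, Submodule.mem_orthogonal']
      intro F hF
      have h2 : ⟪η.fst, (0 : vtxKer L)⟫_ℂ + ⟪η.snd, Γ.dMax F⟫_ℂ = 0 := hη ⟨F, hF⟩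
      rw [inner_zero_right, zero_add] at h2
      rw [inner_neg_left, ContinuousLinearMap.adjoint_inner_left, h2, neg_zero]
    obtain ⟨K, hK, hK'⟩ := exists_opSqrt_eq_of_mem_vtxCoker hL hr h1
    let K₀ : G := ⟨η.fst, vtxKer_le L η.fst.2⟩
    have hK₀ : opSqrt L K₀ = 0 := (opSqrt_eq_zero_iff_mem hL).2 η.fst.2
    refine ⟨WithLp.toLp 2 (g, K + K₀), fun (m : Γ.H1max) => (hinner _ m).trans ?_, WithLp.prod_ext ?_ hgη⟩
    · change ⟪g, Γ.deriv m⟫_ℂ + ⟪(opSqrt L (K + K₀) : Γ.Gmax), Γ.trace m⟫_ℂ = 0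
      rw [map_add, hK₀, add_zero, hK, hg, edgeIntegral_deriv, inner_neg_left,
        ContinuousLinearMap.adjoint_inner_left, add_neg_cancel]
    · change (vtxKer L).orthogonalProjectionOnto ((K + K₀ : G) : Γ.Gmax) = η.fst
      rw [Submodule.coe_add, map_add, proj_vtxKer_of_mem_vtxCoker hK', zero_add]
      exact Submodule.orthogonalProjectionOnto_mem_subspace_eq_self _
  · intro _
    have := finiteDimensional_Gmax (Γ := Γ)
    have := finiteDimensional_EdgeL2 (Γ := Γ)
    refine ⟨bddAbove_range_len, isClosed_range_of_finite L, inferInstance, inferInstance, ?_⟩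
    have h1 := finrank_add_finrank_orthogonal_Gmax (vtxCoker L)
    have h2 := finrank_vtxKer_add_finrank_vtxCoker L
    rw [finrank_withLp_prod, finrank_EdgeL2]
    -- `dim 𝒢₁ᗮ - dim 𝒢₀ - |E| = 2|E| - dim 𝒢₁ - dim 𝒢₀ - |E| = |E| - dim 𝒢`.
    omega

/-- The index theorem in the `1`-enlarged case with projection. -/
theorem indexTheorem_oneProj (hL : L.IsPositive) :
    Γ.IndexTheorem (dOneProj L) (H1G.toH1max Γ G) (discOneProj L)
      (phiOneProj₀ L) (phiOneProj₁ L)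
      (BddAbove (range Γ.len)) (IsClosed (range L)) (-(Nat.card E : ℤ)) := by
  have hinner : ∀ (y : WithLp 2 (Γ.L2 × G)) (x : Γ.H1G G), ⟪y, dOneProj L x⟫_ℂ
      = ⟪y.fst, Γ.deriv (H1G.toH1max Γ G x)⟫_ℂ
        + ⟪(opSqrt L y.snd : Γ.Gmax), Γ.trace (H1G.toH1max Γ G x)⟫_ℂ := fun y x => by
    rw [WithLp.prod_inner_apply]
    change _ + ⟪y.snd, opSqrt L (Γ.traceG G x)⟫_ℂ = _
    rw [← inner_opSqrt_left]
    rfl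
  have hker : ∀ y : WithLp 2 (Γ.L2 × G), (∀ x, ⟪y, dOneProj L x⟫_ℂ = 0) →
      ∀ m : Γ.H1max, Γ.trace m ∈ G →
        ⟪y.fst, Γ.deriv m⟫_ℂ + ⟪(opSqrt L y.snd : Γ.Gmax), Γ.trace m⟫_ℂ = 0 :=
    fun y hy m hm => by
      obtain ⟨x, rfl⟩ := exists_H1G hm
      exact (hinner y x).symm.trans (hy x)
  have hker' : ∀ y : WithLp 2 (Γ.L2 × G), (∀ x, ⟪y, dOneProj L x⟫_ℂ = 0) →
      ∀ m : Γ.H1max, Γ.trace m = 0 → ⟪y.fst, Γ.deriv m⟫_ℂ = 0 := fun y hy m hm => by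
    simpa [hm] using hker y hy m (hm ▸ G.zero_mem)
  have htr : ∀ x : Γ.H1G G, dOneProj L x = 0 →
      Γ.trace (H1G.toH1max Γ G x) ∈ vtxKer L := fun x hx =>
    (opSqrt_eq_zero_iff_mem hL (x := Γ.traceG G x)).1 (congrArg WithLp.snd hx)
  have hphi : ∀ x : Γ.H1G G, dOneProj L x = 0 →
      (phiOneProj₀ L x : Γ.Gmax) = Γ.trace (H1G.toH1max Γ G x) := fun x hx =>
    Submodule.coe_orthogonalProjectionOnto_of_mem (htr x hx)
  refine IndexTheorem.of_kernels Γ (phiOneForm L) ⟨dense_H1G, isClosed_dOneProj⟩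
    ?_ norm_phiOneForm_le (fun _ hx => congrArg WithLp.fst hx) ?_ ?_ ?_ ?_
    (fun y hy => eq_zero_of_phiOneForm_eq_zero hL (hker y hy)) ?_ ?_
  · intro ℓ₀ h0 h1 hl x
    refine le_trans ?_ (norm_trace_sq_le h0 h1 hl (H1G.toH1max Γ G x))
    gcongr
    exact (vtxKer L).norm_orthogonalProjectionOnto_apply_le _
  · intro x hx
    refine WithLp.prod_ext rfl ?_
    change Γ.dMax (phiOneProj₀ L x : Γ.Gmax) = 0
    have hx' : Γ.deriv (H1G.toH1max Γ G x) = 0 := congrArg WithLp.fst hx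
    rw [hphi x hx, ← edgeIntegral_deriv, hx', map_zero]
  · intro x hx h
    have h1 : H1G.toH1max Γ G x = 0 := by
      refine eq_zero_of_deriv_of_trace (congrArg WithLp.fst hx) ?_
      rw [← hphi x hx, h]
      rfl
    exact Subtype.ext (congrArg Subtype.val h1 :)
  · intro hb F hF
    obtain ⟨m, hm, hmF⟩ := exists_deriv_eq_zero hb (F := (F : Γ.Gmax)) (congrArg WithLp.snd hF)
    obtain ⟨x, rfl⟩ := exists_H1G (m := m) (hmF ▸ vtxKer_le L F.2)
    have hd : dOneProj L x = 0 :=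
      WithLp.prod_ext hm ((opSqrt_eq_zero_iff_mem hL (x := Γ.traceG G x)).2 (hmF ▸ F.2 :))
    exact ⟨x, hd, Subtype.ext ((hphi x hd).trans hmF)⟩
  · intro y hy F
    obtain ⟨m, hm⟩ := exists_trace_eq (F : Γ.Gmax)
    have h1 := hker y hy m (hm ▸ vtxKer_le L F.2)
    rw [hm, ← inner_conj_symm _ (F : Γ.Gmax),
      inner_vtxKer_vtxCoker F.2 (opSqrt_mem_vtxCoker hL y.snd), map_zero, add_zero,
      ← inner_edgeIntegral_dMax (hker' y hy), hm] at h1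
    change ⟪_, (0 : vtxKer L)⟫_ℂ + ⟪Γ.edgeIntegral y.fst, Γ.dMax (F : Γ.Gmax)⟫_ℂ = 0
    rw [h1, inner_zero_right, add_zero]
  · intro hr η hη
    obtain ⟨g, hgη, hg⟩ := exists_edgeIntegral_eq η.snd
    set w : Γ.Gmax := -ContinuousLinearMap.adjoint Γ.dMax η.snd with hw
    -- Here `w` is only known to lie in `𝒢₀ᗮ`. The equation `L^{1/2} K = P w` is solved instead,
    -- which suffices because boundary values in `𝒢` do not distinguish `w` from `P w`.
    have h1 : w ∈ (vtxKer L)ᗮ := by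
      rw [Submodule.mem_orthogonal']
      intro F hF
      have h2 : ⟪η.fst, (0 : vtxKer L)⟫_ℂ + ⟪η.snd, Γ.dMax F⟫_ℂ = 0 := hη ⟨F, hF⟩
      rw [inner_zero_right, zero_add] at h2
      rw [hw, inner_neg_left, ContinuousLinearMap.adjoint_inner_left, h2, neg_zero]
    obtain ⟨K, hK, hK'⟩ :=
      exists_opSqrt_eq_of_mem_vtxCoker hL hr (mem_orthogonal_vtxKer_iff.1 h1)
    let K₀ : G := ⟨η.fst, vtxKer_le L η.fst.2⟩
    have hK₀ : opSqrt L K₀ = 0 := (opSqrt_eq_zero_iff_mem hL).2 η.fst.2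
    refine ⟨WithLp.toLp 2 (g, K + K₀), fun x => (hinner _ x).trans ?_, WithLp.prod_ext ?_ hgη⟩
    · change ⟪g, Γ.deriv (H1G.toH1max Γ G x)⟫_ℂ
        + ⟪(opSqrt L (K + K₀) : Γ.Gmax), Γ.trace (H1G.toH1max Γ G x)⟫_ℂ = 0
      have h3 : ⟪(G.orthogonalProjectionOnto w : Γ.Gmax), Γ.trace (H1G.toH1max Γ G x)⟫_ℂ
          = ⟪w, Γ.trace (H1G.toH1max Γ G x)⟫_ℂ :=
        Submodule.inner_orthogonalProjectionOnto_eq_of_mem_right (Γ.traceG G x) w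
      rw [map_add, hK₀, add_zero, hK, h3, hw, hg, edgeIntegral_deriv, inner_neg_left,
        ContinuousLinearMap.adjoint_inner_left, add_neg_cancel]
    · change (vtxKer L).orthogonalProjectionOnto ((K + K₀ : G) : Γ.Gmax) = η.fst
      rw [Submodule.coe_add, map_add, proj_vtxKer_of_mem_vtxCoker hK', zero_add]
      exact Submodule.orthogonalProjectionOnto_mem_subspace_eq_self _
  · intro _
    have := finiteDimensional_Gmax (Γ := Γ)
    have := finiteDimensional_EdgeL2 (Γ := Γ)
    refine ⟨bddAbove_range_len, isClosed_range_of_finite L, inferInstance, inferInstance, ?_⟩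
    rw [finrank_withLp_prod, finrank_EdgeL2]
    push_cast
    ring

end OneEnlarged

end MetricGraph

theorem theorem6p1 {V E : Type*} (Γ : MetricGraph V E)
    (G : Submodule ℂ Γ.Gmax) [CompleteSpace G] (L : G →L[ℂ] G) (hL : L.IsPositive) :
    Γ.IndexTheorem (Γ.dSimple G) (MetricGraph.H1G.toH1max Γ G) (Γ.dDisc G)
      (Γ.phiSimple₀ G) (Γ.phiSimple₁ G)
      (BddAbove (Set.range Γ.len)) True
      ((Module.finrank ℂ G : ℤ) - Nat.card E) ∧
    Γ.IndexTheorem (MetricGraph.dZero L) (MetricGraph.domZero.fn L) (MetricGraph.discZero L)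
      (MetricGraph.phiZero₀ L) (MetricGraph.phiZero₁ L)
      (BddAbove (Set.range Γ.len) ∧ IsClosed (Set.range L)) True
      ((Module.finrank ℂ G : ℤ) - Nat.card E) ∧
    Γ.IndexTheorem (MetricGraph.dZeroProj L) (MetricGraph.domZeroProj.fn L)
      (MetricGraph.discZeroProj L)
      (MetricGraph.phiZeroProj₀ L) (MetricGraph.phiZeroProj₁ L)
      (BddAbove (Set.range Γ.len) ∧ IsClosed (Set.range L)) True
      (Nat.card E : ℤ) ∧
    Γ.IndexTheorem (MetricGraph.dOne L) LinearMap.id (MetricGraph.discOne L)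
      (MetricGraph.phiOne₀ L) (MetricGraph.phiOne₁ L)
      (BddAbove (Set.range Γ.len)) (IsClosed (Set.range L))
      ((Nat.card E : ℤ) - Module.finrank ℂ G) ∧
    Γ.IndexTheorem (MetricGraph.dOneProj L) (MetricGraph.H1G.toH1max Γ G)
      (MetricGraph.discOneProj L)
      (MetricGraph.phiOneProj₀ L) (MetricGraph.phiOneProj₁ L)
      (BddAbove (Set.range Γ.len)) (IsClosed (Set.range L))
      (-(Nat.card E : ℤ)) :=
  ⟨MetricGraph.indexTheorem_simple G, MetricGraph.indexTheorem_zero hL,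
    MetricGraph.indexTheorem_zeroProj hL, MetricGraph.indexTheorem_one hL,
    MetricGraph.indexTheorem_oneProj hL⟩
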